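/- Conventions. $\Sigma$ is a finite alphabet with a total order $\preceq$. An NFA $\mathcal{A}=(Q,E,s,F)$ has a finite set of states $Q$, edges $E\subseteq Q\times Q\times\Sigma$, an initial state $s\in Q$ and final states $F\subseteq Q$; every state is assumed to be reachable from $s$ and to reach a final state. If $\le$ is a total order on $Q$, then $(\mathcal{A},\le)$ is a Wheeler NFA if (1) $s\le u$ for every $u\in Q$; (2) if $(u,v,a),(u',v',b)\in E$ and $v<v'$, then $a\preceq b$; (3) if $(u,v,a),(u',v',a)\in E$ and $v<v'$, then $u\le u'$. A Wheeler bisimulation from $(\mathcal{A},\le)$ to $(\mathcal{A}',\le')$ is a relation $R\subseteq Q\times Q'$ such that: $s\,R\,s'$; if $u\,R\,u'$, then $u\in F\Leftrightarrow u'\in F'$; if $u\,R\,u'$ and $(u,v,a)\in E$, then there is $v'$ with $v\,R\,v'$ and $(u',v',a)\in E'$; if $u\,R\,u'$ and $(u',v',a)\in E'$, then there is $v$ with $v\,R\,v'$ and $(u,v,a)\in E$; and the image under $R$ of every $\le$-convex set is $\le'$-convex, and the preimage under $R$ of every $\le'$-convex set is $\le$-convex. Model of computation. A word RAM has words of $w$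 bits and executes in unit time each elementary instruction (assignment, array access, arithmetic, comparison, bitwise operation, test); its memory is zero outside the input. A Wheeler NFA is given by $|Q|$, $|E|$, the list of its edges in any order without repetitions (each state being represented by its position in the order $\le$, and each character by a $w$-bit word, so that the order of the words is that of the characters), and the bit array of the final states. For each $w$ let $\mathfrak{L}_w$ be a set of finite sequences of $w$-bit words. We say that the sequences in $\mathfrak{L}=(\mathfrak{L}_w)_w$ can be sorted in linear time if there are a program and constants $K_0,C_0$ such that, for all $w$ and all $\ell\in\mathfrak{L}_w$ with $K_0(|\ell|+1)\le 2^w$, the program, given $\ell$, computes in at most $C_0(|\ell|+1)$ steps a permutation of the positions of $\ell$ that sorts $\ell$. Statement. Assume that the sequences in $\mathfrak{L}$ can be sorted in linear time. Then there are a word RAM program and constants $K,C$ such that the following holds. For all finite ordered alphabets, all Wheeler NFAs $(\mathcal{A},\le)$ and $(\mathcal{A}',\le')$ with $\mathcal{A}=(Q,E,s,F)$ and $\mathcal{A}'=(Q',E',s',F')$, and all word lengths $w$ with $K(|E|+|E'|+1)\le 2^w$, if the sequence of the edge labels in the input (those of $\mathcal{A}$ followed by those of $\mathcal{A}'$) belongs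 to $\mathfrak{L}_w$, then the program, given $(\mathcal{A},\le)$ and $(\mathcal{A}',\le')$, halts after at most $C(|E|+|E'|+1)$ steps, with output $1$ if there exists a Wheeler bisimulation from $(\mathcal{A},\le)$ to $(\mathcal{A}',\le')$ and with output $0$ otherwise. In other words, it can be decided in $O(|E|+|E'|)$ time whether a Wheeler bisimulation exists, provided that the edge labels can be sorted in linear time. -/

import Mathlib

namespace WheelerBisim

/-! ### Automata, Wheeler automata, Wheeler bisimulations -/

/-- A nondeterministic finite automaton with set of states `Q` over the alphabet `σ`: the set of
edges `(u, v, a)` (from `u` to `v`, labeled `a`), one initial state, the set of final states. -/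
structure Automaton (Q σ : Type*) where
  edges : Finset (Q × Q × σ)
  start : Q
  final : Finset Q

namespace Automaton

variable {Q Q' σ : Type*}

/-- There is an edge from `u` to `v`. -/
def Step (A : Automaton Q σ) (u v : Q) : Prop := ∃ a, (u, v, a) ∈ A.edges

/-- Every state is reachable from the initial state and can reach a final state. -/
def IsTrim (A : Automaton Q σ) : Prop :=
  ∀ u, Relation.ReflTransGen A.Step A.start u ∧
    ∃ f ∈ A.final, Relation.ReflTransGen A.Step u f

/-- The automaton, together with the total order on its states, is a Wheeler NFA. -/
structure IsWheeler [LinearOrder Q] [LinearOrder σ] (A : Automaton Q σ) : Prop where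
  trim : A.IsTrim
  start_le : ∀ u, A.start ≤ u
  label_le : ∀ u v u' v' a b, (u, v, a) ∈ A.edges → (u', v', b) ∈ A.edges → v < v' → a ≤ b
  source_le : ∀ u v u' v' a, (u, v, a) ∈ A.edges → (u', v', a) ∈ A.edges → v < v' → u ≤ u'

/-- `R` is a bisimulation from `A` to `A'`. -/
structure IsBisimulation (A : Automaton Q σ) (A' : Automaton Q' σ) (R : Q → Q' → Prop) :
    Prop where
  forth : ∀ u v u' a, R u u' → (u, v, a) ∈ A.edges → ∃ v', R v v' ∧ (u', v', a) ∈ A'.edges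
  back : ∀ u u' v' a, R u u' → (u', v', a) ∈ A'.edges → ∃ v, R v v' ∧ (u, v, a) ∈ A.edges
  start : R A.start A'.start
  final : ∀ u u', R u u' → (u ∈ A.final ↔ u' ∈ A'.final)

/-- `R` is a Wheeler bisimulation from `A` to `A'`: a bisimulation such that images and preimages
of convex sets are convex (`Set.OrdConnected` is convexity with respect to the order). -/
structure IsWheelerBisimulation [LinearOrder Q] [LinearOrder Q'] (A : Automaton Q σ)
    (A' : Automaton Q' σ) (R : Q → Q' → Prop) : Prop where
  bisim : A.IsBisimulation A' R
  image_convex : ∀ D : Set Q, D.OrdConnected → {u' | ∃ u ∈ D, R u u'}.OrdConnected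
  preimage_convex : ∀ D' : Set Q', D'.OrdConnected → {u | ∃ u' ∈ D', R u u'}.OrdConnected

end Automaton

/-! ### The word RAM -/

/-- The binary operations of the machine. -/
inductive BinOp
  | add | sub | mul | div | mod | land | lor | lxor | shl | shr | lt | eq

/-- The value of an operation, before it is reduced to a machine word. -/
def BinOp.eval : BinOp → ℕ → ℕ → ℕ
  | .add, y, z => y + z
  | .sub, y, z => y - z
  | .mul, y, z => y * z
  | .div, y, z => y / z
  | .mod, y, z => y % z
  | .land, y, z => y &&& z
  | .lor, y, z => y ||| z
  | .lxor, y, z => y ^^^ z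
  | .shl, y, z => y <<< z
  | .shr, y, z => y >>> z
  | .lt, y, z => if y < z then 1 else 0
  | .eq, y, z => if y = z then 1 else 0

/-- Programs, in structured form. Registers and arrays are named by natural numbers; a program
mentions only finitely many of them. -/
inductive Cmd
  | skip
  /-- register `x` := the constant `n` -/
  | const (x n : ℕ)
  /-- register `x` := register `y` `o` register `z` -/
  | binop (o : BinOp) (x y z : ℕ)
  /-- register `x` := entry of array `a` at the index in register `y` -/
  | load (x a y : ℕ)
  /-- entry of array `a` at the index in register `y` := register `x` -/
  | store (a y x : ℕ)
  | seq (c d : Cmd)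
  /-- if register `x` is nonzero then `c` else `d` -/
  | ite (x : ℕ) (c d : Cmd)
  /-- while register `x` is nonzero do `c` -/
  | loop (x : ℕ) (c : Cmd)

/-- The contents of the memory: the registers and the arrays. -/
structure Mem where
  reg : ℕ → ℕ
  arr : ℕ → ℕ → ℕ

/-- Write the value `n` into register `x`. -/
def Mem.setReg (s : Mem) (x n : ℕ) : Mem :=
  { s with reg := Function.update s.reg x n }

/-- Write the value `n` into entry `i` of array `a`. -/
def Mem.setArr (s : Mem) (a i n : ℕ) : Mem :=
  { s with arr := Function.update s.arr a (Function.update (s.arr a) i n) }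

/-- `Exec w c s s' t`: on the machine with words of `w` bits, the program `c`, started with memory
`s`, halts after exactly `t` steps with memory `s'`. Every elementary instruction and every test of
a condition takes one step; results are reduced modulo `2 ^ w`. -/
inductive Exec (w : ℕ) : Cmd → Mem → Mem → ℕ → Prop
  | skip (s : Mem) : Exec w .skip s s 1
  | const (x n : ℕ) (s : Mem) : Exec w (.const x n) s (s.setReg x (n % 2 ^ w)) 1
  | binop (o : BinOp) (x y z : ℕ) (s : Mem) :
      Exec w (.binop o x y z) s (s.setReg x (o.eval (s.reg y) (s.reg z) % 2 ^ w)) 1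
  | load (x a y : ℕ) (s : Mem) : Exec w (.load x a y) s (s.setReg x (s.arr a (s.reg y))) 1
  | store (a y x : ℕ) (s : Mem) : Exec w (.store a y x) s (s.setArr a (s.reg y) (s.reg x)) 1
  | seq {c d : Cmd} {s s' s'' : Mem} {t t' : ℕ} :
      Exec w c s s' t → Exec w d s' s'' t' → Exec w (.seq c d) s s'' (t + t')
  | ite_true {x : ℕ} {c d : Cmd} {s s' : Mem} {t : ℕ} :
      s.reg x ≠ 0 → Exec w c s s' t → Exec w (.ite x c d) s s' (t + 1)
  | ite_false {x : ℕ} {c d : Cmd} {s s' : Mem} {t : ℕ} :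
      s.reg x = 0 → Exec w d s s' t → Exec w (.ite x c d) s s' (t + 1)
  | loop_false {x : ℕ} {c : Cmd} {s : Mem} :
      s.reg x = 0 → Exec w (.loop x c) s s 1
  | loop_true {x : ℕ} {c : Cmd} {s s' s'' : Mem} {t t' : ℕ} :
      s.reg x ≠ 0 → Exec w c s s' t → Exec w (.loop x c) s' s'' t' →
        Exec w (.loop x c) s s'' (t + t' + 1)

/-- The memory with the given first registers and first arrays, and zero everywhere else. -/
def Mem.ofInput (regs : List ℕ) (arrs : List (List ℕ)) : Mem where
  reg x := regs.getD x 0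
  arr a i := (arrs.getD a []).getD i 0

/-! ### Sorting in linear time -/

/-- The first entries of `f` list a permutation of the positions of `l` along which the entries of
`l` are in nondecreasing order. -/
def IsSortingOf (f : ℕ → ℕ) (l : List ℕ) : Prop :=
  ∃ π : Equiv.Perm (Fin l.length),
    (∀ i : Fin l.length, f i = π i) ∧ Monotone fun i => l.get (π i)

/-- Sequences of words can be sorted in linear time if, on machines with words of `w` bits, they
belong to `𝓛 w`: one program does so for every `w` such that `2 ^ w` is at least a constant times
the length of the sequence. Input: the length in register `0` and the sequence in array `0`.
Output: in array `1`, the positions of the sequence in sorted order. -/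
def SortableInLinearTime (𝓛 : ℕ → Set (List ℕ)) : Prop :=
  ∃ (S : Cmd) (K C : ℕ), ∀ (w : ℕ) (l : List ℕ), l ∈ 𝓛 w → (∀ a ∈ l, a < 2 ^ w) →
    K * (l.length + 1) ≤ 2 ^ w →
    ∃ (s : Mem) (t : ℕ), Exec w S (Mem.ofInput [l.length] [l]) s t ∧
      t ≤ C * (l.length + 1) ∧ IsSortingOf (s.arr 1) l

/-! ### Wheeler automata as input -/

/-- The position (from `0`) of a state in the order. -/
def rank {Q : Type*} [Fintype Q] [LinearOrder Q] (u : Q) : ℕ :=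
  (Finset.univ.filter (· < u)).card

namespace Automaton

variable {Q σ : Type*}

/-- `L` lists every edge of `A` exactly once, in any order. -/
def IsEdgeList (A : Automaton Q σ) (L : List (Q × Q × σ)) : Prop :=
  L.Nodup ∧ ∀ e, e ∈ L ↔ e ∈ A.edges

/-- The codes of the labels of a list of edges. -/
def labels (code : σ → ℕ) (L : List (Q × Q × σ)) : List ℕ := L.map fun e => code e.2.2

/-- The bit array that marks the final states, the states being taken in increasing order: entry `i` is `1`
exactly if the state in position `i` is final. -/
def finalBits [Fintype Q] [LinearOrder Q] (A : Automaton Q σ) : List ℕ :=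
  (List.range (Fintype.card Q)).map fun i => if ∃ u ∈ A.final, rank u = i then 1 else 0

/-- The arrays that represent a Wheeler NFA: sources, targets and labels of the edges, where a state
is represented by its position in the order, and the bit array of final states. The initial state
need not be represented, since it is always the state in position `0`. -/
def arrays [Fintype Q] [LinearOrder Q] (A : Automaton Q σ) (code : σ → ℕ)
    (L : List (Q × Q × σ)) : List (List ℕ) :=
  [L.map fun e => rank e.1, L.map fun e => rank e.2.1, labels code L, A.finalBits]

/-- The memory that holds a pair of Wheeler NFAs: their numbers of states and edges in registers
`0` to `3`, their arrays in arrays `0` to `7`. -/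
def inputPair {Q' : Type*} [Fintype Q] [LinearOrder Q] [Fintype Q'] [LinearOrder Q']
    (A : Automaton Q σ) (A' : Automaton Q' σ) (code : σ → ℕ)
    (L : List (Q × Q × σ)) (L' : List (Q' × Q' × σ)) : Mem :=
  Mem.ofInput [Fintype.card Q, A.edges.card, Fintype.card Q', A'.edges.card]
    (A.arrays code L ++ A'.arrays code L')

end Automaton

end WheelerBisim

namespace WheelerBisim

/-! ### The combinatorial core -/

/-! Put the two automata side by side. Among the partitions of the states into convex classes that
respect the two automata, the final states and the outgoing edges, there is a coarsest one. A
Wheeler bisimulation exists exactly if the two quotients by it coincide, once the classes of each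
automaton are numbered in increasing order.

The partition is described by its boundaries `Bd`. A boundary is forced between neighbours that
differ in finality or in their outgoing labels. Moreover, a boundary between `v` and `v + 1` forces
others. By the Wheeler axioms labels, and for equal labels sources, grow with the targets, so a
label that enters both `v` and `v + 1` is the largest one into `v` and the smallest one into `v +
1`. Let `e` be the last edge into `v` and `f` the first edge into `v + 1` in the order by label,
then source, and let their labels agree. Edges with this label from sources below `src f` end at `v`
or before, and those from sources above `src e` end at `v + 1` or after. Hence there is a boundary
before `src f` and one after `src e`. Each boundary implies at most two others in this way, so a
queue closes the set of boundaries in linear time.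

These rules are necessary: no convex tolerance relates states across a boundary
(`IsConvexTolerance.not_of_bd`). They are also sufficient: lying in the same class is a bisimulation
(`SameClass.bisim`, by `IsClassMap.dst_of_not_bd`). If `R` is a Wheeler bisimulation, then going
through `R`, moving inside a class and coming back is a convex tolerance, so `R` matches classes
with classes one to one (`IsWB.class_eq_iff`); as `R` respects convexity and starts at the initial
states, matched classes have equal numbers (`IsWB.class_eq`). Conversely, if the quotients have the
same edges and final classes, relating states with equal class numbers gives a Wheeler bisimulation
(`exists_isWB_iff`).

For the running time, the assumed sorting program is used once, to replace labels by ranks that do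
not exceed the number of edges. All further sorting is stable counting sort. The quotients are
compared by sorting their edges so that equal ones become adjacent (`edgesAgree_iff`). Since every
state but the initial one has an incoming edge, the numbers of states are bounded by those of edges
(`IsTrim.card_le`). -/

/-- Two Wheeler NFAs side by side: the states of the first are the numbers below `n`, those of the
second the numbers from `n` to `N`; the edges of the first are those with index below `m`, those of
the second have indices from `m` to `M`. -/
structure EdgeData where
  n : ℕ
  m : ℕ
  N : ℕ
  M : ℕ
  src : ℕ → ℕ
  dst : ℕ → ℕ
  lab : ℕ → ℕ
  fin : ℕ → ℕ

namespace EdgeData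

/-- The two automata satisfy the Wheeler axioms, and all states are reachable. -/
structure IsJoint (J : EdgeData) : Prop where
  n_pos : 0 < J.n
  n_lt : J.n < J.N
  m_le : J.m ≤ J.M
  src_lt : ∀ e < J.M, J.src e < J.N
  dst_lt : ∀ e < J.M, J.dst e < J.N
  src_half : ∀ e < J.M, (J.src e < J.n ↔ e < J.m)
  dst_half : ∀ e < J.M, (J.dst e < J.n ↔ e < J.m)
  label_le : ∀ e < J.M, ∀ f < J.M, (e < J.m ↔ f < J.m) → J.dst e < J.dst f → J.lab e ≤ J.lab f
  source_le : ∀ e < J.M, ∀ f < J.M, (e < J.m ↔ f < J.m) → J.lab e = J.lab f →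
    J.dst e < J.dst f → J.src e ≤ J.src f
  reach : ∀ P : ℕ → Prop, P 0 → P J.n → (∀ e < J.M, P (J.src e) → P (J.dst e)) → ∀ v < J.N, P v

variable {J : EdgeData}

/-- `f` is the first edge into `v` in the order by label, then source. -/
def IsFirst (J : EdgeData) (f v : ℕ) : Prop :=
  f < J.M ∧ J.dst f = v ∧ ∀ g < J.M, J.dst g = v →
    J.lab f < J.lab g ∨ J.lab f = J.lab g ∧ J.src f ≤ J.src g

/-- `e` is the last edge into `v` in the order by label, then source. -/
def IsLast (J : EdgeData) (e v : ℕ) : Prop :=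
  e < J.M ∧ J.dst e = v ∧ ∀ g < J.M, J.dst g = v →
    J.lab g < J.lab e ∨ J.lab g = J.lab e ∧ J.src g ≤ J.src e

/-- The boundaries of the coarsest partition into convex classes that is stable: `J.Bd v` separates
`v - 1` from `v`. -/
inductive Bd (J : EdgeData) : ℕ → Prop
  | zero : Bd J 0
  | mid : Bd J J.n
  | top : Bd J J.N
  | fin (v : ℕ) : v + 1 < J.N → J.fin v ≠ J.fin (v + 1) → Bd J (v + 1)
  | left (e : ℕ) : e < J.M → (∀ g < J.M, J.lab g = J.lab e → J.src g + 1 ≠ J.src e) →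
      Bd J (J.src e)
  | right (e : ℕ) : e < J.M → (∀ g < J.M, J.lab g = J.lab e → J.src g ≠ J.src e + 1) →
      Bd J (J.src e + 1)
  | step_first (v e f : ℕ) : Bd J (v + 1) → v + 1 < J.N → v + 1 ≠ J.n → J.IsLast e v →
      J.IsFirst f (v + 1) → J.lab e = J.lab f → Bd J (J.src f)
  | step_last (v e f : ℕ) : Bd J (v + 1) → v + 1 < J.N → v + 1 ≠ J.n → J.IsLast e v →
      J.IsFirst f (v + 1) → J.lab e = J.lab f → Bd J (J.src e + 1)

/-- The initial states together with all targets of edges form a set that contains the initial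
states and is closed under edges, so reachability makes it everything. -/
theorem IsJoint.incoming (h : J.IsJoint) {v : ℕ} (hv : v < J.N) (h0 : v ≠ 0) (hn : v ≠ J.n) :
    ∃ e < J.M, J.dst e = v := by
  have := h.reach (fun v => v = 0 ∨ v = J.n ∨ ∃ e < J.M, J.dst e = v) (by simp) (by simp)
    (fun e he _ => Or.inr (Or.inr ⟨e, he, rfl⟩)) v hv
  tauto

theorem exists_isFirst {v : ℕ} (hv : ∃ e < J.M, J.dst e = v) : ∃ f, J.IsFirst f v := by
  obtain ⟨e, he, hev⟩ := hv
  obtain ⟨f, hf, hmin⟩ := Finset.exists_min_image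
    ((Finset.range J.M).filter (fun e => J.dst e = v)) (fun e => toLex (J.lab e, J.src e))
    ⟨e, by simp [he, hev]⟩
  simp only [Finset.mem_filter, Finset.mem_range, Prod.Lex.toLex_le_toLex, and_imp] at hf hmin
  exact ⟨f, hf.1, hf.2, hmin⟩

theorem exists_isLast {v : ℕ} (hv : ∃ e < J.M, J.dst e = v) : ∃ f, J.IsLast f v := by
  obtain ⟨e, he, hev⟩ := hv
  obtain ⟨f, hf, hmin⟩ := Finset.exists_max_image
    ((Finset.range J.M).filter (fun e => J.dst e = v)) (fun e => toLex (J.lab e, J.src e))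
    ⟨e, by simp [he, hev]⟩
  simp only [Finset.mem_filter, Finset.mem_range, Prod.Lex.toLex_le_toLex, and_imp] at hf hmin
  exact ⟨f, hf.1, hf.2, hmin⟩

/-! ### Convex tolerances cannot cross a boundary -/

/-- A symmetric and reflexive bisimulation with convex images of points, from the disjoint union of
the two automata to itself, that does not relate states of different automata. -/
structure IsConvexTolerance (J : EdgeData) (T : ℕ → ℕ → Prop) : Prop where
  refl : ∀ x < J.N, T x x
  symm : ∀ x y, T x y → T y x
  half : ∀ x y, T x y → x < J.N ∧ (x < J.n ↔ y < J.n)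
  fin : ∀ x y, T x y → J.fin x = J.fin y
  forth : ∀ e < J.M, ∀ y, T (J.src e) y →
    ∃ f < J.M, J.src f = y ∧ J.lab f = J.lab e ∧ T (J.dst e) (J.dst f)
  convex : ∀ x y z, T x y → z ∈ Set.uIcc x y → T x z

/-- Necessity of the boundary rules, by induction on the derivation. Convexity first moves a related
pair that crosses `v` so that one of its members is the source of the edge in the rule; that edge
must then be imitated from the other side. In the two propagation rules the imitating edge has its
target on the far side of the earlier boundary, against the induction hypothesis; any other target
contradicts the Wheeler axiom on sources or the choice of the first or last edge. Transitivity is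
never needed. -/
theorem IsConvexTolerance.not_of_bd (h : J.IsJoint) {T : ℕ → ℕ → Prop}
    (hT : J.IsConvexTolerance T) {v : ℕ} (hv : J.Bd v) : ∀ x y, x < v → v ≤ y → ¬ T x y := by
  induction hv with
  | zero => intro x y hx; omega
  | mid => intro x y hx hy hxy; have := hT.half _ _ hxy; omega
  | top => intro x y hx hy hxy; have := hT.half _ _ (hT.symm _ _ hxy); omega
  | fin v hv hf =>
    intro x y hx hy hxy
    have h1 := hT.fin _ _ (hT.convex _ _ v hxy (by rw [Set.uIcc_of_le (by omega)]; constructor <;> omega))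
    have h2 := hT.fin _ _ (hT.convex _ _ (v+1) hxy (by rw [Set.uIcc_of_le (by omega)]; constructor <;> omega))
    exact hf (h1.symm.trans h2)
  | left e he hg =>
    intro x y hx hy hxy
    have h1 := hT.symm _ _ (hT.convex _ _ (J.src e) hxy (by rw [Set.uIcc_of_le (by omega)]; constructor <;> omega))
    have h2 := (hT.convex _ _ (J.src e - 1) h1 (by rw [Set.uIcc_of_ge (by omega)]; constructor <;> omega))
    obtain ⟨f, hf, hfs, hfl, -⟩ := hT.forth e he _ h2
    exact hg f hf hfl (by omega)
  | right e he hg =>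
    intro x y hx hy hxy
    have h1 := hT.symm _ _ (hT.convex _ _ (J.src e) (hT.symm _ _ hxy) (by rw [Set.uIcc_of_ge (by omega)]; constructor <;> omega))
    have h2 := (hT.convex _ _ (J.src e + 1) h1 (by rw [Set.uIcc_of_le (by omega)]; constructor <;> omega))
    obtain ⟨f, hf, hfs, hfl, -⟩ := hT.forth e he _ h2
    exact hg f hf hfl (by omega)
  | step_first v e f _ hvN hvn he hf hl ih =>
    intro x y hx hy hxy
    have h1 := hT.symm _ _ (hT.convex _ _ (J.src f) hxy (by rw [Set.uIcc_of_le (by omega)]; constructor <;> omega))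
    obtain ⟨g, hg, hgs, hgl, hgT⟩ := hT.forth f hf.1 _ h1
    have hh := (hT.half _ _ hgT).2
    rw [h.dst_half f hf.1, h.dst_half g hg] at hh
    rw [hf.2.1] at hgT
    rcases lt_trichotomy (J.dst g) (v+1) with h3 | h3 | h3
    · exact ih _ _ h3 le_rfl (hT.symm _ _ hgT)
    · have := hf.2.2 g hg h3; omega
    · have := h.source_le f hf.1 g hg hh hgl.symm (by rw [hf.2.1]; exact h3)
      omega
  | step_last v e f _ hvN hvn he hf hl ih =>
    intro x y hx hy hxy
    have h1 := hT.symm _ _ (hT.convex _ _ (J.src e) (hT.symm _ _ hxy) (by rw [Set.uIcc_of_ge (by omega)]; constructor <;> omega))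
    obtain ⟨g, hg, hgs, hgl, hgT⟩ := hT.forth e he.1 _ h1
    have hh := (hT.half _ _ hgT).2
    rw [h.dst_half e he.1, h.dst_half g hg] at hh
    rw [he.2.1] at hgT
    rcases lt_trichotomy (J.dst g) v with h3 | h3 | h3
    · have := h.source_le g hg e he.1 hh.symm hgl (by rw [he.2.1]; exact h3)
      omega
    · have := he.2.2 g hg h3; omega
    · exact ih _ _ (Nat.lt_succ_self v) h3 hgT

/-! ### Class numbers and stability of the classes -/

/-- `c` numbers the classes of each of the two automata in increasing order, from `1`. -/
structure IsClassMap (J : EdgeData) (c : ℕ → ℕ) : Prop where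
  zero : c 0 = 1
  mid : c J.n = 1
  succ_bd : ∀ v, v + 1 < J.N → v + 1 ≠ J.n → J.Bd (v + 1) → c (v + 1) = c v + 1
  succ : ∀ v, v + 1 < J.N → v + 1 ≠ J.n → ¬ J.Bd (v + 1) → c (v + 1) = c v

variable {c : ℕ → ℕ}

theorem IsClassMap.step (hc : J.IsClassMap c) {v : ℕ} (h1 : v + 1 < J.N) (h2 : v + 1 ≠ J.n) :
    c v ≤ c (v + 1) ∧ c (v + 1) ≤ c v + 1 := by
  by_cases h : J.Bd (v + 1)
  · have := hc.succ_bd v h1 h2 h; omega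
  · have := hc.succ v h1 h2 h; omega

theorem IsClassMap.mono (hc : J.IsClassMap c) {u v : ℕ} (huv : u ≤ v) (hv : v < J.N)
    (hh : u < J.n ↔ v < J.n) : c u ≤ c v := by
  induction v, huv using Nat.le_induction with
  | base => exact le_rfl
  | succ v huv ih =>
    exact (ih (by omega) (by omega)).trans (hc.step hv (by omega)).1

/-- Every value between those at `u` and at `v` is attained between `u` and `v`. -/
theorem IsClassMap.exists_eq (hc : J.IsClassMap c) {u v k : ℕ} (huv : u ≤ v) (hv : v < J.N)
    (hh : u < J.n ↔ v < J.n) (h1 : c u ≤ k) (h2 : k ≤ c v) : ∃ z, u ≤ z ∧ z ≤ v ∧ c z = k := by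
  induction v, huv using Nat.le_induction with
  | base => exact ⟨u, le_rfl, le_rfl, by omega⟩
  | succ v huv ih =>
    by_cases hk : k ≤ c v
    · obtain ⟨z, hz⟩ := ih (by omega) (by omega) hk
      exact ⟨z, hz.1, by omega, hz.2.2⟩
    · have := hc.step hv (by omega)
      exact ⟨v + 1, by omega, le_rfl, by omega⟩

/-- The two states have to be in the same automaton because the numbering restarts at `J.n`. -/
theorem IsClassMap.eq_iff (hc : J.IsClassMap c) {u v : ℕ} (huv : u ≤ v) (hv : v < J.N)
    (hh : u < J.n ↔ v < J.n) : c u = c v ↔ ∀ t, u < t → t ≤ v → ¬ J.Bd t := by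
  induction v, huv using Nat.le_induction with
  | base => simp only [true_iff]; intros; omega
  | succ v huv ih =>
    have ih := ih (by omega) (by omega)
    have hm := hc.mono huv (by omega) (by omega)
    by_cases hB : J.Bd (v + 1)
    · have := hc.succ_bd v hv (by omega) hB
      constructor
      · omega
      · intro h; exact absurd hB (h _ (by omega) le_rfl)
    · rw [hc.succ v hv (by omega) hB, ih]
      constructor
      · intro h t h1 h2
        rcases Nat.lt_or_ge v t with h3 | h3
        · obtain rfl : t = v + 1 := by omega
          exact hB
        · exact h t h1 h3
      · intro h t h1 h2
        exact h t h1 (by omega)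

/-- `u` and `v` are states of the same automaton and lie in the same class. -/
def SameClass (J : EdgeData) (c : ℕ → ℕ) (u v : ℕ) : Prop :=
  u < J.N ∧ v < J.N ∧ (u < J.n ↔ v < J.n) ∧ c u = c v

theorem SameClass.symm {u v : ℕ} (h : J.SameClass c u v) : J.SameClass c v u :=
  ⟨h.2.1, h.1, h.2.2.1.symm, h.2.2.2.symm⟩

theorem SameClass.trans {u v x : ℕ} (h : J.SameClass c u v) (h' : J.SameClass c v x) :
    J.SameClass c u x :=
  ⟨h.1, h'.2.1, h.2.2.1.trans h'.2.2.1, h.2.2.2.trans h'.2.2.2⟩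

/-- This is the sense in which the partition is the coarsest: every convex tolerance is contained in
it. -/
theorem IsConvexTolerance.sameClass (h : J.IsJoint) (hc : J.IsClassMap c) {T : ℕ → ℕ → Prop}
    (hT : J.IsConvexTolerance T) {x y : ℕ} (hxy : T x y) : J.SameClass c x y := by
  wlog hle : x ≤ y generalizing x y
  · exact (this (hT.symm _ _ hxy) (by omega)).symm
  have h1 := hT.half _ _ hxy
  have h2 := hT.half _ _ (hT.symm _ _ hxy)
  refine ⟨h1.1, h2.1, h1.2, (hc.eq_iff hle h2.1 h1.2).2 fun t h3 h4 hB => ?_⟩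
  exact hT.not_of_bd h hB _ _ h3 h4 hxy

/-- The edges with the same label out of two consecutive states in the same class lead to the same
class. -/
theorem IsClassMap.dst_of_not_bd (h : J.IsJoint) (hc : J.IsClassMap c) {g k : ℕ} (hg : g < J.M)
    (hk : k < J.M) (hl : J.lab g = J.lab k) (hs : J.src k = J.src g + 1)
    (hB : ¬ J.Bd (J.src k)) : J.SameClass c (J.dst g) (J.dst k) := by
  have hkn : J.src k ≠ J.n := fun h1 => hB (h1 ▸ Bd.mid)
  have hh : g < J.m ↔ k < J.m := by
    rw [← h.src_half g hg, ← h.src_half k hk]; omega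
  have hd : J.dst g < J.n ↔ J.dst k < J.n := by
    rw [h.dst_half g hg, h.dst_half k hk]; exact hh
  have hle : J.dst g ≤ J.dst k := by
    by_contra hlt
    have := h.source_le k hk g hg hh.symm hl.symm (by omega)
    omega
  refine ⟨h.dst_lt g hg, h.dst_lt k hk, hd, (hc.eq_iff hle (h.dst_lt k hk) hd).2 ?_⟩
  -- Suppose that a boundary `v + 1` separates the two targets. The last edge `e` into `v` and the
  -- first edge `f` into `v + 1` are squeezed between `g` and `k`: all four labels agree, and `src g
  -- ≤ src e ≤ src f ≤ src k = src g + 1`.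
  intro t h1 h2 hBt
  obtain ⟨v, rfl⟩ : ∃ v, t = v + 1 := ⟨t - 1, by omega⟩
  have hvN : v + 1 < J.N := h2.trans_lt (h.dst_lt k hk)
  have hvn : v + 1 ≠ J.n := by omega
  have half_of : ∀ e < J.M, J.dst g ≤ J.dst e → J.dst e ≤ J.dst k →
      ((g < J.m ↔ e < J.m) ∧ (k < J.m ↔ e < J.m)) := by
    intro e he h3 h4
    have := h.dst_half e he
    have := h.dst_half g hg
    omega
  obtain ⟨f, hf⟩ := exists_isFirst (h.incoming hvN (by omega) hvn)
  -- If `v` lies strictly above `dst g` it is not an initial state and has incoming edges; otherwise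
  -- `v = dst g` and `g` is such an edge.
  obtain ⟨e, he⟩ : ∃ e, J.IsLast e v := by
    apply exists_isLast
    rcases Nat.lt_or_ge (J.dst g) v with h3 | h3
    · exact h.incoming (by omega) (by omega) (by omega)
    · exact ⟨g, hg, by omega⟩
  have hfh := half_of f hf.1 (by rw [hf.2.1]; omega) (by rw [hf.2.1]; omega)
  have heh := half_of e he.1 (by rw [he.2.1]; omega) (by rw [he.2.1]; omega)
  have f1 := h.label_le g hg f hf.1 hfh.1 (by rw [hf.2.1]; omega)
  have e1 := h.label_le e he.1 k hk heh.2.symm (by rw [he.2.1]; omega)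
  have f2 : J.lab f = J.lab g ∧ J.src f ≤ J.src k := by
    rcases Nat.lt_or_ge (v + 1) (J.dst k) with h3 | h3
    · have h4 := h.label_le f hf.1 k hk hfh.2.symm (by rw [hf.2.1]; omega)
      have h5 : J.lab f = J.lab k := by omega
      exact ⟨by omega, h.source_le f hf.1 k hk hfh.2.symm h5 (by rw [hf.2.1]; omega)⟩
    · have := hf.2.2 k hk (by omega)
      omega
  have e2 : J.lab e = J.lab g ∧ J.src g ≤ J.src e := by
    rcases Nat.lt_or_ge (J.dst g) v with h3 | h3
    · have h4 := h.label_le g hg e he.1 heh.1 (by rw [he.2.1]; omega)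
      have h5 : J.lab g = J.lab e := by omega
      exact ⟨by omega, h.source_le g hg e he.1 heh.1 h5 (by rw [he.2.1]; omega)⟩
    · have := he.2.2 g hg (by omega)
      omega
  have hef : J.lab e = J.lab f := by omega
  have h3 := h.source_le e he.1 f hf.1 (by rw [← heh.1, hfh.1]) hef (by rw [he.2.1, hf.2.1]; omega)
  have b1 := Bd.step_first v e f hBt hvN hvn he hf hef
  have b2 := Bd.step_last v e f hBt hvN hvn he hf hef
  -- There is no room for both `src e` and `src f` to lie strictly inside: either `src f = src k`,
  -- or `src e = src g`. In both cases a propagation rule puts a boundary at `src k`.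
  by_cases h4 : J.src f = J.src k
  · exact hB (h4 ▸ b1)
  · have h5 : J.src e + 1 = J.src k := by omega
    exact hB (h5 ▸ b2)

/-- Sufficiency of the boundary rules. Inside a class one passes from a state to its neighbour. No
boundary there means, by `Bd.left` and `Bd.right`, that the neighbour has an edge with the same
label, and by `dst_of_not_bd` that the two targets lie in the same class. -/
theorem SameClass.bisim (h : J.IsJoint) (hc : J.IsClassMap c) {u v : ℕ} (huv : J.SameClass c u v) :
    J.fin u = J.fin v ∧ ∀ e < J.M, J.src e = u →
      ∃ f < J.M, J.src f = v ∧ J.lab f = J.lab e ∧ J.SameClass c (J.dst e) (J.dst f) := by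
  -- Both directions of the simulation are carried through the induction, so that it is enough to
  -- treat `u ≤ v`.
  suffices key : ∀ u v, u ≤ v → J.SameClass c u v → J.fin u = J.fin v ∧
      (∀ e < J.M, J.src e = u →
        ∃ f < J.M, J.src f = v ∧ J.lab f = J.lab e ∧ J.SameClass c (J.dst e) (J.dst f)) ∧
      (∀ e < J.M, J.src e = v →
        ∃ f < J.M, J.src f = u ∧ J.lab f = J.lab e ∧ J.SameClass c (J.dst e) (J.dst f)) by
    rcases le_total u v with hle | hle
    · exact ⟨(key u v hle huv).1, (key u v hle huv).2.1⟩
    · exact ⟨(key v u hle huv.symm).1.symm, (key v u hle huv.symm).2.2⟩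
  clear huv u v
  intro u v hle
  induction v, hle using Nat.le_induction with
  | base =>
    refine fun _ => ⟨rfl, fun e he hs => ⟨e, he, hs, rfl, ?_⟩, fun e he hs => ⟨e, he, hs, rfl, ?_⟩⟩ <;>
    exact ⟨h.dst_lt e he, h.dst_lt e he, Iff.rfl, rfl⟩
  | succ v hle ih =>
    rintro ⟨h1, h2, h3, h4⟩
    have hnB := (hc.eq_iff (by omega) h2 h3).1 h4
    have hB : ¬ J.Bd (v + 1) := hnB _ (by omega) le_rfl
    have hvn : v + 1 ≠ J.n := fun h1 => hB (h1 ▸ Bd.mid)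
    obtain ⟨i1, i2, i3⟩ := ih ⟨h1, by omega, by omega,
      (hc.eq_iff hle (by omega) (by omega)).2 fun t ht ht' => hnB t ht (by omega)⟩
    refine ⟨?_, ?_, ?_⟩
    · rw [i1]
      by_contra hne
      exact hB (Bd.fin v h2 hne)
    · intro e he hs
      obtain ⟨f, hf, f1, f2, f3⟩ := i2 e he hs
      by_contra! hcon
      refine hB (f1 ▸ Bd.right f hf ?_)
      intro g hg hgl hgs
      refine hcon g hg (by omega) (by omega) (f3.trans ?_)
      exact hc.dst_of_not_bd h hf hg hgl.symm hgs (by rwa [hgs, f1])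
    · intro e he hs
      have : ∃ g < J.M, J.lab g = J.lab e ∧ J.src g + 1 = J.src e := by
        by_contra! hcon
        exact hB (hs ▸ Bd.left e he hcon)
      obtain ⟨g, hg, hgl, hgs⟩ := this
      obtain ⟨f, hf, f1, f2, f3⟩ := i3 g hg (by omega)
      refine ⟨f, hf, f1, by omega, SameClass.trans ?_ f3⟩
      exact (hc.dst_of_not_bd h hg he hgl hgs.symm (by rwa [hs])).symm

/-! ### Wheeler bisimulations and the two quotients -/

/-- `R` is a Wheeler bisimulation from the first automaton to the second. -/
structure IsWB (J : EdgeData) (R : ℕ → ℕ → Prop) : Prop where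
  dom : ∀ u v, R u v → u < J.n ∧ J.n ≤ v ∧ v < J.N
  start : R 0 J.n
  fin : ∀ u v, R u v → J.fin u = J.fin v
  forth : ∀ e < J.m, ∀ v, R (J.src e) v →
    ∃ f, J.m ≤ f ∧ f < J.M ∧ J.src f = v ∧ J.lab f = J.lab e ∧ R (J.dst e) (J.dst f)
  back : ∀ f, J.m ≤ f → f < J.M → ∀ u, R u (J.src f) →
    ∃ e < J.m, J.src e = u ∧ J.lab f = J.lab e ∧ R (J.dst e) (J.dst f)
  image : ∀ u v u' v' z, R u u' → R v v' → u' ≤ z → z ≤ v' → ∃ x ∈ Set.uIcc u v, R x z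
  preimage : ∀ u v u' v' z, R u u' → R v v' → u ≤ z → z ≤ v → ∃ x ∈ Set.uIcc u' v', R z x

variable {R : ℕ → ℕ → Prop}

/-- All states are reachable, and `forth` and `back` carry related partners along edges, starting
from the initial states. -/
theorem IsWB.total (h : J.IsJoint) (hR : J.IsWB R) :
    ∀ x < J.N, (x < J.n → ∃ y, R x y) ∧ (J.n ≤ x → ∃ y, R y x) := by
  have := h.n_pos
  refine h.reach _ ⟨fun _ => ⟨_, hR.start⟩, fun _ => by omega⟩ ⟨fun _ => by omega, fun _ => ⟨_, hR.start⟩⟩ ?_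
  rintro e he ⟨h1, h2⟩
  constructor
  · intro h3
    have h4 := (h.dst_half e he).1 h3
    obtain ⟨y, hy⟩ := h1 ((h.src_half e he).2 h4)
    obtain ⟨f, -, -, -, -, hf⟩ := hR.forth e h4 y hy
    exact ⟨_, hf⟩
  · intro h3
    have h5 := h.dst_half e he
    have h6 := h.src_half e he
    obtain ⟨y, hy⟩ := h2 (by omega)
    obtain ⟨f, -, -, -, hf⟩ := hR.back e (by omega) he y hy
    exact ⟨_, hf⟩

/-- States related to states of the same class. -/
def Related (J : EdgeData) (c : ℕ → ℕ) (R : ℕ → ℕ → Prop) (x y : ℕ) : Prop :=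
  (∃ x' y', R x x' ∧ R y y' ∧ J.SameClass c x' y') ∨
    ∃ x' y', R x' x ∧ R y' y ∧ J.SameClass c x' y'

theorem SameClass.of_mem_uIcc (hc : J.IsClassMap c) {x y z : ℕ} (h : J.SameClass c x y)
    (hz : z ∈ Set.uIcc x y) : J.SameClass c x z := by
  wlog hle : x ≤ y generalizing x y
  · have h1 := this h.symm (by rwa [Set.uIcc_comm]) (by omega)
    exact h.trans h1
  rw [Set.uIcc_of_le hle] at hz
  obtain ⟨h1, h2, h3, h4⟩ := h
  obtain ⟨z1, z2⟩ := hz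
  refine ⟨h1, by omega, by omega, ?_⟩
  have a := hc.mono z1 (by omega) (by omega)
  have b := hc.mono z2 (by omega) (by omega)
  omega

/-- An edge is carried through `R` to the other automaton, moved there inside a class by
`SameClass.bisim`, and carried back. A point between `x` and `y` has, by convexity of images or
preimages, a partner between the partners of `x` and `y`, hence in their common class. -/
theorem IsWB.isConvexTolerance (h : J.IsJoint) (hc : J.IsClassMap c) (hR : J.IsWB R) :
    J.IsConvexTolerance (J.Related c R) where
  refl x hx := by
    rcases Nat.lt_or_ge x J.n with h1 | h1
    · obtain ⟨y, hy⟩ := (hR.total h x hx).1 h1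
      exact Or.inl ⟨y, y, hy, hy, (hR.dom _ _ hy).2.2, (hR.dom _ _ hy).2.2, Iff.rfl, rfl⟩
    · obtain ⟨y, hy⟩ := (hR.total h x hx).2 h1
      have := (hR.dom _ _ hy)
      exact Or.inr ⟨y, y, hy, hy, by omega, by omega, Iff.rfl, rfl⟩
  symm := by
    rintro x y (⟨x', y', h1, h2, h3⟩ | ⟨x', y', h1, h2, h3⟩)
    · exact Or.inl ⟨y', x', h2, h1, h3.symm⟩
    · exact Or.inr ⟨y', x', h2, h1, h3.symm⟩
  half := by
    rintro x y (⟨x', y', h1, h2, h3⟩ | ⟨x', y', h1, h2, h3⟩)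
    · have := hR.dom _ _ h1; have := hR.dom _ _ h2; omega
    · have := hR.dom _ _ h1; have := hR.dom _ _ h2; omega
  fin := by
    rintro x y (⟨x', y', h1, h2, h3⟩ | ⟨x', y', h1, h2, h3⟩)
    · rw [hR.fin _ _ h1, hR.fin _ _ h2, (h3.bisim h hc).1]
    · rw [← hR.fin _ _ h1, ← hR.fin _ _ h2, (h3.bisim h hc).1]
  forth := by
    rintro e he y (⟨x', y', h1, h2, h3⟩ | ⟨x', y', h1, h2, h3⟩)
    · obtain ⟨f, f1, f2, f3, f4, f5⟩ := hR.forth e ((h.src_half e he).1 (hR.dom _ _ h1).1) _ h1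
      obtain ⟨g, g1, g2, g3, g4⟩ := (h3.bisim h hc).2 f f2 f3
      subst g2
      have := (h.src_half g g1).2.mt (by have := (hR.dom _ _ h2); omega)
      obtain ⟨k, k1, k2, k3, k4⟩ := hR.back g (by omega) g1 y h2
      exact ⟨k, k1.trans_le h.m_le, k2, by omega, Or.inl ⟨_, _, f5, k4, g4⟩⟩
    · have := (h.src_half e he).2.mt (by have := (hR.dom _ _ h1); omega)
      obtain ⟨f, f1, f3, f4, f5⟩ := hR.back e (by omega) he _ h1
      obtain ⟨g, g1, g2, g3, g4⟩ := (h3.bisim h hc).2 f (f1.trans_le h.m_le) f3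
      subst g2
      obtain ⟨k, k1, k2, k3, k4, k5⟩ := hR.forth g ((h.src_half g g1).1 (hR.dom _ _ h2).1) y h2
      exact ⟨k, k2, k3, by omega, Or.inr ⟨_, _, f5, k5, g4⟩⟩
  convex := by
    rintro x y z (⟨x', y', h1, h2, h3⟩ | ⟨x', y', h1, h2, h3⟩) hz
    · rcases le_total x y with hle | hle
      · rw [Set.uIcc_of_le hle] at hz
        obtain ⟨z', hz', hz2⟩ := hR.preimage _ _ _ _ z h1 h2 hz.1 hz.2
        exact Or.inl ⟨x', z', h1, hz2, h3.of_mem_uIcc hc hz'⟩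
      · rw [Set.uIcc_of_ge hle] at hz
        obtain ⟨z', hz', hz2⟩ := hR.preimage _ _ _ _ z h2 h1 hz.1 hz.2
        exact Or.inl ⟨x', z', h1, hz2, h3.of_mem_uIcc hc (by rwa [Set.uIcc_comm])⟩
    · rcases le_total x y with hle | hle
      · rw [Set.uIcc_of_le hle] at hz
        obtain ⟨z', hz', hz2⟩ := hR.image _ _ _ _ z h1 h2 hz.1 hz.2
        exact Or.inr ⟨x', z', h1, hz2, h3.of_mem_uIcc hc hz'⟩
      · rw [Set.uIcc_of_ge hle] at hz
        obtain ⟨z', hz', hz2⟩ := hR.image _ _ _ _ z h2 h1 hz.1 hz.2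
        exact Or.inr ⟨x', z', h1, hz2, h3.of_mem_uIcc hc (by rwa [Set.uIcc_comm])⟩

/-- By maximality `Related` is contained in `SameClass`, so that `R` induces a well-defined and
injective correspondence of classes. -/
theorem IsWB.class_eq_iff (h : J.IsJoint) (hc : J.IsClassMap c) (hR : J.IsWB R) {u v u' v' : ℕ}
    (hu : R u u') (hv : R v v') : c u = c v ↔ c u' = c v' := by
  have d1 := hR.dom _ _ hu
  have d2 := hR.dom _ _ hv
  constructor
  · intro h1
    exact ((hR.isConvexTolerance h hc).sameClass h hc (Or.inr ⟨u, v, hu, hv,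
      by omega, by omega, by omega, h1⟩)).2.2.2
  · intro h1
    exact ((hR.isConvexTolerance h hc).sameClass h hc (Or.inl ⟨u', v', hu, hv,
      by omega, by omega, by omega, h1⟩)).2.2.2

/-- A Wheeler bisimulation relates states in classes with the same number only. -/
theorem IsWB.class_eq (h : J.IsJoint) (hc : J.IsClassMap c) (hR : J.IsWB R) {u u' : ℕ}
    (hu : R u u') : c u = c u' := by
  have hn := h.n_lt
  -- Strong induction on the class number, for both sides at once: pairs with a smaller number on
  -- either side are already known to agree.
  suffices key : ∀ i, ∀ u u', R u u' → (c u = i ↔ c u' = i) from ((key _ u u' hu).1 rfl).symm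
  clear hu u u'
  intro i
  induction i using Nat.strong_induction_on with
  | _ i ih =>
  intro u u' hu
  have d1 := hR.dom _ _ hu
  have m0 := hc.mono (Nat.zero_le u) (by omega) (by omega)
  have m1 := hc.mono d1.2.1 (by omega) (by omega)
  have hz := hc.zero
  have hm := hc.mid
  constructor
  · intro h1
    by_contra h2
    have h3 : i < c u' := by
      rcases Nat.lt_or_ge (c u') i with h4 | h4
      · have := (ih _ h4 u u' hu).2 rfl; omega
      · omega
    -- If `c u = i < c u'`, class `i` is met at some `z` between the initial state and `u'`, since
    -- numbers grow by at most one. The image of the interval from `0` to `u` is convex, so some `x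
    -- ≤ u` is related to `z`. The induction hypothesis excludes `c x < i`; so `x` and `u` share a
    -- class while `z` and `u'` do not.
    obtain ⟨z, z1, z2, z3⟩ := hc.exists_eq (k := i) d1.2.1 d1.2.2 (by omega) (by omega) h3.le
    obtain ⟨x, hx, hxz⟩ := hR.image _ _ _ _ z hR.start hu z1 z2
    rw [Set.uIcc_of_le (Nat.zero_le u)] at hx
    have h5 := hc.mono hx.2 (by omega) (by have := hx.2; omega)
    have h6 : c x = c u := by
      rcases Nat.lt_or_ge (c x) i with h4 | h4
      · have := (ih _ h4 x z hxz).1 rfl; omega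
      · omega
    have := (hR.class_eq_iff h hc hxz hu).1 h6
    omega
  · intro h1
    by_contra h2
    have h3 : i < c u := by
      rcases Nat.lt_or_ge (c u) i with h4 | h4
      · have := (ih _ h4 u u' hu).1 rfl; omega
      · omega
    obtain ⟨z, z1, z2, z3⟩ := hc.exists_eq (k := i) (Nat.zero_le u) (by omega) (by omega) (by omega) h3.le
    obtain ⟨x, hx, hxz⟩ := hR.preimage _ _ _ _ z hR.start hu z1 z2
    rw [Set.uIcc_of_le d1.2.1] at hx
    obtain ⟨x1, x2⟩ := hx
    have h5 := hc.mono x2 (by omega) (by omega)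
    have h6 : c x = c u' := by
      rcases Nat.lt_or_ge (c x) i with h4 | h4
      · have := (ih _ h4 z x hxz).2 rfl; omega
      · omega
    have := (hR.class_eq_iff h hc hxz hu).2 h6
    omega

/-- Two edges have the same label, and their ends lie in classes with the same numbers. -/
def SameEdge (J : EdgeData) (c : ℕ → ℕ) (e f : ℕ) : Prop :=
  J.lab e = J.lab f ∧ c (J.src e) = c (J.src f) ∧ c (J.dst e) = c (J.dst f)

/-- A Wheeler bisimulation exists exactly if the quotients have the same edges and final states. -/
theorem exists_isWB_iff (h : J.IsJoint) (hc : J.IsClassMap c) :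
    (∃ R, J.IsWB R) ↔
      (∀ e < J.m, ∃ f, J.m ≤ f ∧ f < J.M ∧ J.SameEdge c e f) ∧
      (∀ f, J.m ≤ f → f < J.M → ∃ e < J.m, J.SameEdge c e f) ∧
      ∀ v, J.n ≤ v → v < J.N → ∃ u < J.n, c u = c v ∧ J.fin u = J.fin v := by
  have hn := h.n_lt
  have hn0 := h.n_pos
  have hmM := h.m_le
  constructor
  · rintro ⟨R, hR⟩
    refine ⟨?_, ?_, ?_⟩
    · intro e he
      have h1 := (h.src_half e (by omega)).2 he
      obtain ⟨y, hy⟩ := (hR.total h _ (h.src_lt e (by omega))).1 h1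
      obtain ⟨f, f1, f2, f3, f4, f5⟩ := hR.forth e he y hy
      subst f3
      exact ⟨f, f1, f2, f4.symm, hR.class_eq h hc hy, hR.class_eq h hc f5⟩
    · intro f f1 f2
      have h1 := (h.src_half f f2)
      obtain ⟨y, hy⟩ := (hR.total h _ (h.src_lt f f2)).2 (by omega)
      obtain ⟨e, e1, e2, e3, e4⟩ := hR.back f f1 f2 y hy
      subst e2
      exact ⟨e, e1, e3.symm, hR.class_eq h hc hy, hR.class_eq h hc e4⟩
    · intro v v1 v2
      obtain ⟨u, hu⟩ := (hR.total h v v2).2 v1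
      exact ⟨u, (hR.dom _ _ hu).1, hR.class_eq h hc hu, hR.fin _ _ hu⟩
  · rintro ⟨h1, h2, h3⟩
    refine ⟨fun u v => u < J.n ∧ J.n ≤ v ∧ v < J.N ∧ c u = c v, ?_, ?_, ?_, ?_, ?_, ?_, ?_⟩
    · intro u v huv; exact ⟨huv.1, huv.2.1, huv.2.2.1⟩
    · exact ⟨by omega, le_rfl, hn, by rw [hc.zero, hc.mid]⟩
    · rintro u v ⟨a1, a2, a3, a4⟩
      obtain ⟨u1, b1, b2, b3⟩ := h3 v a2 a3
      have : J.SameClass c u u1 := ⟨by omega, by omega, by omega, by omega⟩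
      rw [(this.bisim h hc).1, b3]
    -- The quotient edge of `e` is realized by some `f`, whose source need not be `v`; stability
    -- moves it to an edge out of `v`.
    · rintro e he v ⟨a1, a2, a3, a4⟩
      obtain ⟨f, f1, f2, f3, f4, f5⟩ := h1 e he
      have hh := h.src_half f f2
      have : J.SameClass c (J.src f) v := ⟨h.src_lt f f2, a3, by omega, by omega⟩
      obtain ⟨g, g1, g2, g3, g4⟩ := (this.bisim h hc).2 f f2 rfl
      have e1 := h.dst_half e (by omega)
      have e2 := h.src_half g g1
      have e3 := h.dst_half g g1
      have e4 := h.dst_lt g g1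
      have e5 := g4.2.2.2
      exact ⟨g, by omega, g1, g2, by omega, by omega, by omega, by omega, by omega⟩
    · rintro f f1 f2 u ⟨a1, a2, a3, a4⟩
      obtain ⟨e, he, f3, f4, f5⟩ := h2 f f1 f2
      have hh := h.src_half e (by omega)
      have : J.SameClass c (J.src e) u := ⟨by omega, by omega, by omega, by omega⟩
      obtain ⟨g, g1, g2, g3, g4⟩ := (this.bisim h hc).2 e (by omega) rfl
      have e1 := h.dst_half f f2
      have e2 := h.src_half g g1
      have e3 := h.dst_half g g1
      have e4 := h.dst_lt f f2
      have e5 := g4.2.2.2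
      exact ⟨g, by omega, g2, by omega, by omega, by omega, by omega, by omega⟩
    -- If `u ≤ v`, the discrete intermediate value property of `c` yields a state of class `c z`
    -- between them. If `v ≤ u`, monotonicity forces `c u = c z`, and `u` itself will do.
    · rintro u v u' v' z ⟨a1, a2, a3, a4⟩ ⟨b1, b2, b3, b4⟩ z1 z2
      have m1 := hc.mono z1 (by omega) (by omega)
      have m2 := hc.mono z2 (by omega) (by omega)
      rcases le_total u v with hle | hle
      · obtain ⟨x, x1, x2, x3⟩ := hc.exists_eq (k := c z) hle (by omega) (by omega) (by omega) (by omega)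
        refine ⟨x, by rw [Set.uIcc_of_le hle]; exact ⟨x1, x2⟩, by omega, by omega, by omega, x3⟩
      · have m3 := hc.mono hle (by omega) (by omega)
        refine ⟨u, by simp, a1, by omega, by omega, by omega⟩
    · rintro u v u' v' z ⟨a1, a2, a3, a4⟩ ⟨b1, b2, b3, b4⟩ z1 z2
      have m1 := hc.mono z1 (by omega) (by omega)
      have m2 := hc.mono z2 (by omega) (by omega)
      rcases le_total u' v' with hle | hle
      · obtain ⟨x, x1, x2, x3⟩ := hc.exists_eq (k := c z) hle (by omega) (by omega) (by omega) (by omega)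
        refine ⟨x, by rw [Set.uIcc_of_le hle]; exact ⟨x1, x2⟩, by omega, by omega, by omega, x3.symm⟩
      · have m3 := hc.mono hle (by omega) (by omega)
        refine ⟨u', by simp, by omega, by omega, by omega, by omega⟩

end EdgeData

end WheelerBisim


namespace WheelerBisim

/-! ### Reasoning about programs -/

theorem Mem.setReg_reg (s : Mem) (x n y : ℕ) :
    (s.setReg x n).reg y = if y = x then n else s.reg y := by
  simp [Mem.setReg, Function.update_apply]

theorem Mem.setReg_arr (s : Mem) (x n : ℕ) : (s.setReg x n).arr = s.arr := rfl

theorem Mem.setArr_reg (s : Mem) (a i n : ℕ) : (s.setArr a i n).reg = s.reg := rfl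

theorem Mem.setArr_arr (s : Mem) (a i n b : ℕ) :
    (s.setArr a i n).arr b = if b = a then Function.update (s.arr a) i n else s.arr b := by
  simp only [Mem.setArr, Function.update_apply]

namespace Cmd

/-- The registers that a program may write. -/
def wregs : Cmd → List ℕ
  | skip => []
  | const x _ => [x]
  | binop _ x _ _ => [x]
  | load x _ _ => [x]
  | store _ _ _ => []
  | seq c d => c.wregs ++ d.wregs
  | ite _ c d => c.wregs ++ d.wregs
  | loop _ c => c.wregs

/-- The arrays that a program may write. -/
def warrs : Cmd → List ℕ
  | skip => []
  | const _ _ => []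
  | binop _ _ _ _ => []
  | load _ _ _ => []
  | store a _ _ => [a]
  | seq c d => c.warrs ++ d.warrs
  | ite _ c d => c.warrs ++ d.warrs
  | loop _ c => c.warrs

/-- A bound on the number of steps of a program without loops. -/
def cost : Cmd → ℕ
  | skip => 1
  | const _ _ => 1
  | binop _ _ _ _ => 1
  | load _ _ _ => 1
  | store _ _ _ => 1
  | seq c d => c.cost + d.cost
  | ite _ c d => max c.cost d.cost + 1
  | loop _ _ => 0

/-- A precondition under which a program without loops reaches the postcondition, and no result of
an operation has to be reduced. -/
def wp (w : ℕ) : Cmd → (Mem → Prop) → Mem → Prop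
  | skip, P, s => P s
  | const x n, P, s => n < 2 ^ w ∧ P (s.setReg x n)
  | binop o x y z, P, s =>
      o.eval (s.reg y) (s.reg z) < 2 ^ w ∧ P (s.setReg x (o.eval (s.reg y) (s.reg z)))
  | load x a y, P, s => P (s.setReg x (s.arr a (s.reg y)))
  | store a y x, P, s => P (s.setArr a (s.reg y) (s.reg x))
  | seq c d, P, s => c.wp w (fun s' => d.wp w P s') s
  | ite x c d, P, s => (s.reg x ≠ 0 → c.wp w P s) ∧ (s.reg x = 0 → d.wp w P s)
  | loop _ _, _, _ => False

/-- The program halts within `T` steps in a state that satisfies `P`. -/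
def Runs (w : ℕ) (c : Cmd) (s : Mem) (T : ℕ) (P : Mem → Prop) : Prop :=
  ∃ s' t, Exec w c s s' t ∧ t ≤ T ∧ P s'

variable {w : ℕ}

theorem wp_mono {c : Cmd} {P P' : Mem → Prop} {s : Mem} (h : c.wp w P s) (hP : ∀ s', P s' → P' s') :
    c.wp w P' s := by
  induction c generalizing P P' s with
  | skip => exact hP _ h
  | const x n => exact ⟨h.1, hP _ h.2⟩
  | binop o x y z => exact ⟨h.1, hP _ h.2⟩
  | load x a y => exact hP _ h
  | store a y x => exact hP _ h
  | seq c d ihc ihd => exact ihc h fun s' h' => ihd h' hP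
  | ite x c d ihc ihd => exact ⟨fun hx => ihc (h.1 hx) hP, fun hx => ihd (h.2 hx) hP⟩
  | loop x c ih => exact h

theorem Runs.of_wp {c : Cmd} {P : Mem → Prop} {s : Mem} (h : c.wp w P s) : Runs w c s c.cost P := by
  induction c generalizing P s with
  | skip => exact ⟨_, _, Exec.skip s, le_rfl, h⟩
  | const x n =>
    exact ⟨_, _, Exec.const x n s, le_rfl, by rw [Nat.mod_eq_of_lt h.1]; exact h.2⟩
  | binop o x y z =>
    exact ⟨_, _, Exec.binop o x y z s, le_rfl, by rw [Nat.mod_eq_of_lt h.1]; exact h.2⟩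
  | load x a y => exact ⟨_, _, Exec.load x a y s, le_rfl, h⟩
  | store a y x => exact ⟨_, _, Exec.store a y x s, le_rfl, h⟩
  | seq c d ihc ihd =>
    obtain ⟨s', t, h1, h2, h3⟩ := ihc h
    obtain ⟨s'', t', h1', h2', h3'⟩ := ihd h3
    exact ⟨s'', t + t', h1.seq h1', by simp only [cost]; omega, h3'⟩
  | ite x c d ihc ihd =>
    by_cases hx : s.reg x = 0
    · obtain ⟨s', t, h1, h2, h3⟩ := ihd (h.2 hx)
      exact ⟨s', t + 1, Exec.ite_false hx h1, by simp only [cost]; omega, h3⟩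
    · obtain ⟨s', t, h1, h2, h3⟩ := ihc (h.1 hx)
      exact ⟨s', t + 1, Exec.ite_true hx h1, by simp only [cost]; omega, h3⟩
  | loop x c ih => exact h.elim

theorem Runs.seq {c d : Cmd} {s : Mem} {T T' : ℕ} {P P' : Mem → Prop} (h : Runs w c s T P)
    (h' : ∀ s', P s' → Runs w d s' T' P') : Runs w (c.seq d) s (T + T') P' := by
  obtain ⟨s', t, h1, h2, h3⟩ := h
  obtain ⟨s'', t', h1', h2', h3'⟩ := h' s' h3
  exact ⟨s'', t + t', h1.seq h1', by omega, h3'⟩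

theorem Runs.mono {c : Cmd} {s : Mem} {T T' : ℕ} {P P' : Mem → Prop} (h : Runs w c s T P)
    (hT : T ≤ T') (hP : ∀ s', P s' → P' s') : Runs w c s T' P' := by
  obtain ⟨s', t, h1, h2, h3⟩ := h
  exact ⟨s', t, h1, h2.trans hT, hP _ h3⟩

/-- The memories agree except for the registers and arrays that the program may write. -/
def Frame (c : Cmd) (s s' : Mem) : Prop :=
  (∀ x, x ∉ c.wregs → s'.reg x = s.reg x) ∧ ∀ a, a ∉ c.warrs → s'.arr a = s.arr a

theorem Frame.refl (c : Cmd) (s : Mem) : c.Frame s s := ⟨fun _ _ => rfl, fun _ _ => rfl⟩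

theorem Frame.trans {c : Cmd} {s s' s'' : Mem} (h : c.Frame s s') (h' : c.Frame s' s'') :
    c.Frame s s'' :=
  ⟨fun x hx => (h'.1 x hx).trans (h.1 x hx), fun x hx => (h'.2 x hx).trans (h.2 x hx)⟩

theorem frame_of_exec {c : Cmd} {s s' : Mem} {t : ℕ} (h : Exec w c s s' t) : c.Frame s s' := by
  induction h with
  | skip s => exact Frame.refl _ _
  | const x n s =>
    exact ⟨fun y hy => by simp_all [wregs, Mem.setReg_reg], fun _ _ => rfl⟩
  | binop o x y z s =>
    exact ⟨fun y hy => by simp_all [wregs, Mem.setReg_reg], fun _ _ => rfl⟩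
  | load x a y s =>
    exact ⟨fun y hy => by simp_all [wregs, Mem.setReg_reg], fun _ _ => rfl⟩
  | store a y x s =>
    exact ⟨fun _ _ => rfl, fun y hy => by simp_all [warrs, Mem.setArr_arr]⟩
  | seq _ _ ih ih' =>
    refine ⟨fun x hx => ?_, fun x hx => ?_⟩
    · simp only [wregs, List.mem_append, not_or] at hx
      exact (ih'.1 x hx.2).trans (ih.1 x hx.1)
    · simp only [warrs, List.mem_append, not_or] at hx
      exact (ih'.2 x hx.2).trans (ih.2 x hx.1)
  | ite_true _ _ ih =>
    refine ⟨fun x hx => ?_, fun x hx => ?_⟩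
    · simp only [wregs, List.mem_append, not_or] at hx
      exact ih.1 x hx.1
    · simp only [warrs, List.mem_append, not_or] at hx
      exact ih.2 x hx.1
  | ite_false _ _ ih =>
    refine ⟨fun x hx => ?_, fun x hx => ?_⟩
    · simp only [wregs, List.mem_append, not_or] at hx
      exact ih.1 x hx.2
    · simp only [warrs, List.mem_append, not_or] at hx
      exact ih.2 x hx.2
  | loop_false => exact Frame.refl _ _
  | loop_true _ _ _ ih ih' => exact Frame.trans (c := loop _ _) ih ih'

theorem Runs.frame {c : Cmd} {s : Mem} {T : ℕ} {P : Mem → Prop} (h : Runs w c s T P) :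
    Runs w c s T (fun s' => P s' ∧ c.Frame s s') := by
  obtain ⟨s', t, h1, h2, h3⟩ := h
  exact ⟨s', t, h1, h2, h3, frame_of_exec h1⟩

theorem wp_frame {c : Cmd} {P : Mem → Prop} {s : Mem} (h : c.wp w P s) :
    c.wp w (fun s' => P s' ∧ c.Frame s s') s := by
  induction c generalizing P s with
  | skip => exact ⟨h, Frame.refl _ _⟩
  | const x n => exact ⟨h.1, h.2, ⟨by simp +contextual [wregs, Mem.setReg_reg], fun _ _ => rfl⟩⟩
  | binop o x y z =>
    exact ⟨h.1, h.2, ⟨by simp +contextual [wregs, Mem.setReg_reg], fun _ _ => rfl⟩⟩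
  | load x a y => exact ⟨h, ⟨by simp +contextual [wregs, Mem.setReg_reg], fun _ _ => rfl⟩⟩
  | store a y x => exact ⟨h, fun _ _ => rfl, by simp +contextual [warrs, Mem.setArr_arr]⟩
  | seq c d ihc ihd =>
    refine wp_mono (c := c) (ihc h) fun s' h' => wp_mono (c := d) (ihd h'.1) fun s'' h'' =>
      ⟨h''.1, ?_⟩
    refine Frame.trans (s' := s') ⟨fun x hx => ?_, fun x hx => ?_⟩ ⟨fun x hx => ?_, fun x hx => ?_⟩
    · exact h'.2.1 x fun h => hx (List.mem_append_left _ h)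
    · exact h'.2.2 x fun h => hx (List.mem_append_left _ h)
    · exact h''.2.1 x fun h => hx (List.mem_append_right _ h)
    · exact h''.2.2 x fun h => hx (List.mem_append_right _ h)
  | ite x c d ihc ihd =>
    refine ⟨fun hx => wp_mono (ihc (h.1 hx)) fun s' h' => ⟨h'.1, ?_⟩,
      fun hx => wp_mono (ihd (h.2 hx)) fun s' h' => ⟨h'.1, ?_⟩⟩
    · exact ⟨fun x hx => h'.2.1 x fun h => hx (List.mem_append_left _ h),
        fun x hx => h'.2.2 x fun h => hx (List.mem_append_left _ h)⟩
    · exact ⟨fun x hx => h'.2.1 x fun h => hx (List.mem_append_right _ h),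
        fun x hx => h'.2.2 x fun h => hx (List.mem_append_right _ h)⟩
  | loop x c ih => exact h

/-- A loop whose body has no loops and decreases a measure. -/
theorem Runs.loop {x : ℕ} {c : Cmd} {s : Mem} (I : Mem → Prop) (μ : Mem → ℕ) (h : I s)
    (hstep : ∀ s', I s' → c.Frame s s' → s'.reg x ≠ 0 →
      c.wp w (fun s'' => I s'' ∧ μ s'' < μ s') s') :
    Runs w (c.loop x) s (μ s * (c.cost + 1) + 1) (fun s' => I s' ∧ s'.reg x = 0) := by
  suffices key : ∀ k s', I s' → c.Frame s s' → μ s' ≤ k →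
      Runs w (c.loop x) s' (k * (c.cost + 1) + 1) (fun s' => I s' ∧ s'.reg x = 0) from
    key _ s h (Frame.refl _ _) le_rfl
  intro k
  induction k with
  | zero =>
    intro s' hI hf hk
    by_cases hx : s'.reg x = 0
    · exact ⟨s', 1, Exec.loop_false hx, by omega, hI, hx⟩
    · obtain ⟨s'', t, -, -, -, h3⟩ := Runs.of_wp (hstep s' hI hf hx)
      omega
  | succ k ih =>
    intro s' hI hf hk
    by_cases hx : s'.reg x = 0
    · exact ⟨s', 1, Exec.loop_false hx, by omega, hI, hx⟩
    · obtain ⟨s1, t, h1, h2, h3, h4⟩ := Runs.of_wp (hstep s' hI hf hx)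
      obtain ⟨s2, t', h1', h2', h3'⟩ := ih s1 h3 (hf.trans (frame_of_exec h1)) (by omega)
      exact ⟨s2, t + t' + 1, Exec.loop_true hx h1 h1', by rw [Nat.succ_mul]; omega, h3'⟩

/-- Repeat a program, register `40` counting up from `0` to the value of register `n`. Register
`42` holds the constant `1`. -/
def forTo (n : ℕ) (c : Cmd) : Cmd :=
  (const 42 1).seq <| (const 40 0).seq <| (binop .lt 41 40 n).seq <|
    loop 41 <| c.seq <| (binop .add 40 40 42).seq <| binop .lt 41 40 n

/-- Here `I k` is the invariant after `k` rounds. It has to survive the updates of counter and test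
register, hence the assignments in `h0` and `hstep`. A round takes the cost of the body plus
increment, comparison and loop test; the remaining `4` are three initializations and the last test.
-/
theorem Runs.forTo {n N : ℕ} {c : Cmd} {s : Mem} (I : ℕ → Mem → Prop) (hw : 1 < 2 ^ w)
    (hn : s.reg n = N) (hN : N < 2 ^ w)
    (hreg : n ∉ c.wregs ∧ 40 ∉ c.wregs ∧ 42 ∉ c.wregs ∧ n ≠ 40 ∧ n ≠ 41 ∧ n ≠ 42)
    (h0 : ∀ b, I 0 (((s.setReg 42 1).setReg 40 0).setReg 41 b))
    (hstep : ∀ k s', k < N → I k s' → (c.forTo n).Frame s s' → s'.reg 40 = k → s'.reg 42 = 1 →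
      c.wp w (fun s'' => ∀ b, I (k + 1) ((s''.setReg 40 (k + 1)).setReg 41 b)) s') :
    Runs w (c.forTo n) s (N * (c.cost + 3) + 4) (fun s' => I N s' ∧ s'.reg 42 = 1) := by
  obtain ⟨r1, r2, r3, r4, r5, r6⟩ := hreg
  have hpre : Runs w ((const 42 1).seq <| (const 40 0).seq <| binop .lt 41 40 n) s 3
      (fun s' => s' = (((s.setReg 42 1).setReg 40 0).setReg 41 (if 0 < N then 1 else 0))) := by
    refine Runs.of_wp ?_
    simp only [wp, BinOp.eval, Mem.setReg_reg, r4, r6, hn, if_true, if_false]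
    refine ⟨hw, by omega, ?_, trivial⟩
    split_ifs <;> omega
  obtain ⟨s1, t1, hE1, ht1, hs1⟩ := hpre
  have hfr : (c.forTo n).Frame s s1 := by
    subst hs1
    refine ⟨fun x hx => ?_, fun _ _ => rfl⟩
    simp only [Cmd.forTo, wregs, List.cons_append, List.nil_append, List.mem_cons, not_or] at hx
    simp [Mem.setReg_reg, hx.1, hx.2.1, hx.2.2.1]
  have hsub : ∀ s' s'' : Mem,
      Cmd.Frame (Cmd.loop 41 <| c.seq <| (binop .add 40 40 42).seq <| binop .lt 41 40 n) s' s'' →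
      (c.forTo n).Frame s' s'' := by
    intro s' s'' h
    refine ⟨fun x hx => h.1 x fun h' => hx ?_, fun x hx => h.2 x fun h' => hx ?_⟩
    · simp only [Cmd.forTo, wregs, List.cons_append, List.nil_append, List.mem_cons] at h' ⊢
      tauto
    · simpa [Cmd.forTo, warrs] using h'
  have hloop := Runs.loop (w := w) (s := s1) (x := 41)
    (c := c.seq <| (binop .add 40 40 42).seq <| binop .lt 41 40 n)
    (fun s' => ∃ k ≤ N, I k s' ∧ s'.reg 40 = k ∧ s'.reg 42 = 1 ∧
      s'.reg n = N ∧ s'.reg 41 = if k < N then 1 else 0)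
    (fun s' => N - s'.reg 40)
    (by
      refine ⟨0, Nat.zero_le _, hs1 ▸ h0 _, ?_⟩
      simp [hs1, Mem.setReg_reg, r4, r5, r6, hn])
    (by
      rintro s' ⟨k, hk, hI, h40, h42, hnN, h41⟩ hf hx
      have hkN : k < N := by
        by_contra hcon
        simp [h41, hcon] at hx
      have hb := wp_frame (hstep k s' hkN hI (hfr.trans (hsub _ _ hf)) h40 h42)
      simp only [wp]
      refine wp_mono hb ?_
      rintro s2 ⟨hI2, hf2⟩
      have e40 : s2.reg 40 = k := by rw [hf2.1 _ r2, h40]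
      have e42 : s2.reg 42 = 1 := by rw [hf2.1 _ r3, h42]
      have en : s2.reg n = N := by rw [hf2.1 _ r1, hnN]
      simp only [BinOp.eval, Mem.setReg_reg, e40, e42, if_true, if_false, r4, en]
      refine ⟨by omega, by split_ifs <;> omega, ⟨k + 1, hkN, hI2 _, ?_⟩, ?_⟩
      · simp [r5]
      · simp; omega)
  obtain ⟨s2, t2, hE2, ht2, ⟨k, hk, hI, h40, h42, -, h41⟩, hz⟩ := hloop
  have hkN : k = N := by
    by_contra hcon
    have : k < N := by omega
    simp [h41, this] at hz
  subst hkN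
  have hcost : cost (c.seq <| (binop .add 40 40 42).seq <| binop .lt 41 40 n) = c.cost + 2 := rfl
  rw [hcost, show c.cost + 2 + 1 = c.cost + 3 from rfl] at ht2
  have h0' : s1.reg 40 = 0 := by simp [hs1, Mem.setReg_reg]
  simp only [h0', Nat.sub_zero] at ht2
  cases hE1 with
  | seq a b =>
    cases b with
    | seq b b' =>
      exact ⟨s2, _, a.seq (b.seq (b'.seq hE2)), by omega, hI, h42⟩

/-- The commands of a list, one after the other. -/
def block : List Cmd → Cmd
  | [] => skip
  | c :: l => c.seq (block l)

theorem Runs.block_append {l₁ l₂ : List Cmd} {s : Mem} {T T' : ℕ} {P P' : Mem → Prop}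
    (h : Runs w (block l₁) s T P) (h' : ∀ s', P s' → Runs w (block l₂) s' T' P') :
    Runs w (block (l₁ ++ l₂)) s (T + T') P' := by
  induction l₁ generalizing s T with
  | nil =>
    obtain ⟨s', t, hE, ht, hP⟩ := h
    cases hE
    exact (h' _ hP).mono (Nat.le_add_left _ _) fun _ h => h
  | cons c l ih =>
    obtain ⟨s', t, hE, ht, hP⟩ := h
    cases hE with
    | seq h1 h2 =>
      obtain ⟨s2, t2, g1, g2, g3⟩ := ih ⟨s', _, h2, le_rfl, hP⟩
      exact ⟨s2, _, h1.seq g1, by omega, g3⟩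

theorem Runs.block_cons {c : Cmd} {l : List Cmd} {s : Mem} {T T' : ℕ} {P P' : Mem → Prop}
    (h : Runs w c s T P) (h' : ∀ s', P s' → Runs w (block l) s' T' P') :
    Runs w (block (c :: l)) s (T + T') P' :=
  h.seq h'

theorem Runs.block_singleton {c : Cmd} {s : Mem} {T : ℕ} {P : Mem → Prop}
    (h : Runs w c s T P) : Runs w (block [c]) s (T + 1) P :=
  h.seq fun s' hs' => ⟨s', 1, Exec.skip s', le_rfl, hs'⟩

/-- The program that uses the registers and arrays with the numbers increased by `k`. -/
def shift (k : ℕ) : Cmd → Cmd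
  | skip => skip
  | const x n => const (x + k) n
  | binop o x y z => binop o (x + k) (y + k) (z + k)
  | load x a y => load (x + k) (a + k) (y + k)
  | store a y x => store (a + k) (y + k) (x + k)
  | seq c d => (c.shift k).seq (d.shift k)
  | ite x c d => ite (x + k) (c.shift k) (d.shift k)
  | loop x c => loop (x + k) (c.shift k)

theorem le_of_mem_wregs_shift {k x : ℕ} {c : Cmd} (h : x ∈ (c.shift k).wregs) : k ≤ x := by
  induction c with
  | skip => simp [shift, wregs] at h
  | const _ _ => simp only [shift, wregs, List.mem_singleton] at h; omega
  | binop _ _ _ _ => simp only [shift, wregs, List.mem_singleton] at h; omega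
  | load _ _ _ => simp only [shift, wregs, List.mem_singleton] at h; omega
  | store _ _ _ => simp [shift, wregs] at h
  | seq c d ihc ihd =>
    simp only [shift, wregs, List.mem_append] at h
    exact h.elim ihc ihd
  | ite _ c d ihc ihd =>
    simp only [shift, wregs, List.mem_append] at h
    exact h.elim ihc ihd
  | loop _ c ih => exact ih h

theorem le_of_mem_warrs_shift {k x : ℕ} {c : Cmd} (h : x ∈ (c.shift k).warrs) : k ≤ x := by
  induction c with
  | store _ _ _ => simp only [shift, warrs, List.mem_singleton] at h; omega
  | seq c d ihc ihd =>
    simp only [shift, warrs, List.mem_append] at h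
    exact h.elim ihc ihd
  | ite _ c d ihc ihd =>
    simp only [shift, warrs, List.mem_append] at h
    exact h.elim ihc ihd
  | loop _ c ih => exact ih h
  | _ => simp [shift, warrs] at h

/-- The memory `s` is found in the memory `r` at the numbers increased by `k`. -/
def Shifted (k : ℕ) (s r : Mem) : Prop :=
  (∀ x, r.reg (x + k) = s.reg x) ∧ ∀ a, r.arr (a + k) = s.arr a

theorem Shifted.setReg {k : ℕ} {s r : Mem} (h : Shifted k s r) (x n : ℕ) :
    Shifted k (s.setReg x n) (r.setReg (x + k) n) :=
  ⟨fun y => by simp [Mem.setReg_reg, h.1], h.2⟩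

theorem Shifted.setArr {k : ℕ} {s r : Mem} (h : Shifted k s r) (a i n : ℕ) :
    Shifted k (s.setArr a i n) (r.setArr (a + k) i n) :=
  ⟨h.1, fun y => by simp [Mem.setArr_arr, h.2]⟩

/-- Nothing is known about the registers and arrays that the sorting program uses. Renaming commutes
with execution and keeps the number of steps, so it can run in a fresh part of the memory. -/
theorem exec_shift {k : ℕ} {c : Cmd} {s s' : Mem} {t : ℕ} (h : Exec w c s s' t) :
    ∀ r, Shifted k s r → ∃ r', Exec w (c.shift k) r r' t ∧ Shifted k s' r' := by
  induction h with
  | skip s => exact fun r hr => ⟨r, Exec.skip r, hr⟩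
  | const x n s => exact fun r hr => ⟨_, Exec.const _ _ _, hr.setReg _ _⟩
  | binop o x y z s =>
    intro r hr
    refine ⟨_, Exec.binop _ _ _ _ _, ?_⟩
    rw [hr.1, hr.1]
    exact hr.setReg _ _
  | load x a y s =>
    intro r hr
    refine ⟨_, Exec.load _ _ _ _, ?_⟩
    rw [hr.1, hr.2]
    exact hr.setReg _ _
  | store a y x s =>
    intro r hr
    refine ⟨_, Exec.store _ _ _ _, ?_⟩
    rw [hr.1, hr.1]
    exact hr.setArr _ _ _
  | seq _ _ ih ih' =>
    intro r hr
    obtain ⟨r1, h1, h2⟩ := ih r hr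
    obtain ⟨r2, h3, h4⟩ := ih' r1 h2
    exact ⟨r2, h1.seq h3, h4⟩
  | ite_true hx _ ih =>
    intro r hr
    obtain ⟨r1, h1, h2⟩ := ih r hr
    exact ⟨r1, Exec.ite_true (by rwa [hr.1]) h1, h2⟩
  | ite_false hx _ ih =>
    intro r hr
    obtain ⟨r1, h1, h2⟩ := ih r hr
    exact ⟨r1, Exec.ite_false (by rwa [hr.1]) h1, h2⟩
  | loop_false hx => exact fun r hr => ⟨r, Exec.loop_false (by rwa [hr.1]), hr⟩
  | loop_true hx _ _ ih ih' =>
    intro r hr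
    obtain ⟨r1, h1, h2⟩ := ih r hr
    obtain ⟨r2, h3, h4⟩ := ih' r1 h2
    exact ⟨r2, Exec.loop_true (by rwa [hr.1]) h1 h3, h4⟩

end Cmd
end WheelerBisim


namespace WheelerBisim

/-! ### Stable counting sort -/

/-- The position of `i` in the stable sorting of `0, …, M - 1` by the keys `κ`. -/
def sortPos (κ : ℕ → ℕ) (M i : ℕ) : ℕ :=
  Nat.count (fun j => κ j < κ i) M + Nat.count (fun j => κ j = κ i) i

theorem count_lt_succ (κ : ℕ → ℕ) (x M : ℕ) : Nat.count (fun j => κ j < x + 1) M =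
    Nat.count (fun j => κ j < x) M + Nat.count (fun j => κ j = x) M := by
  induction M with
  | zero => simp
  | succ M ih =>
    simp only [Nat.count_succ, ih]
    split_ifs <;> omega

theorem sortPos_lt_count {κ : ℕ → ℕ} {M i : ℕ} (hi : i < M) :
    sortPos κ M i < Nat.count (fun j => κ j < κ i + 1) M := by
  rw [count_lt_succ, sortPos]
  have := Nat.count_strict_mono (p := fun j => κ j = κ i) rfl hi
  omega

theorem sortPos_lt {κ : ℕ → ℕ} {M i : ℕ} (hi : i < M) : sortPos κ M i < M :=
  (sortPos_lt_count hi).trans_le (Nat.count_le _)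

theorem sortPos_lt_of_key {κ : ℕ → ℕ} {M i j : ℕ} (hi : i < M) (h : κ i < κ j) :
    sortPos κ M i < sortPos κ M j := by
  refine (sortPos_lt_count hi).trans_le (le_trans ?_ (Nat.le_add_right _ _))
  exact Nat.count_mono_left fun k hk => by omega

theorem sortPos_lt_of_lt {κ : ℕ → ℕ} {M i j : ℕ} (h : κ i = κ j) (hij : i < j) :
    sortPos κ M i < sortPos κ M j := by
  simp only [sortPos, h]
  have := Nat.count_strict_mono (p := fun k => κ k = κ j) h hij
  omega

theorem sortPos_inj {κ : ℕ → ℕ} {M i j : ℕ} (hi : i < M) (hj : j < M)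
    (h : sortPos κ M i = sortPos κ M j) : i = j := by
  rcases lt_trichotomy (κ i) (κ j) with h1 | h1 | h1
  · have := sortPos_lt_of_key hi h1; omega
  · rcases lt_trichotomy i j with h2 | h2 | h2
    · have := sortPos_lt_of_lt (M := M) h1 h2; omega
    · exact h2
    · have := sortPos_lt_of_lt (M := M) h1.symm h2; omega
  · have := sortPos_lt_of_key hj h1; omega

theorem sortPos_surj {κ : ℕ → ℕ} {M p : ℕ} (hp : p < M) : ∃ i < M, sortPos κ M i = p := by
  have := Finset.surj_on_of_inj_on_of_card_le (s := Finset.range M) (t := Finset.range M)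
    (fun i _ => sortPos κ M i) (fun i hi => by simpa using sortPos_lt (by simpa using hi))
    (fun i j hi hj h => sortPos_inj (by simpa using hi) (by simpa using hj) h) le_rfl p
    (by simpa using hp)
  obtain ⟨i, hi, h⟩ := this
  exact ⟨i, by simpa using hi, h.symm⟩

/-- `d` lists the numbers below `M`, each once. -/
def IsListing (M : ℕ) (d : ℕ → ℕ) : Prop :=
  (∀ i < M, d i < M) ∧ ∀ i < M, ∀ j < M, d i = d j → i = j

theorem IsListing.surj {M : ℕ} {d : ℕ → ℕ} (h : IsListing M d) {e : ℕ} (he : e < M) :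
    ∃ i < M, d i = e := by
  have := Finset.surj_on_of_inj_on_of_card_le (s := Finset.range M) (t := Finset.range M)
    (fun i _ => d i) (fun i hi => by simpa using h.1 i (by simpa using hi))
    (fun i j hi hj h' => h.2 i (by simpa using hi) j (by simpa using hj) h') le_rfl e
    (by simpa using he)
  obtain ⟨i, hi, h⟩ := this
  exact ⟨i, by simpa using hi, h.symm⟩

/-- The entries of `d` are listed in an order compatible with `r`. -/
def ListedBy (M : ℕ) (d : ℕ → ℕ) (r : ℕ → ℕ → Prop) : Prop :=
  ∀ i j, i < j → j < M → r (d i) (d j)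

/-- Compare by `key` first, then by `r`. -/
def ByKey (key : ℕ → ℕ) (r : ℕ → ℕ → Prop) (e f : ℕ) : Prop :=
  key e < key f ∨ key e = key f ∧ r e f

/-- The step of a radix sort: by stability, entries with equal keys keep their previous order `r`.
-/
theorem IsListing.of_sortPos {M : ℕ} {d d' key : ℕ → ℕ} (h : IsListing M d)
    (hd : ∀ i < M, d' (sortPos (fun i => key (d i)) M i) = d i) :
    IsListing M d' ∧ ∀ r, ListedBy M d r → ListedBy M d' (ByKey key r) := by
  set κ := fun i => key (d i) with hκ
  refine ⟨⟨fun p hp => ?_, fun p hp q hq hpq => ?_⟩, fun r hr p q hpq hq => ?_⟩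
  · obtain ⟨i, hi, rfl⟩ := sortPos_surj (κ := κ) hp
    rw [hd i hi]; exact h.1 i hi
  · obtain ⟨i, hi, rfl⟩ := sortPos_surj (κ := κ) hp
    obtain ⟨j, hj, rfl⟩ := sortPos_surj (κ := κ) hq
    rw [hd i hi, hd j hj] at hpq
    rw [h.2 i hi j hj hpq]
  · obtain ⟨i, hi, rfl⟩ := sortPos_surj (κ := κ) (hpq.trans hq)
    obtain ⟨j, hj, rfl⟩ := sortPos_surj (κ := κ) hq
    rw [hd i hi, hd j hj]
    rcases lt_trichotomy (κ i) (κ j) with h1 | h1 | h1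
    · exact Or.inl h1
    · refine Or.inr ⟨h1, ?_⟩
      rcases lt_trichotomy i j with h2 | h2 | h2
      · exact hr i j h2 hj
      · subst h2; omega
      · have := sortPos_lt_of_lt (M := M) h1.symm h2; omega
    · have := sortPos_lt_of_key hj h1; omega

namespace Cmd

variable {w : ℕ}

/-- Stable counting sort of the list in array `inn` (of length register `4`) by the keys in array
`key`, which are below register `kb`. The array `cnt` must be zero. -/
def countingSort (key kb inn out cnt : ℕ) : Cmd :=
  block [
    forTo 4 (block [load 20 inn 40, load 21 key 20, binop .add 21 21 42, load 22 cnt 21,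
      binop .add 22 22 42, store cnt 21 22]),
    forTo kb (block [load 20 cnt 40, binop .add 21 40 42, load 22 cnt 21, binop .add 22 22 20,
      store cnt 21 22]),
    forTo 4 (block [load 20 inn 40, load 21 key 20, load 22 cnt 21, store out 22 20,
      binop .add 22 22 42, store cnt 21 22])]

/-- Count the keys, form running sums, then place the entries from left to right. Placing in the
given order makes the sort stable. -/
theorem countingSort_runs {key kb inn out cnt : ℕ} {s : Mem} {M K : ℕ}
    (hne : key ≠ cnt ∧ inn ≠ cnt ∧ out ≠ cnt ∧ key ≠ out ∧ inn ≠ out)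
    (hkb : kb < 20) (h4 : s.reg 4 = M) (hK : s.reg kb = K) (hcnt : ∀ i, s.arr cnt i = 0)
    (hkey : ∀ i < M, s.arr key (s.arr inn i) < K) (hw : M + K + 2 ≤ 2 ^ w) :
    Runs w (countingSort key kb inn out cnt) s (30 * (M + K + 1)) (fun s' =>
      ∀ i < M, s'.arr out (sortPos (fun i => s.arr key (s.arr inn i)) M i) = s.arr inn i) := by
  obtain ⟨n1, n2, n3, n4, n5⟩ := hne
  set κ := fun i => s.arr key (s.arr inn i) with hκ
  have hloop1 := Runs.forTo (w := w) (n := 4) (N := M) (s := s)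
    (c := block [load 20 inn 40, load 21 key 20, binop .add 21 21 42, load 22 cnt 21,
      binop .add 22 22 42, store cnt 21 22])
    -- The number of keys equal to `x` is stored at `x + 1`, so that after summation entry `x` is
    -- the number of keys below `x`, where the block of `x` starts.
    (fun k s' => s'.arr cnt 0 = 0 ∧ ∀ x, s'.arr cnt (x + 1) = Nat.count (fun j => κ j = x) k)
    (by omega) h4 (by omega) (by simp [block, wregs])
    (by simp [Mem.setReg_arr, hcnt])
    (by
      rintro k s' hk ⟨hc0, hc⟩ hf h40 h42
      have e1 : s'.arr inn = s.arr inn := hf.2 _ (by simp [block, forTo, warrs, n2])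
      have e2 : s'.arr key = s.arr key := hf.2 _ (by simp [block, forTo, warrs, n1])
      have hkk := hkey k hk
      have hck := Nat.count_le (fun j => κ j = s.arr key (s.arr inn k)) (n := k)
      simp only [block, wp, BinOp.eval, Mem.setReg_reg, Mem.setReg_arr, Mem.setArr_arr,
        h40, h42, e1, e2, hκ]
      norm_num
      rw [hc]
      refine ⟨by omega, by omega, by simpa using hc0, fun x => ?_⟩
      simp only [Function.update_apply, Nat.add_right_cancel_iff, hc, Nat.count_succ]
      by_cases hx : x = s.arr key (s.arr inn k)
      · simp [hx, hκ]
      · rw [if_neg hx, if_neg (Ne.symm hx), add_zero])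
  refine ((hloop1.frame).seq (T' := K * 9 + 4 + (M * 10 + 4 + 1)) (P' := fun s' =>
      ∀ i < M, s'.arr out (sortPos (fun i => s.arr key (s.arr inn i)) M i) = s.arr inn i) ?_).mono ?_
      (fun _ h => h)
  swap
  · simp only [block, cost]; omega
  rintro s1 ⟨⟨⟨i0, i1⟩, -⟩, hf1⟩
  have f4 : s1.reg 4 = M := by rw [hf1.1 _ (by simp [block, forTo, wregs]), h4]
  have fk : s1.reg kb = K := by
    rw [hf1.1 _ (by simp [block, forTo, wregs]; omega), hK]
  have fi : s1.arr inn = s.arr inn := hf1.2 _ (by simp [block, forTo, warrs, n2])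
  have fke : s1.arr key = s.arr key := hf1.2 _ (by simp [block, forTo, warrs, n1])
  clear hf1 hloop1
  have hloop2 := Runs.forTo (w := w) (n := kb) (N := K) (s := s1)
    (c := block [load 20 cnt 40, binop .add 21 40 42, load 22 cnt 21, binop .add 22 22 20,
      store cnt 21 22])
    (fun k s' => (∀ x ≤ k, s'.arr cnt x = Nat.count (fun j => κ j < x) M) ∧
      ∀ x, k ≤ x → s'.arr cnt (x + 1) = Nat.count (fun j => κ j = x) M)
    (by omega) fk (by omega) (by simp [block, wregs]; omega)
    (by simp [Mem.setReg_arr, i0, i1])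
    (by
      rintro k s' hk ⟨hc0, hc⟩ hf h40 h42
      have hck := Nat.count_le (fun j => κ j < k + 1) (n := M)
      have a1 := hc0 k le_rfl
      have a2 := hc k le_rfl
      have a3 := count_lt_succ κ k M
      simp only [block, wp, BinOp.eval, Mem.setReg_reg, Mem.setReg_arr, Mem.setArr_arr,
        h40, h42]
      norm_num
      refine ⟨by omega, by omega, fun x hx => ?_, fun x hx => ?_⟩
      · rw [Function.update_apply]
        split_ifs with h
        · subst h; omega
        · exact hc0 x (by omega)
      · rw [Function.update_apply, if_neg (by omega)]
        exact hc x (by omega))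
  refine hloop2.frame.seq (T' := M * 10 + 4 + 1) ?_
  rintro s2 ⟨⟨⟨j1, -⟩, -⟩, hf2⟩
  have g4 : s2.reg 4 = M := by rw [hf2.1 _ (by simp [block, forTo, wregs]), f4]
  have gi : s2.arr inn = s.arr inn := by rw [hf2.2 _ (by simp [block, forTo, warrs, n2]), fi]
  have gk : s2.arr key = s.arr key := by rw [hf2.2 _ (by simp [block, forTo, warrs, n1]), fke]
  clear hf2 hloop2 fi fke f4 fk
  have hloop3 := Runs.forTo (w := w) (n := 4) (N := M) (s := s2)
    (c := block [load 20 inn 40, load 21 key 20, load 22 cnt 21, store out 22 20,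
      binop .add 22 22 42, store cnt 21 22])
    -- Entry `x` is now the next free position in the block of `x`; for the key of item `k` this is
    -- `sortPos κ M k`.
    (fun k s' => (∀ x < K, s'.arr cnt x = Nat.count (fun j => κ j < x) M +
        Nat.count (fun j => κ j = x) k) ∧
      ∀ i < k, s'.arr out (sortPos κ M i) = s.arr inn i)
    (by omega) g4 (by omega) (by simp [block, wregs])
    (by
      intro b
      refine ⟨fun x hx => ?_, fun i hi => by omega⟩
      simp only [Mem.setReg_arr, Nat.count_zero, add_zero]
      exact j1 x hx.le)
    (by
      rintro k s' hk ⟨hc, ho⟩ hf h40 h42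
      have e1 : s'.arr inn = s.arr inn :=
        (hf.2 _ (by simp [block, forTo, warrs, n2, n5])).trans gi
      have e2 : s'.arr key = s.arr key :=
        (hf.2 _ (by simp [block, forTo, warrs, n1, n4])).trans gk
      have hkk := hkey k hk
      have hpos : s'.arr cnt (s.arr key (s.arr inn k)) = sortPos κ M k := hc _ hkk
      have hlt := sortPos_lt (κ := κ) hk
      simp only [block, wp, BinOp.eval, Mem.setReg_reg, Mem.setReg_arr, Mem.setArr_arr,
        Mem.setArr_reg, h40, h42, e1, e2]
      simp only [Nat.reduceEqDiff, if_true, if_false, hpos, n3, n3.symm]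
      refine ⟨by omega, fun b => ⟨fun x hx => ?_, fun i hi => ?_⟩⟩
      · rw [Function.update_apply, Nat.count_succ]
        split_ifs with h h' h'
        · subst h; rw [sortPos, hκ]; ring
        · exact absurd h.symm h'
        · exact absurd h'.symm h
        · exact hc x hx
      · rw [Function.update_apply]
        split_ifs with h
        · rw [sortPos_inj (by omega) hk h]
        · refine ho i ?_
          by_contra hcon
          exact h (by rw [show i = k by omega]))
  refine hloop3.seq (T' := 1) ?_
  rintro s3 ⟨⟨-, h⟩, -⟩
  exact Runs.of_wp (c := skip) h

end Cmd
end WheelerBisim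


namespace WheelerBisim

/-! ### Computing the boundaries -/

namespace Cmd

variable {w : ℕ} {J : EdgeData}

/-- The memory holds the two automata, with ranks in place of labels, in the arrays `0` (sources),
`1` (targets), `8` (labels), `3` (final states). -/
structure Holds (J : EdgeData) (s : Mem) : Prop where
  n : s.reg 0 = J.n
  m : s.reg 1 = J.m
  M : s.reg 4 = J.M
  N : s.reg 5 = J.N
  M1 : s.reg 6 = J.M + 1
  N1 : s.reg 7 = J.N + 1
  src : s.arr 0 = J.src
  dst : s.arr 1 = J.dst
  lab : s.arr 8 = J.lab
  fin : s.arr 3 = J.fin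

theorem Holds.frame {c : Cmd} {s s' : Mem} (h : Holds J s) (hf : c.Frame s s')
    (hr : ∀ x ∈ c.wregs, x ∉ [0, 1, 4, 5, 6, 7]) (ha : ∀ a ∈ c.warrs, a ∉ [0, 1, 3, 8]) :
    Holds J s' := by
  have hr' : ∀ x ∈ [0, 1, 4, 5, 6, 7], s'.reg x = s.reg x :=
    fun x hx => hf.1 x fun h => hr x h hx
  have ha' : ∀ x ∈ [0, 1, 3, 8], s'.arr x = s.arr x := fun x hx => hf.2 x fun h => ha x h hx
  exact ⟨(hr' 0 (by simp)).trans h.n, (hr' 1 (by simp)).trans h.m, (hr' 4 (by simp)).trans h.M,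
    (hr' 5 (by simp)).trans h.N, (hr' 6 (by simp)).trans h.M1, (hr' 7 (by simp)).trans h.N1,
    (ha' 0 (by simp)).trans h.src, (ha' 1 (by simp)).trans h.dst, (ha' 8 (by simp)).trans h.lab,
    (ha' 3 (by simp)).trans h.fin⟩

/-- The boundaries found when the queue contains `qs`. -/
def Marked (J : EdgeData) (qs : List ℕ) (v : ℕ) : Prop :=
  v = 0 ∨ v = J.n ∨ v = J.N ∨ v ∈ qs

instance (J : EdgeData) (qs : List ℕ) (v : ℕ) : Decidable (Marked J qs v) := by
  unfold Marked; infer_instance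

/-- The queue in array `15`, of length register `10`, contains `qs`, and array `14` marks the
boundaries found. -/
structure Queued (J : EdgeData) (s : Mem) (qs : List ℕ) : Prop where
  length : s.reg 10 = qs.length
  get : ∀ i (h : i < qs.length), s.arr 15 i = qs[i]
  nodup : qs.Nodup
  mem : ∀ v ∈ qs, v < J.N ∧ v ≠ 0 ∧ v ≠ J.n
  mark : ∀ v, s.arr 14 v = if Marked J qs v then 1 else 0

theorem Queued.congr {s s' : Mem} {qs : List ℕ} (h : Queued J s qs) (h1 : s'.reg 10 = s.reg 10)
    (h2 : s'.arr 14 = s.arr 14) (h3 : s'.arr 15 = s.arr 15) : Queued J s' qs :=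
  ⟨h1 ▸ h.length, h3 ▸ h.get, h.nodup, h.mem, h2 ▸ h.mark⟩

/-- The queue never holds a number twice. This bounds the time of the propagation and keeps the
queue pointers within a word. -/
theorem Queued.length_le {s : Mem} {qs : List ℕ} (h : Queued J s qs) : qs.length ≤ J.N := by
  rw [← List.toFinset_card_of_nodup h.nodup, ← Finset.card_range J.N]
  refine Finset.card_le_card fun v hv => ?_
  simpa using (h.mem v (by simpa using hv)).1

/-- Mark the boundary in register `x` and put it into the queue, unless it is marked. -/
def push (x : ℕ) : Cmd :=
  block [load 39 14 x, ite 39 skip (block [store 14 x 42, store 15 10 x, binop .add 10 10 42])]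

/-- The value `J.N` is permitted for the register because it is always marked and therefore never
enters the queue. -/
theorem wp_push {x : ℕ} {s : Mem} {qs : List ℕ} {P : Mem → Prop} (hx : x ≠ 39)
    (hQ : Queued J s qs) (h42 : s.reg 42 = 1) (hv : s.reg x ≤ J.N) (hw : J.N + 3 ≤ 2 ^ w)
    (h : ∀ s' qs', Queued J s' qs' →
      (∀ u, Marked J qs' u ↔ Marked J qs u ∨ u = s.reg x) → qs <+: qs' →
      (∀ r, r ≠ 10 → r ≠ 39 → s'.reg r = s.reg r) →
      (∀ a, a ≠ 14 → a ≠ 15 → s'.arr a = s.arr a) → P s') :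
    (push x).wp w P s := by
  have hl := hQ.length_le
  have hmk := hQ.mark (s.reg x)
  simp only [push, block, wp, BinOp.eval, Mem.setReg_reg, Mem.setArr_reg, h42, hx, if_true, if_false, Nat.reduceEqDiff]
  refine ⟨fun h1 => ?_, fun h1 => ⟨?_, ?_⟩⟩
  · have hm : Marked J qs (s.reg x) := by
      by_contra hcon
      rw [if_neg hcon] at hmk
      exact h1 hmk
    refine h _ qs (hQ.congr ?_ rfl rfl) (fun u => ⟨Or.inl, ?_⟩) (List.prefix_refl _) ?_ ?_
    · simp [Mem.setReg_reg]
    · rintro (h2 | rfl)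
      · exact h2
      · exact hm
    · intro r _ h3; simp [Mem.setReg_reg, h3]
    · intros; rfl
  · rw [hQ.length]; omega
  · have hm : ¬ Marked J qs (s.reg x) := by
      intro hcon
      rw [if_pos hcon] at hmk
      omega
    have hm' := hm
    simp only [Marked, not_or] at hm'
    have hiff : ∀ u, Marked J (qs ++ [s.reg x]) u ↔ Marked J qs u ∨ u = s.reg x := by
      intro u
      simp only [Marked, List.mem_append, List.mem_singleton]
      tauto
    refine h _ (qs ++ [s.reg x]) ⟨?_, ?_, ?_, ?_, ?_⟩ hiff (List.prefix_append _ _) ?_ ?_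
    · simp [Mem.setReg_reg, hQ.length]
    · intro i hi
      simp only [List.length_append, List.length_singleton] at hi
      simp only [Mem.setReg_arr, Mem.setArr_arr, Nat.reduceEqDiff, if_true, if_false,
        Function.update_apply, hQ.length]
      split_ifs with h2
      · subst h2; simp
      · rw [List.getElem_append_left (by omega)]
        exact hQ.get i (by omega)
    · rw [List.nodup_append]
      refine ⟨hQ.nodup, by simp, ?_⟩
      simp only [List.mem_singleton, forall_eq]
      exact fun a ha hax => hm'.2.2.2 (hax ▸ ha)
    · intro v hv'
      simp only [List.mem_append, List.mem_singleton] at hv'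
      rcases hv' with h2 | rfl
      · exact hQ.mem v h2
      · exact ⟨by omega, hm'.1, hm'.2.1⟩
    · intro v
      simp only [Mem.setReg_arr, Mem.setArr_arr, Nat.reduceEqDiff, if_true, if_false,
        Function.update_apply, hQ.mark, hiff v]
      by_cases h2 : v = s.reg x <;> simp [h2]
    · intro r h2 h3; simp [Mem.setReg_reg, Mem.setArr_reg, h2, h3]
    · intro a h2 h3; simp [Mem.setReg_arr, Mem.setArr_arr, h2, h3]

/-- All marked boundaries are boundaries. -/
def Sound (J : EdgeData) (qs : List ℕ) : Prop := ∀ v, Marked J qs v → J.Bd v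

theorem Sound.insert {qs qs' : List ℕ} {x : ℕ} (h : Sound J qs) (hx : J.Bd x)
    (hiff : ∀ u, Marked J qs' u ↔ Marked J qs u ∨ u = x) : Sound J qs' := by
  intro v hv
  rcases (hiff v).1 hv with h1 | rfl
  · exact h v h1
  · exact hx

/-- The boundaries where one state is final and the other is not are marked. -/
def CoversFin (J : EdgeData) (qs : List ℕ) (k : ℕ) : Prop :=
  ∀ v, v + 1 < k → J.fin v ≠ J.fin (v + 1) → Marked J qs (v + 1)

/-- Mark the ends of the two automata and the boundaries between final and other states. -/
def markFin : Cmd :=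
  block [const 42 1, const 10 0, const 20 0, store 14 20 42, store 14 0 42, store 14 5 42,
    forTo 5 (block [load 20 3 40, binop .sub 21 40 42, load 21 3 21, binop .eq 22 20 21,
      ite 22 skip (push 40)])]

theorem markFin_runs {s : Mem} (hs : Holds J s) (h14 : ∀ v, s.arr 14 v = 0)
    (hw : J.N + 3 ≤ 2 ^ w) :
    Runs w markFin s (20 * (J.N + 1)) (fun s' => s'.reg 42 = 1 ∧
      ∃ qs, Queued J s' qs ∧ Sound J qs ∧ CoversFin J qs J.N) := by
  have hpre : Runs w (block [const 42 1, const 10 0, const 20 0, store 14 20 42, store 14 0 42,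
      store 14 5 42]) s 7 (fun s' => Queued J s' []) := by
    refine Runs.of_wp ?_
    simp only [block, wp, Mem.setReg_reg, Mem.setArr_reg, if_true, if_false, Nat.reduceEqDiff]
    refine ⟨by omega, by omega, by omega, ?_, by simp, by simp, by simp, ?_⟩
    · simp [Mem.setArr_reg, Mem.setReg_reg]
    · intro v
      simp only [Mem.setArr_arr, if_true, Function.update_apply, Mem.setReg_arr, h14, hs.n, hs.N,
        Marked]
      simp
      grind
  refine (Runs.block_append (T' := J.N * 16 + 5) (l₂ := [_]) hpre.frame ?_).mono (by omega)
    fun _ h => h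
  rintro s1 ⟨hQ1, hf1⟩
  have hs1 : Holds J s1 := hs.frame hf1 (by simp [block, wregs]) (by simp [block, warrs])
  have hloop := Runs.forTo (w := w) (n := 5) (N := J.N) (s := s1)
    (c := block [load 20 3 40, binop .sub 21 40 42, load 21 3 21, binop .eq 22 20 21,
      ite 22 skip (push 40)])
    (fun k s' => ∃ qs, Queued J s' qs ∧ Sound J qs ∧ CoversFin J qs k)
    (by omega) hs1.N (by omega) (by simp [block, wregs, push])
    (by
      intro b
      refine ⟨[], hQ1.congr ?_ rfl rfl, ?_, ?_⟩
      · simp [Mem.setReg_reg]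
      · intro v hv
        simp only [Marked, List.not_mem_nil, or_false] at hv
        rcases hv with rfl | rfl | rfl
        · exact .zero
        · exact .mid
        · exact .top
      · intro v hv; omega)
    (by
      rintro k s' hk ⟨qs, hQ, hS, hC⟩ hf h40 h42
      have e3 : s'.arr 3 = J.fin :=
        (hf.2 _ (by simp [block, forTo, warrs, push])).trans hs1.fin
      simp only [block, wp, BinOp.eval, Mem.setReg_reg, Mem.setReg_arr,
        if_true, if_false, Nat.reduceEqDiff, h40, h42, e3]
      refine ⟨by omega, by split_ifs <;> omega, fun h1 b => ?_, fun h1 => ?_⟩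
      · have h1 : J.fin k = J.fin (k - 1) := by
          by_contra hcon; simp [hcon] at h1
        refine ⟨qs, hQ.congr (by simp [Mem.setReg_reg]) rfl rfl, hS, ?_⟩
        intro v hv hne
        rcases Nat.lt_or_ge (v + 1) k with h2 | h2
        · exact hC v h2 hne
        · obtain rfl : k = v + 1 := by omega
          exact absurd h1.symm hne
      · have h1 : J.fin k ≠ J.fin (k - 1) := by
          intro hcon; simp [hcon] at h1
        -- In round `0` the subtraction is truncated and state `0` is compared with itself, so this
        -- branch is not taken.
        have hk0 : k ≠ 0 := by rintro rfl; simp at h1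
        obtain ⟨u, rfl⟩ : ∃ u, k = u + 1 := ⟨k - 1, by omega⟩
        refine wp_push (qs := qs) (by norm_num) (hQ.congr (by simp [Mem.setReg_reg]) rfl rfl)
          (by simp [Mem.setReg_reg, h42]) (by simp [Mem.setReg_reg, h40]; omega) hw ?_
        intro s2 qs2 hQ2 hM2 _ hr ha b
        simp only [Mem.setReg_reg, Nat.reduceEqDiff, if_false, h40] at hM2
        refine ⟨qs2, hQ2.congr (by simp [Mem.setReg_reg]) rfl rfl,
          hS.insert (EdgeData.Bd.fin u hk (by simpa using h1.symm)) hM2, ?_⟩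
        intro v hv hne
        rw [hM2]
        rcases Nat.lt_or_ge (v + 1) (u + 1) with h2 | h2
        · exact Or.inl (hC v h2 hne)
        · exact Or.inr (by omega))
  refine Runs.block_singleton (hloop.mono ?_ ?_)
  · simp only [block, cost, push]; norm_num
  · rintro s2 ⟨⟨qs, h1, h2, h3⟩, h42⟩
    exact ⟨h42, qs, h1, h2, h3⟩

end Cmd
end WheelerBisim


/-! ### Boundaries between states with different outgoing labels -/

namespace WheelerBisim

namespace Cmd

variable {w : ℕ} {J : EdgeData}

/-- The edges are listed by label, then source. -/
structure Sorted (J : EdgeData) (d : ℕ → ℕ) : Prop where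
  listing : IsListing J.M d
  listed : ListedBy J.M d (ByKey J.lab (ByKey J.src fun _ _ => True))

theorem Sorted.le {d : ℕ → ℕ} (h : Sorted J d) {i j : ℕ} (hij : i ≤ j) (hj : j < J.M) :
    J.lab (d i) < J.lab (d j) ∨ J.lab (d i) = J.lab (d j) ∧ J.src (d i) ≤ J.src (d j) := by
  rcases Nat.lt_or_ge i j with h1 | h1
  · rcases h.listed i j h1 hj with h2 | ⟨h2, h3 | ⟨h3, -⟩⟩
    · exact Or.inl h2
    · exact Or.inr ⟨h2, h3.le⟩
    · exact Or.inr ⟨h2, h3.le⟩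
  · obtain rfl : i = j := by omega
    exact Or.inr ⟨rfl, le_rfl⟩

/-- The boundary before the source of `e` is marked if its label is missing there. -/
def CoversLeft (J : EdgeData) (qs : List ℕ) (e : ℕ) : Prop :=
  Marked J qs (J.src e) ∨ ∃ g < J.M, J.lab g = J.lab e ∧ J.src g + 1 = J.src e

/-- The boundary after the source of `e` is marked if its label is missing there. -/
def CoversRight (J : EdgeData) (qs : List ℕ) (e : ℕ) : Prop :=
  Marked J qs (J.src e + 1) ∨ ∃ g < J.M, J.lab g = J.lab e ∧ J.src g = J.src e + 1

/-- Mark the boundaries between two states that differ in the labels of their outgoing edges. -/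
def markLabels : Cmd :=
  ite 4 (block [const 20 0, load 21 12 20, load 23 0 21, load 24 8 21, push 23,
    forTo 4 (block [load 21 12 40, load 25 0 21, load 26 8 21, binop .add 27 23 42,
      binop .eq 22 24 26, binop .lt 28 27 25,
      ite 22 (ite 28 (block [push 27, push 25]) skip) (block [push 27, push 25]),
      load 23 0 21, load 24 8 21]),
    binop .add 27 23 42, push 27]) skip

/-- Consecutive entries of the sorted list leave no room for an edge with the label of `d k` whose
source is the next state. The same reasoning, seen from the other end of the gap, gives
`left_of_gap`. -/
theorem right_of_gap {d : ℕ → ℕ} (hd : Sorted J d) {k : ℕ} (hk : k + 1 < J.M)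
    (hgap : J.lab (d k) = J.lab (d (k + 1)) → J.src (d k) + 1 < J.src (d (k + 1))) :
    J.Bd (J.src (d k) + 1) := by
  refine EdgeData.Bd.right _ (hd.listing.1 k (by omega)) fun g hg hl hs => ?_
  obtain ⟨j, hj, rfl⟩ := hd.listing.surj hg
  rcases Nat.lt_or_ge k j with h1 | h1
  · have h2 := hd.le (i := k + 1) (j := j) h1 hj
    have h3 := hd.le (i := k) (j := k + 1) (by omega) hk
    omega
  · have h2 := hd.le (i := j) (j := k) h1 (by omega)
    omega

theorem left_of_gap {d : ℕ → ℕ} (hd : Sorted J d) {k : ℕ} (hk : k + 1 < J.M)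
    (hgap : J.lab (d k) = J.lab (d (k + 1)) → J.src (d k) + 1 < J.src (d (k + 1))) :
    J.Bd (J.src (d (k + 1))) := by
  refine EdgeData.Bd.left _ (hd.listing.1 (k + 1) (by omega)) fun g hg hl hs => ?_
  obtain ⟨j, hj, rfl⟩ := hd.listing.surj hg
  rcases Nat.lt_or_ge k j with h1 | h1
  · have h2 := hd.le (i := k + 1) (j := j) h1 hj
    omega
  · have h2 := hd.le (i := j) (j := k) h1 (by omega)
    have h3 := hd.le (i := k) (j := k + 1) (by omega) hk
    omega

/-- The state of the loop in `markLabels` after `k` rounds. -/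
structure MarkInv (J : EdgeData) (d : ℕ → ℕ) (k : ℕ) (qs : List ℕ) : Prop where
  sound : Sound J qs
  fin : CoversFin J qs J.N
  left : ∀ i < k, CoversLeft J qs (d i)
  right : ∀ i < k, CoversRight J qs (d i) ∨
    J.lab (d i) = J.lab (d (k - 1)) ∧ J.src (d i) = J.src (d (k - 1))
  first : Marked J qs (J.src (d 0))

theorem CoversFin.mono {qs qs' : List ℕ} {k : ℕ} (h : CoversFin J qs k)
    (hM : ∀ u, Marked J qs u → Marked J qs' u) : CoversFin J qs' k :=
  fun v hv hne => hM _ (h v hv hne)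

theorem CoversLeft.mono {qs qs' : List ℕ} {k : ℕ} (h : CoversLeft J qs k)
    (hM : ∀ u, Marked J qs u → Marked J qs' u) : CoversLeft J qs' k :=
  h.imp (hM _) id

theorem CoversRight.mono {qs qs' : List ℕ} {k : ℕ} (h : CoversRight J qs k)
    (hM : ∀ u, Marked J qs u → Marked J qs' u) : CoversRight J qs' k :=
  h.imp (hM _) id

/-- The conditions on the marked boundaries before the propagation. -/
structure CoversBase (J : EdgeData) (qs : List ℕ) : Prop where
  fin : CoversFin J qs J.N
  left : ∀ e < J.M, CoversLeft J qs e
  right : ∀ e < J.M, CoversRight J qs e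

theorem CoversBase.mono {qs qs' : List ℕ} (h : CoversBase J qs)
    (hM : ∀ u, Marked J qs u → Marked J qs' u) : CoversBase J qs' :=
  ⟨h.fin.mono hM, fun e he => (h.left e he).mono hM, fun e he => (h.right e he).mono hM⟩

/-- In the list sorted by label and then source, a label missing next to one of its sources shows up
as a gap between consecutive entries, or as the beginning or end of the list of that label. The
right side of the current label and source is settled only when a different pair follows, which is
why `MarkInv.right` leaves it open. -/
theorem markLabels_runs {s : Mem} (hJ : J.IsJoint) (hs : Holds J s) (hd : Sorted J (s.arr 12))
    (h42 : s.reg 42 = 1) {qs₀ : List ℕ} (hQ0 : Queued J s qs₀) (hS0 : Sound J qs₀)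
    (hF0 : CoversFin J qs₀ J.N) (hw : J.N + J.M + 3 ≤ 2 ^ w) :
    Runs w markLabels s (40 * (J.M + 1)) (fun s' => s'.reg 42 = 1 ∧
      ∃ qs, Queued J s' qs ∧ Sound J qs ∧ CoversBase J qs) := by
  set d := s.arr 12 with hdd
  by_cases hM : J.M = 0
  · refine ⟨s, 2, Exec.ite_false (by rw [hs.M, hM]) (.skip _), by omega, h42, qs₀, hQ0, hS0,
      hF0, ?_, ?_⟩ <;> omega
  have hd0 : d 0 < J.M := hd.listing.1 0 (by omega)
  have hsN := hJ.src_lt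
  have hpre : Runs w (block [const 20 0, load 21 12 20, load 23 0 21, load 24 8 21, push 23]) s
      12 (fun s' => s'.reg 23 = J.src (d 0) ∧ s'.reg 24 = J.lab (d 0) ∧ ∃ qs, Queued J s' qs ∧
        Sound J qs ∧ CoversFin J qs J.N ∧ Marked J qs (J.src (d 0))) := by
    refine (Runs.of_wp ?_).mono (by simp [block, cost, push]) fun _ h => h
    simp only [block, wp, Mem.setReg_reg, Mem.setReg_arr, if_true, if_false, Nat.reduceEqDiff,
      hs.src, hs.lab]
    refine ⟨by omega, ?_⟩
    refine wp_push (qs := qs₀) (by norm_num) (hQ0.congr (by simp [Mem.setReg_reg]) rfl rfl)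
      (by simp [Mem.setReg_reg, h42]) (by simp [Mem.setReg_reg, ← hdd]; exact (hsN _ hd0).le)
      (by omega) ?_
    intro s2 qs2 hQ2 hM2 _ hr ha
    simp only [Mem.setReg_reg, if_true, Nat.reduceEqDiff, if_false, ← hdd] at hM2 hr
    refine ⟨?_, ?_, qs2, hQ2, hS0.insert ?_ hM2, hF0.mono fun u hu => (hM2 u).2 (Or.inl hu),
      (hM2 _).2 (Or.inr rfl)⟩
    · rw [hr 23 (by norm_num) (by norm_num)]; simp
    · rw [hr 24 (by norm_num) (by norm_num)]; simp
    · refine EdgeData.Bd.left _ hd0 fun g hg hl hs => ?_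
      obtain ⟨j, hj, rfl⟩ := hd.listing.surj hg
      have := hd.le (Nat.zero_le j) hj
      omega
  have hM' : s.reg 4 ≠ 0 := by rw [hs.M]; exact hM
  suffices hmain : Runs w (block [const 20 0, load 21 12 20, load 23 0 21, load 24 8 21, push 23,
    forTo 4 (block [load 21 12 40, load 25 0 21, load 26 8 21, binop .add 27 23 42,
      binop .eq 22 24 26, binop .lt 28 27 25,
      ite 22 (ite 28 (block [push 27, push 25]) skip) (block [push 27, push 25]),
      load 23 0 21, load 24 8 21]),
    binop .add 27 23 42, push 27]) s (40 * J.M + 39) (fun s' => s'.reg 42 = 1 ∧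
      ∃ qs, Queued J s' qs ∧ Sound J qs ∧ CoversBase J qs) by
    obtain ⟨s', t, h1, h2, h3⟩ := hmain
    exact ⟨s', t + 1, Exec.ite_true hM' h1, by omega, h3⟩
  refine (Runs.block_append (l₂ := [_, _, _]) hpre.frame (T' := J.M * 29 + 4 + 9) ?_).mono
    (by omega) fun _ h => h
  rintro s1 ⟨⟨h23, h24, qs1, hQ1, hS1, hF1, hm1⟩, hf1⟩
  have hs1 : Holds J s1 := hs.frame hf1 (by simp [block, wregs, push])
    (by simp [block, warrs, push])
  have hd1 : s1.arr 12 = d := hf1.2 _ (by simp [block, warrs, push])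
  have hloop := Runs.forTo (w := w) (n := 4) (N := J.M) (s := s1)
    (c := block [load 21 12 40, load 25 0 21, load 26 8 21, binop .add 27 23 42,
      binop .eq 22 24 26, binop .lt 28 27 25,
      ite 22 (ite 28 (block [push 27, push 25]) skip) (block [push 27, push 25]),
      load 23 0 21, load 24 8 21])
    -- For `k = 0` the previous edge is `d 0` itself; it shows no gap, and nothing is marked.
    (fun k s' => s'.reg 23 = J.src (d (k - 1)) ∧ s'.reg 24 = J.lab (d (k - 1)) ∧
      ∃ qs, Queued J s' qs ∧ MarkInv J d k qs)
    (by omega) hs1.M (by omega) (by simp [block, wregs, push])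
    (by
      intro b
      refine ⟨by simpa [Mem.setReg_reg] using h23, by simpa [Mem.setReg_reg] using h24,
        qs1, hQ1.congr (by simp [Mem.setReg_reg]) rfl rfl, hS1, hF1, ?_, ?_, hm1⟩ <;> omega)
    (by
      rintro k s' hk ⟨g23, g24, qs, hQ, hI⟩ hf h40 h42
      have hs' : Holds J s' := hs1.frame hf (by simp [block, forTo, wregs, push])
        (by simp [block, forTo, warrs, push])
      have hd' : s'.arr 12 = d := (hf.2 _ (by simp [block, forTo, warrs, push])).trans hd1
      have hdk : d k < J.M := hd.listing.1 k hk
      have hdk1 : d (k - 1) < J.M := hd.listing.1 (k - 1) (by omega)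
      have hsk := hsN _ hdk
      have hsk1 := hsN _ hdk1
      have hpost : ∀ (s4 : Mem) (qs4 : List ℕ), s4.reg 21 = d k → s4.arr 0 = J.src →
          s4.arr 8 = J.lab → Queued J s4 qs4 → MarkInv J d (k + 1) qs4 →
          (block [load 23 0 21, load 24 8 21]).wp w (fun s'' => ∀ b,
            s''.reg 23 = J.src (d (k + 1 - 1)) ∧ s''.reg 24 = J.lab (d (k + 1 - 1)) ∧
              ∃ qs, Queued J ((s''.setReg 40 (k + 1)).setReg 41 b) qs ∧
                MarkInv J d (k + 1) qs) s4 := by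
        intro s4 qs4 r21 a0 a8 hQ4 hI4
        simp only [block, wp, Mem.setReg_reg, Mem.setReg_arr, if_true, if_false, Nat.reduceEqDiff,
          r21, a0, a8, Nat.add_sub_cancel, true_and]
        exact fun b => ⟨qs4, hQ4.congr (by simp [Mem.setReg_reg]) rfl rfl, hI4⟩
      have hmark : (J.lab (d (k - 1)) = J.lab (d k) → J.src (d (k - 1)) + 1 < J.src (d k)) →
          ∀ s2 : Mem, s2.reg 21 = d k → s2.reg 25 = J.src (d k) →
            s2.reg 27 = J.src (d (k - 1)) + 1 → s2.reg 42 = 1 → s2.reg 10 = s'.reg 10 →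
            s2.arr = s'.arr →
          (push 27).wp w (fun s' => (push 25).wp w (fun s' =>
            (block [load 23 0 21, load 24 8 21]).wp w (fun s'' => ∀ b,
            s''.reg 23 = J.src (d (k + 1 - 1)) ∧ s''.reg 24 = J.lab (d (k + 1 - 1)) ∧
              ∃ qs, Queued J ((s''.setReg 40 (k + 1)).setReg 41 b) qs ∧
                MarkInv J d (k + 1) qs) s') s') s2 := by
        intro hgap s2 k21 k25 k27 k42 k10 karr
        have hk0 : k ≠ 0 := by
          rintro rfl
          simp only [Nat.zero_sub] at hgap
          have := hgap trivial
          omega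
        obtain ⟨k, rfl⟩ : ∃ j, k = j + 1 := ⟨k - 1, by omega⟩
        rw [Nat.add_sub_cancel] at hgap k27 hsk1
        refine wp_push (by norm_num) (hQ.congr k10 (by rw [karr]) (by rw [karr])) k42
          (by rw [k27]; omega) (by omega) ?_
        intro s3 qs3 hQ3 hM3 _ hr3 ha3
        refine wp_push (by norm_num) hQ3 (by rw [hr3 42 (by norm_num) (by norm_num), k42])
          (by rw [hr3 25 (by norm_num) (by norm_num), k25]; omega) (by omega) ?_
        intro s4 qs4 hQ4 hM4 _ hr4 ha4
        rw [k27] at hM3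
        rw [hr3 25 (by norm_num) (by norm_num), k25] at hM4
        have a0 : s4.arr 0 = J.src := by
          rw [ha4 0 (by norm_num) (by norm_num), ha3 0 (by norm_num) (by norm_num), karr, hs'.src]
        have a8 : s4.arr 8 = J.lab := by
          rw [ha4 8 (by norm_num) (by norm_num), ha3 8 (by norm_num) (by norm_num), karr, hs'.lab]
        have r21 : s4.reg 21 = d (k + 1) := by
          rw [hr4 21 (by norm_num) (by norm_num), hr3 21 (by norm_num) (by norm_num), k21]
        have hMM : ∀ u, Marked J qs u → Marked J qs4 u := fun u hu =>
          (hM4 u).2 (Or.inl ((hM3 u).2 (Or.inl hu)))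
        refine hpost s4 qs4 r21 a0 a8 hQ4 ⟨?_, hI.fin.mono hMM, ?_, ?_, hMM _ hI.first⟩
        · exact (hI.sound.insert (right_of_gap hd hk hgap) hM3).insert (left_of_gap hd hk hgap) hM4
        · intro i hi
          rcases Nat.lt_or_ge i (k + 1) with h1 | h1
          · exact (hI.left i h1).mono hMM
          · obtain rfl : i = k + 1 := by omega
            exact Or.inl ((hM4 _).2 (Or.inr rfl))
        · intro i hi
          rcases Nat.lt_or_ge i (k + 1) with h1 | h1
          · rcases hI.right i h1 with h2 | ⟨h2, h3⟩
            · exact Or.inl (h2.mono hMM)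
            · refine Or.inl (Or.inl ?_)
              rw [Nat.add_sub_cancel] at h3
              rw [h3]
              exact (hM4 _).2 (Or.inl ((hM3 _).2 (Or.inr rfl)))
          · obtain rfl : i = k + 1 := by omega
            exact Or.inr ⟨rfl, rfl⟩
      rw [block, block, block, block, block, block, block, block, block, block]
      simp only [wp, BinOp.eval, Mem.setReg_reg, Mem.setReg_arr,
        if_true, if_false, Nat.reduceEqDiff, h40, h42, hs'.src, hs'.lab, hd', g23, g24]
      refine ⟨by omega, by split_ifs <;> omega, by split_ifs <;> omega,
        fun h1 => ⟨fun h2 => ?_, fun h2 => ?_⟩, fun h1 => ?_⟩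
      · refine hmark (fun _ => ?_) _ (by simp [Mem.setReg_reg]) (by simp [Mem.setReg_reg])
          (by simp [Mem.setReg_reg]) (by simp [Mem.setReg_reg, h42]) (by simp [Mem.setReg_reg]) rfl
        by_contra hcon; simp [hcon] at h2
      · have h1 : J.lab (d (k - 1)) = J.lab (d k) := by
          by_contra hcon; simp [hcon] at h1
        have h2 : J.src (d k) ≤ J.src (d (k - 1)) + 1 := by
          by_contra hcon
          have hcon := not_le.1 hcon
          simp [hcon] at h2
        refine hpost _ qs (by simp [Mem.setReg_reg]) hs'.src hs'.lab
          (hQ.congr (by simp [Mem.setReg_reg]) rfl rfl) ⟨hI.sound, hI.fin, ?_, ?_, hI.first⟩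
        · intro i hi
          rcases Nat.lt_or_ge i k with h3 | h3
          · exact hI.left i h3
          · obtain rfl : i = k := by omega
            rcases Nat.eq_zero_or_pos i with rfl | hi0
            · exact Or.inl hI.first
            -- Without a gap, the new source either directly follows the previous one, which then
            -- carries the label, or equals it and inherits its status.
            have h4 := hd.le (i := i - 1) (j := i) (by omega) hk
            rcases Nat.lt_or_ge (J.src (d (i - 1))) (J.src (d i)) with h5 | h5
            · exact Or.inr ⟨_, hdk1, h1, by omega⟩
            · have h6 : J.src (d (i - 1)) = J.src (d i) := by omega
              have h7 := hI.left (i - 1) (by omega)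
              rw [CoversLeft, h6, h1] at h7
              exact h7
        · intro i hi
          simp only [Nat.add_sub_cancel]
          rcases Nat.lt_or_ge i k with h3 | h3
          · rcases hI.right i h3 with h4 | ⟨h4, h5⟩
            · exact Or.inl h4
            · have h6 := hd.le (i := k - 1) (j := k) (by omega) hk
              rcases Nat.lt_or_ge (J.src (d (k - 1))) (J.src (d k)) with h7 | h7
              · exact Or.inl (Or.inr ⟨_, hdk, by omega, by omega⟩)
              · exact Or.inr ⟨by omega, by omega⟩
          · obtain rfl : i = k := by omega
            exact Or.inr ⟨rfl, rfl⟩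
      · refine hmark (fun h3 => ?_) _ (by simp [Mem.setReg_reg]) (by simp [Mem.setReg_reg])
          (by simp [Mem.setReg_reg]) (by simp [Mem.setReg_reg, h42]) (by simp [Mem.setReg_reg]) rfl
        simp [h3] at h1)
  refine Runs.block_cons (T' := 9) ((hloop.frame).mono (by simp only [block, cost, push]; norm_num)
    fun _ h => h) ?_
  rintro s2 ⟨⟨⟨g23, g24, qs, hQ, hI⟩, h42⟩, hf2⟩
  have hdM : d (J.M - 1) < J.M := hd.listing.1 _ (by omega)
  have hsM := hsN _ hdM
  refine (Runs.of_wp ?_).mono (by simp only [block, cost, push]; norm_num) fun _ h => h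
  simp only [block, wp, BinOp.eval, g23, h42]
  refine ⟨by omega, ?_⟩
  refine wp_push (by norm_num) (hQ.congr (by simp [Mem.setReg_reg]) rfl rfl)
    (by simp [Mem.setReg_reg, h42]) (by simp [Mem.setReg_reg]; omega) (by omega) ?_
  intro s4 qs4 hQ4 hM4 _ hr4 ha4
  simp only [Mem.setReg_reg, if_true] at hM4 hr4
  have hMM : ∀ u, Marked J qs u → Marked J qs4 u := fun u hu => (hM4 u).2 (Or.inl hu)
  refine ⟨by rw [hr4 42 (by norm_num) (by norm_num)]; simpa using h42, qs4, hQ4,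
    hI.sound.insert ?_ hM4, hI.fin.mono hMM, ?_, ?_⟩
  -- The last edge has the largest source for its label, so the label is missing at the next state.
  · refine EdgeData.Bd.right _ hdM fun g hg hl hs => ?_
    obtain ⟨j, hj, rfl⟩ := hd.listing.surj hg
    have := hd.le (i := j) (j := J.M - 1) (by omega) (by omega)
    omega
  · intro e he
    obtain ⟨j, hj, rfl⟩ := hd.listing.surj he
    exact (hI.left j hj).mono hMM
  · intro e he
    obtain ⟨j, hj, rfl⟩ := hd.listing.surj he
    rcases hI.right j hj with h1 | ⟨h1, h2⟩
    · exact h1.mono hMM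
    · refine Or.inl ?_
      rw [h2]
      exact (hM4 _).2 (Or.inr rfl)

end Cmd
end WheelerBisim


/-! ### Propagation of boundaries along the edges -/

namespace WheelerBisim

namespace Cmd

variable {w : ℕ} {J : EdgeData}

/-- Array `16` contains the first edge into every state, array `17` the last one, increased by
`1`. -/
structure Linked (J : EdgeData) (s : Mem) : Prop where
  first_zero : ∀ v, s.arr 16 v = 0 → ∀ e < J.M, J.dst e ≠ v
  last_zero : ∀ v, s.arr 17 v = 0 → ∀ e < J.M, J.dst e ≠ v
  first : ∀ v f, s.arr 16 v = f + 1 → J.IsFirst f v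
  last : ∀ v f, s.arr 17 v = f + 1 → J.IsLast f v

/-- Find the first and the last edge into every state. -/
def link : Cmd :=
  forTo 4 (block [load 21 12 40, load 20 1 21, binop .add 22 21 42, store 17 20 22, load 23 16 20,
    ite 23 skip (store 16 20 22)])

/-- Along the sorted list, array `17` is overwritten by every edge into a state and array `16` only
when it is still zero. Zero means that there is no edge, hence the increase by `1`. -/
theorem link_runs {s : Mem} (hs : Holds J s) (hd : Sorted J (s.arr 12))
    (h16 : ∀ v, s.arr 16 v = 0) (h17 : ∀ v, s.arr 17 v = 0) (hw : J.M + 3 ≤ 2 ^ w) :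
    Runs w link s (11 * J.M + 4) (fun s' => Linked J s' ∧ s'.reg 42 = 1) := by
  set d := s.arr 12 with hdd
  refine ((Runs.forTo (w := w) (n := 4) (N := J.M) (s := s)
    (fun k s' => (∀ v, s'.arr 16 v = 0 → ∀ i < k, J.dst (d i) ≠ v) ∧
      (∀ v, s'.arr 17 v = 0 → ∀ i < k, J.dst (d i) ≠ v) ∧
      (∀ v f, s'.arr 16 v = f + 1 → ∃ i < k, d i = f ∧ J.dst f = v ∧ ∀ j < i, J.dst (d j) ≠ v) ∧
      ∀ v f, s'.arr 17 v = f + 1 →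
        ∃ i < k, d i = f ∧ J.dst f = v ∧ ∀ j, i < j → j < k → J.dst (d j) ≠ v)
    (by omega) hs.M (by omega) (by simp [block, wregs])
    (by simp [Mem.setReg_arr, h16, h17])
    (by
      rintro k s' hk ⟨i1, i2, i3, i4⟩ hf h40 h42
      have hs' : Holds J s' := hs.frame hf (by simp [block, forTo, wregs])
        (by simp [block, forTo, warrs])
      have hd' : s'.arr 12 = d := (hf.2 _ (by simp [block, forTo, warrs])).trans hdd.symm
      have hdk : d k < J.M := hd.listing.1 k hk
      simp only [block, wp, BinOp.eval, Mem.setReg_reg, Mem.setReg_arr, Mem.setArr_arr,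
        Mem.setArr_reg, if_true, if_false, Nat.reduceEqDiff, h40, h42, hs'.dst, hd']
      refine ⟨by omega, fun h1 _ => ⟨?_, ?_, ?_, ?_⟩, fun h1 _ => ⟨?_, ?_, ?_, ?_⟩⟩
      · intro v hv i hi
        rcases Nat.lt_or_ge i k with h2 | h2
        · exact i1 v hv i h2
        · obtain rfl : i = k := by omega
          rintro rfl; exact h1 hv
      · intro v hv i hi
        rw [Function.update_apply] at hv
        split_ifs at hv with h2
        · rcases Nat.lt_or_ge i k with h3 | h3
          · exact i2 v hv i h3
          · obtain rfl : i = k := by omega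
            exact Ne.symm h2
      · intro v f hv
        obtain ⟨i, hi, h3⟩ := i3 v f hv
        exact ⟨i, by omega, h3⟩
      · intro v f hv
        rw [Function.update_apply] at hv
        split_ifs at hv with h2
        · exact ⟨k, by omega, by omega, by rw [h2, Nat.add_right_cancel hv], fun j _ _ => by omega⟩
        · obtain ⟨i, hi, h3, h4, h5⟩ := i4 v f hv
          refine ⟨i, by omega, h3, h4, fun j hj hj' => ?_⟩
          rcases Nat.lt_or_ge j k with h6 | h6
          · exact h5 j hj h6
          · obtain rfl : j = k := by omega
            exact Ne.symm h2
      · intro v hv i hi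
        rw [Function.update_apply] at hv
        split_ifs at hv with h2
        · rcases Nat.lt_or_ge i k with h3 | h3
          · exact i1 v hv i h3
          · obtain rfl : i = k := by omega
            exact Ne.symm h2
      · intro v hv i hi
        rw [Function.update_apply] at hv
        split_ifs at hv with h2
        · rcases Nat.lt_or_ge i k with h3 | h3
          · exact i2 v hv i h3
          · obtain rfl : i = k := by omega
            exact Ne.symm h2
      · intro v f hv
        rw [Function.update_apply] at hv
        split_ifs at hv with h2
        · subst h2
          exact ⟨k, by omega, by omega, by rw [Nat.add_right_cancel hv], i1 _ h1⟩
        · obtain ⟨i, hi, h3⟩ := i3 v f hv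
          exact ⟨i, by omega, h3⟩
      · intro v f hv
        rw [Function.update_apply] at hv
        split_ifs at hv with h2
        · exact ⟨k, by omega, by omega, by rw [h2, Nat.add_right_cancel hv], fun j _ _ => by omega⟩
        · obtain ⟨i, hi, h3, h4, h5⟩ := i4 v f hv
          refine ⟨i, by omega, h3, h4, fun j hj hj' => ?_⟩
          rcases Nat.lt_or_ge j k with h6 | h6
          · exact h5 j hj h6
          · obtain rfl : j = k := by omega
            exact Ne.symm h2)).mono (by simp [block, cost]; omega) ?_)
  rintro s' ⟨⟨i1, i2, i3, i4⟩, h42⟩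
  refine ⟨⟨fun v hv e he => ?_, fun v hv e he => ?_, fun v f hv => ?_, fun v f hv => ?_⟩, h42⟩
  · obtain ⟨i, hi, rfl⟩ := hd.listing.surj he
    exact i1 v hv i hi
  · obtain ⟨i, hi, rfl⟩ := hd.listing.surj he
    exact i2 v hv i hi
  · obtain ⟨i, hi, rfl, h2, h3⟩ := i3 v f hv
    refine ⟨hd.listing.1 i hi, h2, fun g hg hgv => ?_⟩
    obtain ⟨j, hj, rfl⟩ := hd.listing.surj hg
    exact hd.le (by by_contra hcon; exact h3 j (by omega) hgv) hj
  · obtain ⟨i, hi, rfl, h2, h3⟩ := i4 v f hv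
    refine ⟨hd.listing.1 i hi, h2, fun g hg hgv => ?_⟩
    obtain ⟨j, hj, rfl⟩ := hd.listing.surj hg
    exact hd.le (by by_contra hcon; exact h3 j (by omega) hj hgv) hi

/-- The boundaries implied by the boundary `v` are marked. -/
def Processed (J : EdgeData) (qs : List ℕ) (v : ℕ) : Prop :=
  ∀ u e f, v = u + 1 → J.IsLast e u → J.IsFirst f v → J.lab e = J.lab f →
    Marked J qs (J.src f) ∧ Marked J qs (J.src e + 1)

theorem Processed.mono {qs qs' : List ℕ} {v : ℕ} (h : Processed J qs v)
    (hM : ∀ u, Marked J qs u → Marked J qs' u) : Processed J qs' v :=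
  fun u e f h1 h2 h3 h4 => (h u e f h1 h2 h3 h4).imp (hM _) (hM _)

/-- Mark all boundaries implied by those in the queue. -/
def propagate : Cmd :=
  block [const 11 0, binop .lt 43 11 10,
    loop 43 (block [load 29 15 11, binop .add 11 11 42, binop .sub 30 29 42, load 31 17 30,
      load 32 16 29,
      ite 31 (ite 32 (block [binop .sub 31 31 42, binop .sub 32 32 42, load 33 8 31, load 34 8 32,
        binop .eq 35 33 34,
        ite 35 (block [load 36 0 32, push 36, load 36 0 31, binop .add 36 36 42, push 36]) skip])
        skip) skip,
      binop .lt 43 11 10])]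

/-- The state of the loop in `propagate` when `k` entries of the queue have been processed. -/
structure PropagateInv (J : EdgeData) (s : Mem) (k : ℕ) (qs : List ℕ) : Prop where
  queued : Queued J s qs
  sound : Sound J qs
  base : CoversBase J qs
  le : k ≤ qs.length
  processed : ∀ i (h : i < qs.length), i < k → Processed J qs qs[i]

/-- Completeness is an induction on the derivation of a boundary. The propagation rules start only
from boundaries other than `0`, `J.n` and `J.N`, and all marked ones of this kind are in the queue
and processed. -/
theorem marked_iff_bd {qs : List ℕ} (hS : Sound J qs) (hB : CoversBase J qs)
    (hP : ∀ v ∈ qs, Processed J qs v) (v : ℕ) : Marked J qs v ↔ J.Bd v := by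
  refine ⟨hS v, fun h => ?_⟩
  induction h with
  | zero => exact Or.inl rfl
  | mid => exact Or.inr (Or.inl rfl)
  | top => exact Or.inr (Or.inr (Or.inl rfl))
  | fin v hv hne => exact hB.fin v hv hne
  | left e he hg =>
    rcases hB.left e he with h1 | ⟨g, h1, h2, h3⟩
    · exact h1
    · exact absurd h3 (hg g h1 h2)
  | right e he hg =>
    rcases hB.right e he with h1 | ⟨g, h1, h2, h3⟩
    · exact h1
    · exact absurd h3 (hg g h1 h2)
  | step_first v e f _ hvN hvn he hf hl ih =>
    have : v + 1 ∈ qs := by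
      rcases ih with h1 | h1 | h1 | h1
      · omega
      · omega
      · omega
      · exact h1
    exact (hP _ this v e f rfl he hf hl).1
  | step_last v e f _ hvN hvn he hf hl ih =>
    have : v + 1 ∈ qs := by
      rcases ih with h1 | h1 | h1 | h1
      · omega
      · omega
      · omega
      · exact h1
    exact (hP _ this v e f rfl he hf hl).2

/-- The queue grows while it is read. Since pushes only append, the processed entries remain a
prefix; since it never exceeds `J.N` entries, the distance of the reading position from `J.N` is a
decreasing measure. -/
theorem propagate_runs {s : Mem} (hJ : J.IsJoint) (hs : Holds J s) (hL : Linked J s)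
    (h42 : s.reg 42 = 1) {qs : List ℕ} (hQ : Queued J s qs) (hS : Sound J qs)
    (hB : CoversBase J qs) (hw : J.N + J.M + 3 ≤ 2 ^ w) :
    Runs w propagate s (50 * (J.N + 1)) (fun s' =>
      (∀ v, J.Bd v → s'.arr 14 v = 1) ∧ ∀ v, ¬ J.Bd v → s'.arr 14 v = 0) := by
  have hpre : Runs w (block [const 11 0, binop .lt 43 11 10]) s 3 (fun s' => s'.reg 11 = 0 ∧
      s'.reg 42 = 1 ∧ (s'.reg 43 = if 0 < qs.length then 1 else 0) ∧ Queued J s' qs) := by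
    refine Runs.of_wp ?_
    simp only [block, wp, BinOp.eval, Mem.setReg_reg, if_true, if_false, Nat.reduceEqDiff,
      hQ.length]
    exact ⟨by omega, by split_ifs <;> omega, trivial, h42, trivial,
      hQ.congr (by simp [Mem.setReg_reg]) rfl rfl⟩
  refine (Runs.block_append (l₂ := [_]) hpre.frame (T' := J.N * 44 + 2) ?_).mono
    (by omega) fun _ h => h
  rintro s1 ⟨⟨h11, h42, h43, hQ1⟩, hf1⟩
  have hs1 : Holds J s1 := hs.frame hf1 (by simp [block, wregs])
    (by simp [block, warrs])
  have hL1 : Linked J s1 := by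
    have a16 : s1.arr 16 = s.arr 16 := hf1.2 _ (by simp [block, warrs])
    have a17 : s1.arr 17 = s.arr 17 := hf1.2 _ (by simp [block, warrs])
    exact ⟨a16 ▸ hL.1, a17 ▸ hL.2, a16 ▸ hL.3, a17 ▸ hL.4⟩
  have hloop := Runs.loop (w := w) (s := s1) (x := 43)
    (c := block [load 29 15 11, binop .add 11 11 42, binop .sub 30 29 42, load 31 17 30,
      load 32 16 29,
      ite 31 (ite 32 (block [binop .sub 31 31 42, binop .sub 32 32 42, load 33 8 31, load 34 8 32,
        binop .eq 35 33 34,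
        ite 35 (block [load 36 0 32, push 36, load 36 0 31, binop .add 36 36 42, push 36]) skip])
        skip) skip,
      binop .lt 43 11 10])
    (fun s' => s'.reg 42 = 1 ∧ ∃ qs, (s'.reg 43 = if s'.reg 11 < qs.length then 1 else 0) ∧
      PropagateInv J s' (s'.reg 11) qs) (fun s' => J.N - s'.reg 11)
    ⟨h42, qs, by rw [h43, h11], hQ1, hS, hB, by omega, by omega⟩ (by
      rintro s' ⟨h42, qs, h43, hI⟩ hf h0
      have hs' : Holds J s' := hs1.frame hf (by simp [block, wregs, push])
        (by simp [block, warrs, push])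
      have hlt : s'.reg 11 < qs.length := by
        by_contra hcon; simp [h43, hcon] at h0
      have a16 : s'.arr 16 = s1.arr 16 := hf.2 _ (by simp [block, warrs, push])
      have a17 : s'.arr 17 = s1.arr 17 := hf.2 _ (by simp [block, warrs, push])
      have hlen := hI.queued.length_le
      set k := s'.reg 11 with hk
      have hget : s'.arr 15 k = qs[k] := hI.queued.get k hlt
      have hmem := hI.queued.mem _ (List.getElem_mem hlt)
      obtain ⟨u, hu⟩ : ∃ u, qs[k] = u + 1 := ⟨qs[k] - 1, by omega⟩
      have hend : ∀ (s2 : Mem) (qs2 : List ℕ), s2.reg 42 = 1 → s2.reg 11 = k + 1 →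
          Queued J s2 qs2 → Sound J qs2 → (∀ v, Marked J qs v → Marked J qs2 v) →
          qs <+: qs2 → Processed J qs2 (u + 1) →
          (block [binop .lt 43 11 10]).wp w (fun s'' => (s''.reg 42 = 1 ∧ ∃ qs,
            (s''.reg 43 = if s''.reg 11 < qs.length then 1 else 0) ∧
              PropagateInv J s'' (s''.reg 11) qs) ∧ J.N - s''.reg 11 < J.N - k) s2 := by
        intro s2 qs2 r42 r11 hQ2 hS2 hM hpre hP
        have hlen2 := hpre.length_le
        simp only [block, wp, BinOp.eval, Mem.setReg_reg, if_true, if_false, Nat.reduceEqDiff,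
          r42, r11, hQ2.length]
        refine ⟨by split_ifs <;> omega, ⟨trivial, qs2, rfl,
          hQ2.congr (by simp [Mem.setReg_reg]) rfl rfl, hS2, hI.base.mono hM, by omega, ?_⟩,
          by omega⟩
        intro i hi hik
        rcases Nat.lt_or_ge i k with h1 | h1
        · have h2 : qs2[i] = qs[i]'(by omega) := (hpre.getElem (by omega)).symm
          rw [h2]
          exact (hI.processed i (by omega) h1).mono hM
        · obtain rfl : i = k := by omega
          have h2 : qs2[k] = qs[k] := (hpre.getElem hlt).symm
          rw [h2, hu]
          exact hP
      rw [block, block, block, block, block, block]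
      simp only [wp, BinOp.eval, Mem.setReg_reg, Mem.setReg_arr, if_true, if_false,
        Nat.reduceEqDiff, h42, ← hk, hget, hu, a16, a17, Nat.add_sub_cancel]
      refine ⟨by omega, by omega, fun h31 => ⟨fun h32 => ?_, fun h32 => ?_⟩, fun h31 => ?_⟩
      · obtain ⟨e, he⟩ := Nat.exists_eq_succ_of_ne_zero h31
        obtain ⟨f, hf⟩ := Nat.exists_eq_succ_of_ne_zero h32
        have hLe := hL1.last _ _ he
        have hLf := hL1.first _ _ hf
        have hse := hJ.src_lt e hLe.1
        have hsf := hJ.src_lt f hLf.1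
        have heM := hLe.1
        have hfM := hLf.1
        -- Ties in the order by label, then source, agree in both, so the implied boundaries do not
        -- depend on which first and last edges are stored.
        have huniq : ∀ e' f', J.IsLast e' u → J.IsFirst f' (u + 1) →
            (J.lab e' = J.lab e ∧ J.src e' = J.src e) ∧ J.lab f' = J.lab f ∧ J.src f' = J.src f := by
          intro e' f' he' hf'
          have := he'.2.2 e hLe.1 hLe.2.1
          have := hLe.2.2 e' he'.1 he'.2.1
          have := hf'.2.2 f hLf.1 hLf.2.1
          have := hLf.2.2 f' hf'.1 hf'.2.1
          omega
        rw [block, block, block, block, block, block]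
        simp only [wp, BinOp.eval, Mem.setReg_reg, Mem.setReg_arr, if_true, if_false,
          Nat.reduceEqDiff, h42, he, hf, Nat.succ_eq_add_one, Nat.add_sub_cancel, hs'.lab]
        refine ⟨by omega, by omega, by split_ifs <;> omega, fun h35 => ?_, fun h35 => ?_⟩
        · have hl : J.lab e = J.lab f := by
            by_contra hcon; simp [hcon] at h35
          rw [block, block, block, block, block]
          simp only [wp, BinOp.eval, Mem.setReg_reg, Mem.setReg_arr, if_true, if_false,
            Nat.reduceEqDiff, hs'.src]
          refine wp_push (qs := qs) (by norm_num)
            (hI.queued.congr (by simp [Mem.setReg_reg]) rfl rfl)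
            (by simp [Mem.setReg_reg, h42]) (by simp [Mem.setReg_reg]; omega) (by omega) ?_
          intro s3 qs3 hQ3 hM3 hp3 hr3 ha3
          simp only [Mem.setReg_reg, Mem.setReg_arr, if_true] at hM3 hr3 ha3
          have q0 : s3.arr 0 = J.src := (ha3 0 (by norm_num) (by norm_num)).trans hs'.src
          have q31 : s3.reg 31 = e := by rw [hr3 31 (by norm_num) (by norm_num)]; simp
          have q42 : s3.reg 42 = 1 := by rw [hr3 42 (by norm_num) (by norm_num)]; simpa using h42
          have q11 : s3.reg 11 = k + 1 := by rw [hr3 11 (by norm_num) (by norm_num)]; simp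
          simp only [q0, q31, q42]
          refine ⟨by omega, ?_⟩
          refine wp_push (qs := qs3) (by norm_num) (hQ3.congr (by simp [Mem.setReg_reg]) rfl rfl)
            (by simp [Mem.setReg_reg, q42]) (by simp [Mem.setReg_reg]; omega) (by omega) ?_
          intro s4 qs4 hQ4 hM4 hp4 hr4 ha4
          simp only [Mem.setReg_reg, if_true] at hM4 hr4
          have hBd : J.Bd (u + 1) := by
            rw [← hu]; exact hI.sound _ (Or.inr (Or.inr (Or.inr (List.getElem_mem hlt))))
          refine hend s4 qs4 (by rw [hr4 42 (by norm_num) (by norm_num)]; simpa using q42)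
            (by rw [hr4 11 (by norm_num) (by norm_num)]; simpa using q11) hQ4 ?_
            (fun v hv => (hM4 v).2 (Or.inl ((hM3 v).2 (Or.inl hv)))) (hp3.trans hp4) ?_
          · exact (hI.sound.insert (.step_first u e f hBd (by omega) (by omega) hLe hLf hl) hM3).insert
              (.step_last u e f hBd (by omega) (by omega) hLe hLf hl) hM4
          · rintro u' e' f' hu' he' hf' -
            obtain rfl : u = u' := by omega
            obtain ⟨⟨-, h1⟩, -, h2⟩ := huniq e' f' he' hf'
            rw [h1, h2]
            exact ⟨(hM4 _).2 (Or.inl ((hM3 _).2 (Or.inr rfl))), (hM4 _).2 (Or.inr rfl)⟩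
        · have hl : J.lab e ≠ J.lab f := by
            intro hcon; simp [hcon] at h35
          refine hend _ qs (by simp [Mem.setReg_reg, h42]) (by simp [Mem.setReg_reg])
            (hI.queued.congr (by simp [Mem.setReg_reg]) rfl rfl) hI.sound (fun _ h => h)
            (List.prefix_refl _) ?_
          intro u' e' f' hu' he' hf' hl'
          obtain rfl : u = u' := by omega
          have := huniq e' f' he' hf'
          omega
      · refine hend _ qs (by simp [Mem.setReg_reg, h42]) (by simp [Mem.setReg_reg])
          (hI.queued.congr (by simp [Mem.setReg_reg]) rfl rfl) hI.sound (fun _ h => h)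
          (List.prefix_refl _) ?_
        intro u' e' f' hu' he' hf' hl'
        exact absurd hf'.2.1 (hL1.first_zero _ h32 _ hf'.1)
      · refine hend _ qs (by simp [Mem.setReg_reg, h42]) (by simp [Mem.setReg_reg])
          (hI.queued.congr (by simp [Mem.setReg_reg]) rfl rfl) hI.sound (fun _ h => h)
          (List.prefix_refl _) ?_
        intro u' e' f' hu' he' hf' hl'
        obtain rfl : u = u' := by omega
        exact absurd he'.2.1 (hL1.last_zero _ h31 _ he'.1))
  refine Runs.block_singleton (hloop.mono (T' := J.N * 44 + 1) ?_ ?_)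
  · rw [h11, Nat.sub_zero]; simp only [block, cost, push]; norm_num; omega
  · rintro s2 ⟨⟨-, qs2, h43, hI⟩, hz⟩
    have hall : qs2.length ≤ s2.reg 11 := by
      by_contra hcon
      rw [if_pos (by omega)] at h43
      omega
    have hiff := marked_iff_bd hI.sound hI.base (fun v hv => by
      obtain ⟨i, hi, rfl⟩ := List.getElem_of_mem hv
      exact hI.processed i hi (by omega))
    refine ⟨fun v hv => ?_, fun v hv => ?_⟩
    · rw [hI.queued.mark, if_pos ((hiff v).2 hv)]
    · rw [hI.queued.mark, if_neg fun h => hv ((hiff v).1 h)]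

end Cmd
end WheelerBisim


/-! ### Comparison of the two quotients -/

namespace WheelerBisim

namespace EdgeData

variable {J : EdgeData} {c : ℕ → ℕ}

/-- The quotients of the two automata have the same edges. -/
def EdgesAgree (J : EdgeData) (c : ℕ → ℕ) : Prop :=
  (∀ e < J.m, ∃ f, J.m ≤ f ∧ f < J.M ∧ J.SameEdge c e f) ∧
    ∀ f, J.m ≤ f → f < J.M → ∃ e < J.m, J.SameEdge c e f

theorem SameEdge.symm {e f : ℕ} (h : J.SameEdge c e f) : J.SameEdge c f e :=
  ⟨h.1.symm, h.2.1.symm, h.2.2.symm⟩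

theorem SameEdge.trans {e f g : ℕ} (h : J.SameEdge c e f) (h' : J.SameEdge c f g) :
    J.SameEdge c e g :=
  ⟨h.1.trans h'.1, h.2.1.trans h'.2.1, h.2.2.trans h'.2.2⟩

/-- Initial states have class `1` on both sides, and every other state is the target of an edge,
whose class reappears in the first automaton. The test of final states needs this in order to read
only entries that were written. -/
theorem EdgesAgree.exists_class (h : J.IsJoint) (hc : J.IsClassMap c) (hE : J.EdgesAgree c)
    {v : ℕ} (hn : J.n ≤ v) (hN : v < J.N) : ∃ u < J.n, c u = c v := by
  by_cases h1 : v = J.n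
  · exact ⟨0, h.n_pos, by rw [hc.zero, h1, hc.mid]⟩
  · obtain ⟨f, hf, rfl⟩ := h.incoming hN (by have := h.n_pos; omega) h1
    have h2 := h.dst_half f hf
    obtain ⟨e, he, -, -, h3⟩ := hE.2 f (by omega) hf
    have hm := h.m_le
    exact ⟨J.dst e, (h.dst_half e (by omega)).2 he, h3⟩

/-- In a list sorted by classes of targets, classes of sources, labels, sources, equal edges of the
quotients are adjacent, those of the first automaton coming first. -/
theorem edgesAgree_iff (h : J.IsJoint) {d csrc cdst : ℕ → ℕ} (hd : IsListing J.M d)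
    (hsrc : ∀ e < J.M, csrc e = c (J.src e)) (hdst : ∀ e < J.M, cdst e = c (J.dst e))
    (hl : ListedBy J.M d (ByKey cdst (ByKey csrc (ByKey J.lab (ByKey J.src fun _ _ => True)))))
    (hM : 0 < J.M) :
    J.EdgesAgree c ↔ (d 0 < J.m ∧ ∀ i, i + 1 < J.M → J.SameEdge c (d i) (d (i + 1)) ∨
      J.m ≤ d i ∧ d (i + 1) < J.m) ∧ J.m ≤ d (J.M - 1) := by
  have hle : ∀ i j, i < j → j < J.M →
      c (J.dst (d i)) < c (J.dst (d j)) ∨ c (J.dst (d i)) = c (J.dst (d j)) ∧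
      (c (J.src (d i)) < c (J.src (d j)) ∨ c (J.src (d i)) = c (J.src (d j)) ∧
      (J.lab (d i) < J.lab (d j) ∨ J.lab (d i) = J.lab (d j) ∧ J.src (d i) ≤ J.src (d j))) := by
    intro i j hij hj
    have h1 := hl i j hij hj
    simp only [ByKey, hsrc _ (hd.1 i (by omega)), hsrc _ (hd.1 j hj), hdst _ (hd.1 i (by omega)),
      hdst _ (hd.1 j hj)] at h1
    omega
  -- Inside a block of equal quotient edges the list is ordered by source, and sources of the first
  -- automaton are the smaller numbers.
  have hside : ∀ i j, i < j → j < J.M → J.SameEdge c (d i) (d j) → d j < J.m → d i < J.m := by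
    intro i j hij hj ⟨s1, s2, s3⟩ h1
    have h2 := hle i j hij hj
    have h3 := h.src_half _ (hd.1 i (by omega))
    have h4 := h.src_half _ (hd.1 j hj)
    omega
  constructor
  · rintro ⟨h1, h2⟩
    refine ⟨⟨?_, fun i hi => ?_⟩, ?_⟩
    · by_contra hcon
      obtain ⟨e, he, hs⟩ := h2 (d 0) (by omega) (hd.1 0 hM)
      obtain ⟨j, hj, rfl⟩ := hd.surj (e := e) (by have := h.m_le; omega)
      rcases Nat.eq_zero_or_pos j with rfl | hj0
      · omega
      · exact hcon (hside 0 j hj0 hj hs.symm he)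
    -- At a change of blocks, suppose that the old block ends in the first automaton or the new one
    -- begins in the second. The partner of that edge in the other automaton would then have to lie
    -- across the change, and monotonicity would put both neighbours into one block.
    · by_contra! hcon
      obtain ⟨hns, hcon⟩ := hcon
      rcases Nat.lt_or_ge (d i) J.m with h3 | h3
      · obtain ⟨f, f1, f2, hs⟩ := h1 (d i) h3
        obtain ⟨j, hj, rfl⟩ := hd.surj f2
        rcases lt_trichotomy j i with h4 | rfl | h4
        · have := hside j i h4 (by omega) hs.symm h3
          omega
        · omega
        · rcases Nat.lt_or_ge (i + 1) j with h5 | h5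
          · have h6 := hle i (i + 1) (by omega) hi
            have h7 := hle (i + 1) j h5 hj
            obtain ⟨s1, s2, s3⟩ := hs
            exact hns ⟨by omega, by omega, by omega⟩
          · obtain rfl : j = i + 1 := by omega
            exact hns hs
      · obtain ⟨e, he, hs⟩ := h2 (d (i + 1)) (hcon h3) (hd.1 _ hi)
        obtain ⟨j, hj, rfl⟩ := hd.surj (e := e) (by have := h.m_le; omega)
        have h8 := hcon h3
        rcases lt_trichotomy j (i + 1) with h4 | rfl | h4
        · rcases Nat.lt_or_ge j i with h5 | h5
          · have h6 := hle j i h5 (by omega)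
            have h7 := hle i (i + 1) (by omega) hi
            obtain ⟨s1, s2, s3⟩ := hs
            exact hns ⟨by omega, by omega, by omega⟩
          · obtain rfl : j = i := by omega
            exact hns hs
        · omega
        · have := hside (i + 1) j h4 hj hs.symm he
          omega
    · by_contra hcon
      obtain ⟨f, f1, f2, hs⟩ := h1 (d (J.M - 1)) (by omega)
      obtain ⟨j, hj, rfl⟩ := hd.surj f2
      rcases Nat.lt_or_ge j (J.M - 1) with h3 | h3
      · have := hside j (J.M - 1) h3 (by omega) hs.symm (by omega)
        omega
      · obtain rfl : j = J.M - 1 := by omega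
        omega
  · rintro ⟨⟨h1, h2⟩, h3⟩
    -- Walking right to the end of the block finds an edge of the second automaton; walking left to
    -- its beginning finds one of the first.
    have hup : ∀ k i, i + k = J.M - 1 → ∃ f, J.m ≤ f ∧ f < J.M ∧ J.SameEdge c (d i) f := by
      intro k
      induction k with
      | zero =>
        intro i hi
        obtain rfl : i = J.M - 1 := by omega
        exact ⟨_, h3, hd.1 _ (by omega), rfl, rfl, rfl⟩
      | succ k ih =>
        intro i hi
        rcases h2 i (by omega) with h4 | h4
        · obtain ⟨f, f1, f2, f3⟩ := ih (i + 1) (by omega)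
          exact ⟨f, f1, f2, h4.trans f3⟩
        · exact ⟨_, h4.1, hd.1 _ (by omega), rfl, rfl, rfl⟩
    have hdown : ∀ i, i < J.M → ∃ e < J.m, J.SameEdge c e (d i) := by
      intro i
      induction i with
      | zero => exact fun _ => ⟨_, h1, rfl, rfl, rfl⟩
      | succ i ih =>
        intro hi
        rcases h2 i hi with h4 | h4
        · obtain ⟨e, e1, e2⟩ := ih (by omega)
          exact ⟨e, e1, e2.trans h4⟩
        · exact ⟨_, h4.2, rfl, rfl, rfl⟩
    constructor
    · intro e he
      obtain ⟨i, hi, rfl⟩ := hd.surj (e := e) (by have := h.m_le; omega)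
      exact hup (J.M - 1 - i) i (by omega)
    · intro f _ hf
      obtain ⟨i, hi, rfl⟩ := hd.surj hf
      exact hdown i hi

end EdgeData

namespace Cmd

variable {w : ℕ} {J : EdgeData}

/-- Number the classes. -/
def numberClasses : Cmd :=
  block [const 12 0, forTo 5 (block [load 20 14 40, binop .eq 21 40 0,
    ite 21 (const 12 0) skip, binop .add 12 12 20, store 18 40 12])]

/-- The class numbers are running sums of the boundary marks. -/
theorem numberClasses_runs {s : Mem} (hJ : J.IsJoint) (hs : Holds J s)
    (h1 : ∀ v, J.Bd v → s.arr 14 v = 1) (h0 : ∀ v, ¬ J.Bd v → s.arr 14 v = 0)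
    (hw : J.N + 3 ≤ 2 ^ w) :
    Runs w numberClasses s (11 * J.N + 6) (fun s' =>
      J.IsClassMap (s'.arr 18) ∧ ∀ v < J.N, s'.arr 18 v ≤ J.N) := by
  have hpre : Runs w (const 12 0) s 1 (fun s' => s'.reg 12 = 0) := by
    refine Runs.of_wp ?_
    simp only [wp, Mem.setReg_reg, if_true]
    exact ⟨by omega, trivial⟩
  refine (Runs.block_cons hpre.frame (T' := 11 * J.N + 5) ?_).mono (by omega) fun _ h => h
  rintro s1 ⟨h12, hf1⟩
  have hs1 : Holds J s1 := hs.frame hf1 (by simp [wregs]) (by simp [warrs])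
  have a14 : s1.arr 14 = s.arr 14 := hf1.2 _ (by simp [warrs])
  have hloop := Runs.forTo (w := w) (n := 5) (N := J.N) (s := s1)
    (c := block [load 20 14 40, binop .eq 21 40 0,
      ite 21 (const 12 0) skip, binop .add 12 12 20, store 18 40 12])
    (fun k s' => (s'.reg 12 = if k = 0 then 0 else s'.arr 18 (k - 1)) ∧
      (∀ v < k, (v = 0 ∨ v = J.n → s'.arr 18 v = 1) ∧ s'.arr 18 v ≤ v + 1) ∧
      ∀ v, v + 1 < k → v + 1 ≠ J.n → s'.arr 18 (v + 1) = s'.arr 18 v + s.arr 14 (v + 1))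
    (by omega) hs1.N (by omega) (by simp [block, wregs])
    (by simp [Mem.setReg_reg, h12])
    (by
      rintro k s' hk ⟨i1, i2, i3⟩ hf h40 h42
      have hs' : Holds J s' := hs1.frame hf (by simp [block, forTo, wregs])
        (by simp [block, forTo, warrs])
      have b14 : s'.arr 14 = s.arr 14 := (hf.2 _ (by simp [block, forTo, warrs])).trans a14
      have hb : s.arr 14 k ≤ 1 := by
        by_cases hB : J.Bd k
        · exact (h1 k hB).le
        · rw [h0 k hB]; omega
      simp only [block, wp, BinOp.eval, Mem.setReg_reg, Mem.setReg_arr, Mem.setArr_arr,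
        Mem.setArr_reg, if_true, if_false, Nat.reduceEqDiff, h40, hs'.n, b14]
      refine ⟨by split_ifs <;> omega, fun hn => ⟨by omega, ?_⟩, fun hn => ?_⟩
      -- At the initial state of the second automaton the counter restarts, and the mark at `J.n`
      -- raises it to `1`.
      · obtain rfl : k = J.n := by
          by_contra hcon; simp [hcon] at hn
        have hbn := h1 _ EdgeData.Bd.mid
        refine ⟨by omega, fun _ => ⟨?_, ?_, ?_⟩⟩
        · simp
        · intro v hv
          rw [Function.update_apply]
          split_ifs with h2
          · omega
          · exact i2 v (by omega)
        · intro v hv hvn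
          rw [Function.update_of_ne (by omega), Function.update_of_ne (by omega)]
          exact i3 v (by omega) hvn
      · have hkn : k ≠ J.n := by rintro rfl; simp at hn
        have h12 : s'.reg 12 ≤ k := by
          rw [i1]
          split_ifs with h2
          · omega
          · have := (i2 (k - 1) (by omega)).2; omega
        refine ⟨by omega, fun _ => ⟨?_, ?_, ?_⟩⟩
        · simp
        · intro v hv
          rw [Function.update_apply]
          split_ifs with h2
          · subst h2
            refine ⟨?_, by omega⟩
            rintro (rfl | h3)
            · rw [i1, h1 0 .zero]; rfl
            · exact absurd h3 hkn
          · exact i2 v (by omega)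
        · intro v hv hvn
          rcases Nat.lt_or_ge (v + 1) k with h2 | h2
          · rw [Function.update_of_ne (by omega), Function.update_of_ne (by omega)]
            exact i3 v (by omega) hvn
          · obtain rfl : k = v + 1 := by omega
            rw [Function.update_self, Function.update_of_ne (by omega), i1]
            simp)
  refine Runs.block_singleton (hloop.mono (T' := 11 * J.N + 4) ?_ ?_)
  · simp [block, cost]; omega
  · rintro s2 ⟨⟨-, i2, i3⟩, -⟩
    have hn := hJ.n_lt
    refine ⟨⟨(i2 0 (by omega)).1 (by simp), (i2 J.n hn).1 (by simp), ?_, ?_⟩, ?_⟩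
    · intro v hv hvn hB
      rw [i3 v hv hvn, h1 _ hB]
    · intro v hv hvn hB
      rw [i3 v hv hvn, h0 _ hB, add_zero]
    · intro v hv
      have := (i2 v hv).2; omega

/-- Compute the classes of the ends of every edge. -/
def edgeClasses : Cmd :=
  forTo 4 (block [load 20 0 40, load 20 18 20, store 19 40 20, load 20 1 40, load 20 18 20,
    store 20 40 20])

theorem edgeClasses_runs {s : Mem} (hs : Holds J s) (hw : J.M + 3 ≤ 2 ^ w) :
    Runs w edgeClasses s (10 * J.M + 4) (fun s' => ∀ e < J.M,
      s'.arr 19 e = s.arr 18 (J.src e) ∧ s'.arr 20 e = s.arr 18 (J.dst e)) := by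
  refine ((Runs.forTo (w := w) (n := 4) (N := J.M) (s := s)
    (fun k s' => ∀ e < k,
      s'.arr 19 e = s.arr 18 (J.src e) ∧ s'.arr 20 e = s.arr 18 (J.dst e))
    (by omega) hs.M (by omega) (by simp [block, wregs]) (by simp)
    (by
      rintro k s' hk hI hf h40 h42
      have hs' : Holds J s' := hs.frame hf (by simp [block, forTo, wregs])
        (by simp [block, forTo, warrs])
      have a18 : s'.arr 18 = s.arr 18 := hf.2 _ (by simp [block, forTo, warrs])
      simp only [block, wp, Mem.setReg_reg, Mem.setReg_arr, Mem.setArr_arr,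
        Mem.setArr_reg, if_true, if_false, Nat.reduceEqDiff, h40, hs'.src, hs'.dst, a18]
      intro _ e he
      rw [Function.update_apply, Function.update_apply]
      split_ifs with h1
      · simp [h1]
      · exact hI e (by omega))).mono (by simp [block, cost]; omega) fun _ h => h.1)

/-- Test whether the quotients have the same edges: the result is in register `8`. -/
def compareEdges : Cmd :=
  block [const 8 1, ite 4 (block [const 20 0, load 21 23 20, binop .lt 22 21 1,
    ite 22 skip (const 8 0),
    forTo 4 (block [load 25 23 40, load 26 8 21, load 27 8 25, binop .eq 28 26 27,
      load 26 19 21, load 27 19 25, binop .eq 29 26 27,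
      load 26 20 21, load 27 20 25, binop .eq 30 26 27,
      binop .mul 28 28 29, binop .mul 28 28 30, binop .lt 29 21 1, binop .lt 30 25 1,
      ite 28 skip (block [ite 29 (const 8 0) skip, ite 30 skip (const 8 0)]),
      load 21 23 40]),
    binop .lt 22 21 1, ite 22 (const 8 0) skip]) skip]

/-- Register `x` tells whether the proposition is true. -/
def Tells (s : Mem) (x : ℕ) (p : Prop) : Prop := (p → s.reg x = 1) ∧ (¬ p → s.reg x = 0)

theorem Tells.congr {s : Mem} {x : ℕ} {p q : Prop} (h : Tells s x p) (hpq : p ↔ q) :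
    Tells s x q := by
  rw [← propext hpq]; exact h

-- One pass checks the criterion of `edgesAgree_iff`; the verdict starts as `1` and can only be
-- lowered to `0`. Products of bits serve as conjunctions.
set_option maxHeartbeats 2000000 in
theorem compareEdges_runs {s : Mem} {c : ℕ → ℕ} (hJ : J.IsJoint) (hs : Holds J s)
    (hd : IsListing J.M (s.arr 23))
    (hl : ListedBy J.M (s.arr 23)
      (ByKey (s.arr 20) (ByKey (s.arr 19) (ByKey J.lab (ByKey J.src fun _ _ => True)))))
    (hsrc : ∀ e < J.M, s.arr 19 e = c (J.src e)) (hdst : ∀ e < J.M, s.arr 20 e = c (J.dst e))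
    (hw : J.M + 3 ≤ 2 ^ w) :
    Runs w compareEdges s (40 * (J.M + 1)) (fun s' => Tells s' 8 (J.EdgesAgree c)) := by
  have hpre : Runs w (const 8 1) s 1 (fun s' => s'.reg 8 = 1) := by
    refine Runs.of_wp ?_
    simp only [wp, Mem.setReg_reg, if_true]
    exact ⟨by omega, trivial⟩
  refine (Runs.block_cons hpre.frame (T' := 30 * J.M + 30) ?_).mono (by omega) fun _ h => h
  rintro s1 ⟨h8, hf1⟩
  have hs1 : Holds J s1 := hs.frame hf1 (by simp [wregs]) (by simp [warrs])
  have harr1 : ∀ a, s1.arr a = s.arr a := fun a => hf1.2 _ (by simp [warrs])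
  refine Runs.block_singleton (T := 30 * J.M + 29) ?_
  have hmM := hJ.m_le
  -- Without edges the quotients agree trivially, whereas the criterion needs a first and a last
  -- entry.
  by_cases hM : J.M = 0
  · refine ⟨s1, 2, Exec.ite_false (by rw [hs1.M, hM]) (.skip _), by omega, fun _ => h8, ?_⟩
    intro hcon
    refine absurd ⟨fun e he => ?_, fun f _ hf => ?_⟩ hcon <;> omega
  set d := s.arr 23 with hdd
  have hM' : s1.reg 4 ≠ 0 := by rw [hs1.M]; exact hM
  suffices hmain : Runs w (block [const 20 0, load 21 23 20, binop .lt 22 21 1,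
    ite 22 skip (const 8 0),
    forTo 4 (block [load 25 23 40, load 26 8 21, load 27 8 25, binop .eq 28 26 27,
      load 26 19 21, load 27 19 25, binop .eq 29 26 27,
      load 26 20 21, load 27 20 25, binop .eq 30 26 27,
      binop .mul 28 28 29, binop .mul 28 28 30, binop .lt 29 21 1, binop .lt 30 25 1,
      ite 28 skip (block [ite 29 (const 8 0) skip, ite 30 skip (const 8 0)]),
      load 21 23 40]),
    binop .lt 22 21 1, ite 22 (const 8 0) skip]) s1 (30 * J.M + 28)
      (fun s' => Tells s' 8 (J.EdgesAgree c)) by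
    obtain ⟨s', t, g1, g2, g3⟩ := hmain
    exact ⟨s', t + 1, Exec.ite_true hM' g1, by omega, g3⟩
  have hpre2 : Runs w (block [const 20 0, load 21 23 20, binop .lt 22 21 1,
      ite 22 skip (const 8 0)]) s1 6 (fun s' => s'.reg 21 = d 0 ∧ Tells s' 8 (d 0 < J.m)) := by
    refine (Runs.of_wp ?_).mono (by simp [block, cost]) fun _ h => h
    simp only [block, wp, BinOp.eval, Mem.setReg_reg, Mem.setReg_arr, if_true, if_false,
      Nat.reduceEqDiff, harr1, hs1.m, Tells, h8]
    rw [← hdd]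
    refine ⟨by omega, by split_ifs <;> omega, ?_⟩
    by_cases h1 : d 0 < J.m
    · simp [h1]
    · simp [h1]
  refine (Runs.block_append (l₂ := [_, _, _]) hpre2.frame (T' := J.M * 25 + 4 + 4) ?_).mono
    (by omega) fun _ h => h
  rintro s2 ⟨⟨h21, h8⟩, hf2⟩
  have hs2 : Holds J s2 := hs1.frame hf2 (by simp [block, wregs]) (by simp [block, warrs])
  have harr2 : ∀ a, s2.arr a = s.arr a := fun a => (hf2.2 _ (by simp [block, warrs])).trans (harr1 a)
  have hloop := Runs.forTo (w := w) (n := 4) (N := J.M) (s := s2)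
    (c := block [load 25 23 40, load 26 8 21, load 27 8 25, binop .eq 28 26 27,
      load 26 19 21, load 27 19 25, binop .eq 29 26 27,
      load 26 20 21, load 27 20 25, binop .eq 30 26 27,
      binop .mul 28 28 29, binop .mul 28 28 30, binop .lt 29 21 1, binop .lt 30 25 1,
      ite 28 skip (block [ite 29 (const 8 0) skip, ite 30 skip (const 8 0)]),
      load 21 23 40])
    (fun k s' => s'.reg 21 = d (k - 1) ∧
      Tells s' 8 (d 0 < J.m ∧ ∀ i, i + 1 < k → J.SameEdge c (d i) (d (i + 1)) ∨
        J.m ≤ d i ∧ d (i + 1) < J.m))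
    (by omega) hs2.M (by omega) (by simp [block, wregs])
    (by
      intro b
      simpa [Tells, Mem.setReg_reg, h21] using h8)
    (by
      rintro k s' hk ⟨g21, g8⟩ hf h40 h42
      have hs' : Holds J s' := hs2.frame hf (by simp [block, forTo, wregs])
        (by simp [block, forTo, warrs])
      have harr : ∀ a, s'.arr a = s.arr a :=
        fun a => (hf.2 _ (by simp [block, forTo, warrs])).trans (harr2 a)
      have hlab : s.arr 8 = J.lab := (harr 8).symm.trans hs'.lab
      have hdk : d k < J.M := hd.1 k hk
      have hdk1 : d (k - 1) < J.M := hd.1 (k - 1) (by omega)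
      have hpost : ∀ x, ((d 0 < J.m ∧ ∀ i, i + 1 < k + 1 →
              J.SameEdge c (d i) (d (i + 1)) ∨ J.m ≤ d i ∧ d (i + 1) < J.m) → x = 1) → (¬ (d 0 < J.m ∧ ∀ i, i + 1 < k + 1 →
              J.SameEdge c (d i) (d (i + 1)) ∨ J.m ≤ d i ∧ d (i + 1) < J.m) → x = 0) → ∀ s'' : Mem,
            s''.reg 8 = x → s''.arr = s'.arr → s''.reg 40 = k →
          (block [load 21 23 40]).wp w (fun s'' => ∀ b,
            s''.reg 21 = d (k + 1 - 1) ∧ Tells ((s''.setReg 40 (k + 1)).setReg 41 b) 8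
              (d 0 < J.m ∧ ∀ i, i + 1 < k + 1 →
              J.SameEdge c (d i) (d (i + 1)) ∨ J.m ≤ d i ∧ d (i + 1) < J.m)) s'' := by
        intro x hx1 hx2 s'' hx' harr' hk'
        simp only [block, wp, Mem.setReg_reg, if_true, if_false,
          Nat.reduceEqDiff, harr', harr, hk', Nat.add_sub_cancel, ← hdd, true_and, Tells, hx']
        exact fun _ => ⟨hx1, hx2⟩
      have hsame : J.SameEdge c (d (k - 1)) (d k) ↔ J.lab (d (k - 1)) = J.lab (d k) ∧
          s.arr 19 (d (k - 1)) = s.arr 19 (d k) ∧ s.arr 20 (d (k - 1)) = s.arr 20 (d k) := by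
        rw [hsrc _ hdk, hsrc _ hdk1, hdst _ hdk, hdst _ hdk1]; rfl
      -- Round `k` adds the condition on the entries `k - 1` and `k`; for `k = 0` they coincide, and
      -- the condition holds.
      have hstep : (d 0 < J.m ∧ ∀ i, i + 1 < k + 1 →
            J.SameEdge c (d i) (d (i + 1)) ∨ J.m ≤ d i ∧ d (i + 1) < J.m) ↔
          (d 0 < J.m ∧ ∀ i, i + 1 < k →
            J.SameEdge c (d i) (d (i + 1)) ∨ J.m ≤ d i ∧ d (i + 1) < J.m) ∧
          (J.SameEdge c (d (k - 1)) (d k) ∨ J.m ≤ d (k - 1) ∧ d k < J.m) := by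
        constructor
        · rintro ⟨a1, a2⟩
          refine ⟨⟨a1, fun i hi => a2 i (by omega)⟩, ?_⟩
          rcases Nat.eq_zero_or_pos k with rfl | h1
          · exact Or.inl ⟨rfl, rfl, rfl⟩
          · have := a2 (k - 1) (by omega)
            rwa [Nat.sub_add_cancel h1] at this
        · rintro ⟨⟨a1, a2⟩, a3⟩
          refine ⟨a1, fun i hi => ?_⟩
          rcases Nat.lt_or_ge (i + 1) k with h1 | h1
          · exact a2 i h1
          · obtain rfl : k = i + 1 := by omega
            exact a3
      have h01 : ∀ p : Prop, ∀ _ : Decidable p, (if p then 1 else 0) < 2 ^ w := by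
        intro p _; split_ifs <;> omega
      have hmul : ∀ p q : Prop, ∀ _ : Decidable p, ∀ _ : Decidable q,
          (if p then 1 else 0) * (if q then 1 else 0) = if p ∧ q then 1 else 0 := by
        intro p q _ _; split_ifs <;> simp_all
      rw [block, block, block, block, block, block, block, block, block, block, block, block,
        block, block, block]
      simp only [wp, BinOp.eval, Mem.setReg_reg, Mem.setReg_arr, if_true, if_false,
        Nat.reduceEqDiff, h40, g21, hs'.m, harr, hlab, hmul, h01, true_and, ← hdd]
      generalize wp w (block [load 21 23 40]) _ = K at hpost ⊢
      generalize (d 0 < J.m ∧ ∀ i, i + 1 < k + 1 →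
        J.SameEdge c (d i) (d (i + 1)) ∨ J.m ≤ d i ∧ d (i + 1) < J.m) = P' at hpost hstep
      simp only [Tells] at g8
      generalize (d 0 < J.m ∧ ∀ i, i + 1 < k →
        J.SameEdge c (d i) (d (i + 1)) ∨ J.m ≤ d i ∧ d (i + 1) < J.m) = P at g8 hstep
      refine ⟨fun h1 => ?_, fun h1 => ?_⟩
      · have hS : J.SameEdge c (d (k - 1)) (d k) := by
          refine hsame.2 ?_
          by_contra hcon
          exact h1 (if_neg (by tauto))
        exact hpost (s'.reg 8) (by tauto) (by tauto) _ (by simp [Mem.setReg_reg]) rfl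
          (by simp [Mem.setReg_reg, h40])
      · have hS : ¬ J.SameEdge c (d (k - 1)) (d k) := by
          intro hcon
          rw [hsame] at hcon
          rw [if_pos (by tauto)] at h1
          omega
        simp only [block, wp, Mem.setReg_reg, if_true, if_false, Nat.reduceEqDiff]
        refine ⟨fun h2 => ⟨by omega, fun h3 => ?_, fun h3 => ⟨by omega, ?_⟩⟩,
          fun h2 => ⟨fun h3 => ?_, fun h3 => ⟨by omega, ?_⟩⟩⟩
        · have h2 : d (k - 1) < J.m := by by_contra hcon; simp [hcon] at h2
          have hP' : ¬ P' := fun h => by have := (hstep.1 h).2.resolve_left hS; omega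
          exact hpost 0 (fun h => absurd h hP') (fun _ => rfl) _ (by simp [Mem.setReg_reg]) rfl
            (by simp [Mem.setReg_reg, h40])
        · have h2 : d (k - 1) < J.m := by by_contra hcon; simp [hcon] at h2
          have hP' : ¬ P' := fun h => by have := (hstep.1 h).2.resolve_left hS; omega
          exact hpost 0 (fun h => absurd h hP') (fun _ => rfl) _ (by simp [Mem.setReg_reg]) rfl
            (by simp [Mem.setReg_reg, h40])
        · have h2 : ¬ d (k - 1) < J.m := by intro hcon; simp [hcon] at h2
          have h3 : d k < J.m := by by_contra hcon; simp [hcon] at h3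
          have hP' : P' ↔ P := hstep.trans ⟨fun h => h.1, fun h => ⟨h, Or.inr ⟨by omega, h3⟩⟩⟩
          exact hpost (s'.reg 8) (by tauto) (by tauto) _ (by simp [Mem.setReg_reg]) rfl
            (by simp [Mem.setReg_reg, h40])
        · have h3 : ¬ d k < J.m := by intro hcon; simp [hcon] at h3
          have hP' : ¬ P' := fun h => by have := (hstep.1 h).2.resolve_left hS; omega
          exact hpost 0 (fun h => absurd h hP') (fun _ => rfl) _ (by simp [Mem.setReg_reg]) rfl
            (by simp [Mem.setReg_reg, h40]))
  refine Runs.block_cons (T' := 4) ((hloop.frame).mono (by simp [block, cost]) fun _ h => h) ?_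
  rintro s3 ⟨⟨⟨g21, g8⟩, -⟩, hf3⟩
  have hs3 : Holds J s3 := hs2.frame hf3 (by simp [block, forTo, wregs])
    (by simp [block, forTo, warrs])
  have hiff := EdgeData.edgesAgree_iff hJ hd hsrc hdst hl (by omega)
  refine (Runs.of_wp ?_).mono (by simp [block, cost]) fun _ h => h
  simp only [block, wp, BinOp.eval, Mem.setReg_reg, if_true, if_false, Nat.reduceEqDiff, g21, hs3.m,
    Tells, hiff]
  refine ⟨by split_ifs <;> omega, fun h1 => ⟨by omega, ?_, fun _ => trivial⟩, fun h1 => ?_⟩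
  · have h1 : d (J.M - 1) < J.m := by by_contra hcon; simp [hcon] at h1
    rintro ⟨-, h2⟩; omega
  · have h1 : ¬ d (J.M - 1) < J.m := by intro hcon; simp [hcon] at h1
    exact ⟨fun h => g8.1 h.1, fun h => g8.2 fun h' => h ⟨h', by omega⟩⟩

/-- Test whether classes with the same number agree on being final; the result, together with
that in register `8`, is put into register `0`. -/
def compareFinal : Cmd :=
  block [forTo 5 (block [load 20 18 40, load 21 3 40, binop .lt 22 40 0,
    ite 22 (store 25 20 21) (block [load 23 25 20, binop .eq 23 23 21, ite 23 skip (const 8 0)])]),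
    binop .land 0 8 8]

/-- Finality is constant on classes, so one bit per class of the first automaton suffices, and it
does not matter which of its states wrote it. -/
theorem compareFinal_runs {s : Mem} (hJ : J.IsJoint) (hs : Holds J s)
    (hc : J.IsClassMap (s.arr 18)) (h8 : Tells s 8 (J.EdgesAgree (s.arr 18)))
    (hw : J.N + 3 ≤ 2 ^ w) :
    Runs w compareFinal s (20 * (J.N + 1)) (fun s' => Tells s' 0 (∃ R, J.IsWB R)) := by
  set c := s.arr 18 with hcc
  have hn := hJ.n_lt
  set G : ℕ → Prop := fun v => ∃ u < J.n, c u = c v ∧ J.fin u = J.fin v with hG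
  have hloop := Runs.forTo (w := w) (n := 5) (N := J.N) (s := s)
    (c := block [load 20 18 40, load 21 3 40, binop .lt 22 40 0,
      ite 22 (store 25 20 21) (block [load 23 25 20, binop .eq 23 23 21, ite 23 skip (const 8 0)])])
    (fun k s' => (∀ u < k, u < J.n → ∃ v < J.n, c v = c u ∧ s'.arr 25 (c u) = J.fin v) ∧
      Tells s' 8 (J.EdgesAgree c ∧ ∀ v < k, J.n ≤ v → G v))
    (by omega) hs.N (by omega) (by simp [block, wregs])
    (by
      intro b
      simpa [Tells, Mem.setReg_reg] using h8)
    (by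
      rintro k s' hk ⟨g1, g8⟩ hf h40 h42
      have hs' : Holds J s' := hs.frame hf (by simp [block, forTo, wregs])
        (by simp [block, forTo, warrs])
      have a18 : s'.arr 18 = c := hf.2 _ (by simp [block, forTo, warrs])
      simp only [block, wp, BinOp.eval, Mem.setReg_reg, Mem.setReg_arr, Mem.setArr_arr,
        Mem.setArr_reg, if_true, if_false, Nat.reduceEqDiff, h40, hs'.n, hs'.fin, a18, Tells]
      simp only [Tells] at g8
      have hstep : (J.EdgesAgree c ∧ ∀ v < k + 1, J.n ≤ v → G v) ↔
          (J.EdgesAgree c ∧ ∀ v < k, J.n ≤ v → G v) ∧ (J.n ≤ k → G k) := by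
        constructor
        · exact fun h => ⟨⟨h.1, fun v hv => h.2 v (by omega)⟩, h.2 k (by omega)⟩
        · rintro ⟨⟨h1, h2⟩, h3⟩
          refine ⟨h1, fun v hv hnv => ?_⟩
          rcases Nat.lt_or_ge v k with h4 | h4
          · exact h2 v h4 hnv
          · obtain rfl : v = k := by omega
            exact h3 hnv
      generalize (J.EdgesAgree c ∧ ∀ v < k + 1, J.n ≤ v → G v) = P' at hstep ⊢
      refine ⟨by split_ifs <;> omega, fun h22 => ?_, fun h22 => ⟨by split_ifs <;> omega,
        fun h23 => ?_, fun h23 => ⟨by omega, ?_⟩⟩⟩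
      · have hkn : k < J.n := by by_contra hcon; simp [hcon] at h22
        have : P' ↔ (J.EdgesAgree c ∧ ∀ v < k, J.n ≤ v → G v) :=
          hstep.trans ⟨fun h => h.1, fun h => ⟨h, fun h' => by omega⟩⟩
        refine fun _ => ⟨fun u hu hun => ?_, by rw [this]; exact g8⟩
        rw [Function.update_apply]
        split_ifs with h2
        · exact ⟨k, hkn, h2.symm, rfl⟩
        · exact g1 u (by by_contra hcon; exact h2 (by rw [show u = k by omega])) hun
      all_goals
        have hkn : J.n ≤ k := by by_contra hcon; simp [not_le.1 hcon] at h22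
        -- Only if the edges agree is the entry for the class of `k` known to have been written.
        -- Otherwise the verdict is already `0`, and the comparison has no influence.
        have hgood : J.EdgesAgree c → (G k ↔ s'.arr 25 (c k) = J.fin k) := by
          intro hE
          obtain ⟨u, hu, huk⟩ := hE.exists_class hJ hc hkn hk
          obtain ⟨v, hv, hvu, hfv⟩ := g1 u (by omega) hu
          rw [huk] at hfv hvu
          constructor
          · rintro ⟨x, hx, hxk, hfx⟩
            have : J.SameClass c x v := ⟨by omega, by omega, by omega, by omega⟩
            rw [hfv, ← hfx, (this.bisim hJ hc).1]
          · intro h; exact ⟨v, hv, hvu, by omega⟩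
        refine fun _ => ⟨fun u hu hun => g1 u (by omega) hun, ?_⟩
      · have h1 : s'.arr 25 (c k) = J.fin k := by by_contra hcon; simp [hcon] at h23
        have : P' ↔ (J.EdgesAgree c ∧ ∀ v < k, J.n ≤ v → G v) :=
          hstep.trans ⟨fun h => h.1, fun h => ⟨h, fun _ => (hgood h.1).2 h1⟩⟩
        rw [this]; exact g8
      · have h1 : s'.arr 25 (c k) ≠ J.fin k := by intro hcon; simp [hcon] at h23
        have : ¬ P' := fun h => h1 ((hgood (hstep.1 h).1.1).1 ((hstep.1 h).2 hkn))
        simp [this])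
  refine (Runs.block_cons hloop (T' := 2) ?_).mono (by simp [block, cost]; omega) fun _ h => h
  rintro s2 ⟨⟨-, g8⟩, -⟩
  have g8 : Tells s2 8 (∃ R, J.IsWB R) := g8.congr <| by
    rw [EdgeData.exists_isWB_iff hJ hc, EdgeData.EdgesAgree, and_assoc]
    simp only [hG]
    exact ⟨fun h => ⟨h.1, h.2.1, fun v h1 h2 => h.2.2 v h2 h1⟩,
      fun h => ⟨h.1, h.2.1, fun v h1 h2 => h.2.2 v h2 h1⟩⟩
  refine (Runs.of_wp ?_).mono (by simp [block, cost]) fun _ h => h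
  simp only [block, wp, BinOp.eval, Nat.and_self, Tells, Mem.setReg_reg, if_true]
  refine ⟨?_, g8⟩
  by_cases hR : ∃ R, J.IsWB R
  · rw [g8.1 hR]; omega
  · rw [g8.2 hR]; omega

end Cmd
end WheelerBisim


/-! ### Decision procedure for ranked labels, and the ranking -/

namespace WheelerBisim

namespace Cmd

variable {w : ℕ} {J : EdgeData}

/-- Decide whether a Wheeler bisimulation exists, once the labels have been replaced by ranks. -/
def decideRanked : Cmd :=
  block [countingSort 0 5 9 10 11, countingSort 8 6 10 12 13, markFin, markLabels, link, propagate,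
    numberClasses, edgeClasses, countingSort 19 7 12 21 22, countingSort 20 7 21 23 24,
    compareEdges, compareFinal]

/-- The four counting sorts form one radix sort: by source and label for the boundaries, then by
class of source and class of target for the comparison of quotients. All keys are bounded linearly
in `J.N` and `J.M`. Every counting array is used once and is still zero at that time. -/
theorem decideRanked_runs {s : Mem} (hJ : J.IsJoint) (hs : Holds J s)
    (hlab : ∀ e < J.M, J.lab e ≤ J.M) (hid : ∀ i < J.M, s.arr 9 i = i)
    (hz : ∀ a, 10 ≤ a → a ≤ 25 → ∀ i, s.arr a i = 0) (hw : 2 * (J.N + J.M + 5) ≤ 2 ^ w) :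
    Runs w decideRanked s (400 * (J.M + J.N + 1))
      (fun s' => Tells s' 0 (∃ R, J.IsWB R)) := by
  have hlist : IsListing J.M (s.arr 9) :=
    ⟨fun i hi => by rw [hid i hi]; exact hi, fun i hi j hj h => by rwa [hid i hi, hid j hj] at h⟩
  refine Runs.mono (T := 30 * (J.M + J.N + 1) + (30 * (J.M + (J.M + 1) + 1) + (20 * (J.N + 1) +
    (40 * (J.M + 1) + (11 * J.M + 4 + (50 * (J.N + 1) + (11 * J.N + 6 + (10 * J.M + 4 +
    (30 * (J.M + (J.N + 1) + 1) + (30 * (J.M + (J.N + 1) + 1) + (40 * (J.M + 1) +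
    (20 * (J.N + 1) + 1)))))))))))) ?_ (by omega) (fun _ h => h)
  refine Runs.block_cons (countingSort_runs (by norm_num) (by norm_num) hs.M hs.N
    (hz 11 (by norm_num) (by norm_num))
    (fun i hi => by rw [hid i hi, hs.src]; exact hJ.src_lt i hi) (by omega)).frame ?_
  rintro s1 ⟨p1, f1⟩
  have hs1 : Holds J s1 := hs.frame f1 (by simp [countingSort, block, forTo, wregs])
    (by simp [countingSort, block, forTo, warrs])
  have hz1 : ∀ a, 12 ≤ a → a ≤ 25 → ∀ i, s1.arr a i = 0 := fun a h1 h2 i => by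
    rw [f1.2 a (by simp [countingSort, block, forTo, warrs]; omega), hz a (by omega) h2]
  obtain ⟨l1, o1⟩ := hlist.of_sortPos p1
  have o1 := o1 (fun _ _ => True) (fun _ _ _ _ => trivial)
  rw [hs.src] at o1
  clear p1 f1 hz hid hlist
  refine Runs.block_cons (countingSort_runs (by norm_num) (by norm_num) hs1.M hs1.M1
    (hz1 13 (by norm_num) (by norm_num))
    (fun i hi => by rw [hs1.lab]; have := hlab _ (l1.1 i hi); omega) (by omega)).frame ?_
  rintro s2 ⟨p2, f2⟩
  have hs2 : Holds J s2 := hs1.frame f2 (by simp [countingSort, block, forTo, wregs])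
    (by simp [countingSort, block, forTo, warrs])
  have hz2 : ∀ a, 14 ≤ a → a ≤ 25 → ∀ i, s2.arr a i = 0 := fun a h1 h2 i => by
    rw [f2.2 a (by simp [countingSort, block, forTo, warrs]; omega), hz1 a (by omega) h2]
  obtain ⟨l2, o2⟩ := l1.of_sortPos p2
  have o2 := o2 _ o1
  rw [hs1.lab] at o2
  have hd2 : Sorted J (s2.arr 12) := ⟨l2, o2⟩
  clear p2 f2 hz1 o1 l1
  refine Runs.block_cons (markFin_runs hs2 (hz2 14 (by norm_num) (by norm_num)) (by omega)).frame ?_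
  rintro s3 ⟨⟨h42, qs, hQ, hS, hF⟩, f3⟩
  have hs3 : Holds J s3 := hs2.frame f3 (by simp [markFin, push, block, forTo, wregs])
    (by simp [markFin, push, block, forTo, warrs])
  have hz3 : ∀ a, 16 ≤ a → a ≤ 25 → ∀ i, s3.arr a i = 0 := fun a h1 h2 i => by
    rw [f3.2 a (by simp [markFin, push, block, forTo, warrs]; omega), hz2 a (by omega) h2]
  have e3 : s3.arr 12 = s2.arr 12 := f3.2 _ (by simp [markFin, push, block, forTo, warrs])
  rw [← e3] at hd2 l2 o2
  clear f3 hz2 e3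
  refine Runs.block_cons (markLabels_runs hJ hs3 hd2 h42 hQ hS hF (by omega)).frame ?_
  clear h42 hQ hS hF qs
  rintro s4 ⟨⟨-, qs, hQ, hS, hB⟩, f4⟩
  have hs4 : Holds J s4 := hs3.frame f4 (by simp [markLabels, push, block, forTo, wregs])
    (by simp [markLabels, push, block, forTo, warrs])
  have hz4 : ∀ a, 16 ≤ a → a ≤ 25 → ∀ i, s4.arr a i = 0 := fun a h1 h2 i => by
    rw [f4.2 a (by simp [markLabels, push, block, forTo, warrs]; omega), hz3 a (by omega) h2]
  have e4 : s4.arr 12 = s3.arr 12 := f4.2 _ (by simp [markLabels, push, block, forTo, warrs])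
  rw [← e4] at hd2 l2 o2
  clear f4 hz3 e4
  refine Runs.block_cons (link_runs hs4 hd2 (hz4 16 (by norm_num) (by norm_num))
    (hz4 17 (by norm_num) (by norm_num)) (by omega)).frame ?_
  rintro s5 ⟨⟨hL, h42⟩, f5⟩
  have hs5 : Holds J s5 := hs4.frame f5 (by simp [link, block, forTo, wregs])
    (by simp [link, block, forTo, warrs])
  have hz5 : ∀ a, 18 ≤ a → a ≤ 25 → ∀ i, s5.arr a i = 0 := fun a h1 h2 i => by
    rw [f5.2 a (by simp [link, block, forTo, warrs]; omega), hz4 a (by omega) h2]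
  have e5 : s5.arr 12 = s4.arr 12 := f5.2 _ (by simp [link, block, forTo, warrs])
  rw [← e5] at l2 o2
  have hQ : Queued J s5 qs := hQ.congr (f5.1 _ (by simp [link, block, forTo, wregs]))
    (f5.2 _ (by simp [link, block, forTo, warrs])) (f5.2 _ (by simp [link, block, forTo, warrs]))
  clear f5 hz4 e5 hd2
  refine Runs.block_cons (propagate_runs hJ hs5 hL h42 hQ hS hB (by omega)).frame ?_
  rintro s6 ⟨⟨hB1, hB0⟩, f6⟩
  have hs6 : Holds J s6 := hs5.frame f6 (by simp [propagate, push, block, wregs])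
    (by simp [propagate, push, block, warrs])
  have hz6 : ∀ a, 18 ≤ a → a ≤ 25 → ∀ i, s6.arr a i = 0 := fun a h1 h2 i => by
    rw [f6.2 a (by simp [propagate, push, block, warrs]; omega), hz5 a (by omega) h2]
  have e6 : s6.arr 12 = s5.arr 12 := f6.2 _ (by simp [propagate, push, block, warrs])
  rw [← e6] at l2 o2
  clear f6 hz5 e6 hQ hS hB hL h42
  refine Runs.block_cons (numberClasses_runs hJ hs6 hB1 hB0 (by omega)).frame ?_
  rintro s7 ⟨⟨hc, hcN⟩, f7⟩
  have hs7 : Holds J s7 := hs6.frame f7 (by simp [numberClasses, block, forTo, wregs])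
    (by simp [numberClasses, block, forTo, warrs])
  have hz7 : ∀ a, 19 ≤ a → a ≤ 25 → ∀ i, s7.arr a i = 0 := fun a h1 h2 i => by
    rw [f7.2 a (by simp [numberClasses, block, forTo, warrs]; omega), hz6 a (by omega) h2]
  have e7 : s7.arr 12 = s6.arr 12 := f7.2 _ (by simp [numberClasses, block, forTo, warrs])
  rw [← e7] at l2 o2
  clear f7 hz6 e7 hB1 hB0
  set c := s7.arr 18 with hcc
  refine Runs.block_cons (edgeClasses_runs hs7 (by omega)).frame ?_
  rintro s8 ⟨hE, f8⟩
  have hs8 : Holds J s8 := hs7.frame f8 (by simp [edgeClasses, block, forTo, wregs])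
    (by simp [edgeClasses, block, forTo, warrs])
  have hz8 : ∀ a, 21 ≤ a → a ≤ 25 → ∀ i, s8.arr a i = 0 := fun a h1 h2 i => by
    rw [f8.2 a (by simp [edgeClasses, block, forTo, warrs]; omega), hz7 a (by omega) h2]
  have e8 : s8.arr 12 = s7.arr 12 := f8.2 _ (by simp [edgeClasses, block, forTo, warrs])
  have c8 : s8.arr 18 = c := f8.2 _ (by simp [edgeClasses, block, forTo, warrs])
  rw [← e8] at l2 o2
  rw [← hcc] at hE
  clear f8 hz7 e8
  refine Runs.block_cons (countingSort_runs (by norm_num) (by norm_num) hs8.M hs8.N1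
    (hz8 22 (by norm_num) (by norm_num))
    (fun i hi => by
      have h1 := l2.1 i hi
      rw [(hE _ h1).1]
      have := hcN _ (hJ.src_lt _ h1)
      omega) (by omega)).frame ?_
  rintro s9 ⟨p9, f9⟩
  have hs9 : Holds J s9 := hs8.frame f9 (by simp [countingSort, block, forTo, wregs])
    (by simp [countingSort, block, forTo, warrs])
  have hz9 : ∀ a, 23 ≤ a → a ≤ 25 → ∀ i, s9.arr a i = 0 := fun a h1 h2 i => by
    rw [f9.2 a (by simp [countingSort, block, forTo, warrs]; omega), hz8 a (by omega) h2]
  obtain ⟨l9, o9⟩ := l2.of_sortPos p9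
  have o9 := o9 _ o2
  have c9 : s9.arr 18 = c := (f9.2 _ (by simp [countingSort, block, forTo, warrs])).trans c8
  have e19 : s9.arr 19 = s8.arr 19 := f9.2 _ (by simp [countingSort, block, forTo, warrs])
  have e20 : s9.arr 20 = s8.arr 20 := f9.2 _ (by simp [countingSort, block, forTo, warrs])
  rw [← e19] at o9
  rw [← e19, ← e20] at hE
  clear p9 f9 hz8 o2 l2 e19 e20
  refine Runs.block_cons (countingSort_runs (by norm_num) (by norm_num) hs9.M hs9.N1
    (hz9 24 (by norm_num) (by norm_num))
    (fun i hi => by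
      have h1 := l9.1 i hi
      rw [(hE _ h1).2]
      have := hcN _ (hJ.dst_lt _ h1)
      omega) (by omega)).frame ?_
  rintro s10 ⟨p10, f10⟩
  have hs10 : Holds J s10 := hs9.frame f10 (by simp [countingSort, block, forTo, wregs])
    (by simp [countingSort, block, forTo, warrs])
  obtain ⟨l10, o10⟩ := l9.of_sortPos p10
  have o10 := o10 _ o9
  have c10 : s10.arr 18 = c := (f10.2 _ (by simp [countingSort, block, forTo, warrs])).trans c9
  have e19 : s10.arr 19 = s9.arr 19 := f10.2 _ (by simp [countingSort, block, forTo, warrs])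
  have e20 : s10.arr 20 = s9.arr 20 := f10.2 _ (by simp [countingSort, block, forTo, warrs])
  rw [← e19, ← e20] at o10
  rw [← e19, ← e20] at hE
  clear p10 f10 hz9 o9 l9 e19 e20
  refine Runs.block_cons (compareEdges_runs hJ hs10 l10 o10 (fun e he => (hE e he).1)
    (fun e he => (hE e he).2) (by omega)).frame ?_
  rintro s11 ⟨h8, f11⟩
  have hs11 : Holds J s11 := hs10.frame f11 (by simp [compareEdges, block, forTo, wregs])
    (by simp [compareEdges, block, forTo, warrs])
  have c11 : s11.arr 18 = c := (f11.2 _ (by simp [compareEdges, block, forTo, warrs])).trans c10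
  exact Runs.block_singleton (compareFinal_runs hJ hs11 (by rwa [c11]) (by rwa [c11]) (by omega))

/-- Compute the ranks of the labels from the sorted order in array `101`. -/
def rankLabels : Cmd :=
  block [const 12 0, load 20 101 12, load 13 2 20,
    forTo 4 (block [load 20 101 40, load 21 2 20, binop .eq 22 21 13,
      ite 22 skip (binop .add 12 12 42), store 8 20 12, load 13 2 20])]

/-- Labels are arbitrary words, too large as keys of a counting sort. Only their order matters, so
along the sorted list they are replaced by the number of changes of label so far. -/
theorem rankLabels_runs {s : Mem} {M : ℕ} (h4 : s.reg 4 = M) (hd : IsListing M (s.arr 101))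
    (hl : ∀ i j, i ≤ j → j < M → s.arr 2 (s.arr 101 i) ≤ s.arr 2 (s.arr 101 j))
    (hw : M + 3 ≤ 2 ^ w) :
    Runs w rankLabels s (20 * (M + 1)) (fun s' => (∀ e < M, s'.arr 8 e ≤ M) ∧
      ∀ e < M, ∀ f < M, s'.arr 8 e ≤ s'.arr 8 f ↔ s.arr 2 e ≤ s.arr 2 f) := by
  set d := s.arr 101 with hdd
  set lab := s.arr 2 with hlab
  have hpre : Runs w (block [const 12 0, load 20 101 12, load 13 2 20]) s 4
      (fun s' => s'.reg 12 = 0 ∧ s'.reg 13 = lab (d 0)) := by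
    refine Runs.of_wp ?_
    simp only [block, wp, Mem.setReg_reg, Mem.setReg_arr, if_true, if_false, Nat.reduceEqDiff,
      ← hdd, ← hlab, and_true]
    omega
  refine (Runs.block_append (l₂ := [_]) hpre.frame (T' := M * 11 + 5) ?_).mono (by omega)
    fun _ h => h
  rintro s1 ⟨⟨h12, h13⟩, f1⟩
  have h4' : s1.reg 4 = M := (f1.1 _ (by simp [block, wregs])).trans h4
  have harr : ∀ a, s1.arr a = s.arr a := fun a => f1.2 _ (by simp [block, warrs])
  have hloop := Runs.forTo (w := w) (n := 4) (N := M) (s := s1)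
    (c := block [load 20 101 40, load 21 2 20, binop .eq 22 21 13,
      ite 22 skip (binop .add 12 12 42), store 8 20 12, load 13 2 20])
    (fun k s' => s'.reg 13 = lab (d (k - 1)) ∧ s'.reg 12 ≤ k ∧
      (k ≠ 0 → s'.arr 8 (d (k - 1)) = s'.reg 12) ∧
      (∀ i < k, s'.arr 8 (d i) ≤ s'.reg 12) ∧
      ∀ i < k, ∀ j < k, s'.arr 8 (d i) ≤ s'.arr 8 (d j) ↔ lab (d i) ≤ lab (d j))
    (by omega) h4' (by omega) (by simp [block, wregs])
    (by simp [Mem.setReg_reg, h12, h13])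
    (by
      rintro k s' hk ⟨g1, g2, g3, g4, g5⟩ hf h40 h42
      have a101 : s'.arr 101 = d :=
        (hf.2 _ (by simp [block, forTo, warrs])).trans (harr _)
      have a2 : s'.arr 2 = lab := (hf.2 _ (by simp [block, forTo, warrs])).trans (harr _)
      -- Here `x` is the rank of the new entry: the current counter if its label repeats the
      -- previous one, and one more otherwise.
      have hpost : ∀ x, x ≤ k + 1 →
          (∀ i < k, s'.arr 8 (d i) ≤ x ∧ (x ≤ s'.arr 8 (d i) ↔ lab (d k) ≤ lab (d i))) →
          ∀ s'' : Mem, s''.reg 40 = k → s''.reg 12 = x → s''.reg 20 = d k → s''.arr = s'.arr →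
          (block [store 8 20 12, load 13 2 20]).wp w (fun s'' => ∀ b : ℕ,
            s''.reg 13 = lab (d (k + 1 - 1)) ∧ s''.reg 12 ≤ k + 1 ∧
            (k + 1 ≠ 0 → s''.arr 8 (d (k + 1 - 1)) = s''.reg 12) ∧
            (∀ i < k + 1, s''.arr 8 (d i) ≤ s''.reg 12) ∧
            ∀ i < k + 1, ∀ j < k + 1,
              s''.arr 8 (d i) ≤ s''.arr 8 (d j) ↔ lab (d i) ≤ lab (d j)) s'' := by
        intro x hxk hx s'' k40 k12 k20 karr
        have hup : ∀ i, Function.update (s'.arr 8) (d k) x (d i) =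
            if d i = d k then x else s'.arr 8 (d i) := fun i => by
          rw [Function.update_apply]
        have hne : ∀ i < k, d i ≠ d k := fun i hi h => by
          have := hd.2 i (by omega) k hk h; omega
        simp only [block, wp, Mem.setReg_reg, Mem.setReg_arr, Mem.setArr_arr, Mem.setArr_reg,
          if_true, if_false, Nat.reduceEqDiff, k12, k20, karr, a2, Nat.add_sub_cancel, hup]
        refine fun _ => ⟨trivial, hxk, fun _ => trivial, fun i hi => ?_, fun i hi j hj => ?_⟩
        · rcases Nat.lt_or_ge i k with h1 | h1
          · rw [if_neg (hne i h1)]; exact (hx i h1).1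
          · rw [if_pos (by rw [show i = k by omega])]
        · rcases Nat.lt_or_ge i k with h1 | h1 <;> rcases Nat.lt_or_ge j k with h2 | h2
          · rw [if_neg (hne i h1), if_neg (hne j h2)]
            exact g5 i h1 j h2
          · obtain rfl : j = k := by omega
            rw [if_neg (hne i h1), if_pos rfl]
            exact iff_of_true (hx i h1).1 (hl i j h1.le hk)
          · obtain rfl : i = k := by omega
            rw [if_neg (hne j h2), if_pos rfl]
            exact (hx j h2).2
          · obtain rfl : i = k := by omega
            obtain rfl : i = j := by omega
            simp
      rw [block, block, block, block]
      simp only [wp, BinOp.eval, Mem.setReg_reg, Mem.setReg_arr, if_true, if_false,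
        Nat.reduceEqDiff, h40, h42, g1, a101, a2]
      refine ⟨by split_ifs <;> omega, fun h22 => ?_, fun h22 => ⟨by omega, ?_⟩⟩
      · have h1 : lab (d k) = lab (d (k - 1)) := by by_contra hcon; simp [hcon] at h22
        refine hpost (s'.reg 12) (by omega) (fun i hi => ⟨g4 i hi, ?_⟩) _
          (by simp [Mem.setReg_reg, h40]) (by simp [Mem.setReg_reg]) (by simp [Mem.setReg_reg]) rfl
        rw [← g3 (by omega), h1]
        exact g5 _ (by omega) _ hi
      · have h1 : lab (d k) ≠ lab (d (k - 1)) := by intro hcon; simp [hcon] at h22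
        have hk0 : k ≠ 0 := by rintro rfl; exact h1 rfl
        refine hpost (s'.reg 12 + 1) (by omega)
          (fun i hi => ⟨(g4 i hi).trans (Nat.le_succ _), ?_⟩) _
          (by simp [Mem.setReg_reg, h40]) (by simp [Mem.setReg_reg]) (by simp [Mem.setReg_reg]) rfl
        have h2 := g4 i hi
        have h3 := hl i (k - 1) (by omega) (by omega)
        have h4 := hl (k - 1) k (by omega) hk
        omega)
  refine Runs.block_singleton (hloop.mono (by simp [block, cost]) ?_)
  rintro s2 ⟨⟨-, g2, -, g4, g5⟩, -⟩
  refine ⟨fun e he => ?_, fun e he f hf => ?_⟩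
  · obtain ⟨i, hi, rfl⟩ := hd.surj he
    exact (g4 i hi).trans g2
  · obtain ⟨i, hi, rfl⟩ := hd.surj he
    obtain ⟨j, hj, rfl⟩ := hd.surj hf
    exact g5 i hi j hj

end Cmd
end WheelerBisim


namespace WheelerBisim

/-! ### Automata and their representation -/

section rank

variable {Q : Type*} [Fintype Q] [LinearOrder Q]

theorem rank_lt_rank {u v : Q} (h : u < v) : rank u < rank v := by
  refine Finset.card_lt_card (Finset.ssubset_iff_of_subset ?_ |>.2 ⟨u, by simp [h], by simp⟩)
  intro x hx
  simp only [Finset.mem_filter, Finset.mem_univ, true_and] at hx ⊢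
  exact hx.trans h

theorem rank_strictMono : StrictMono (rank : Q → ℕ) := fun _ _ => rank_lt_rank

theorem rank_lt_card (u : Q) : rank u < Fintype.card Q := by
  rw [← Finset.card_univ]
  exact Finset.card_lt_card (Finset.ssubset_iff_of_subset (Finset.filter_subset _ _) |>.2
    ⟨u, by simp, by simp⟩)

theorem exists_rank_eq {k : ℕ} (hk : k < Fintype.card Q) : ∃ u : Q, rank u = k := by
  have := Finset.surj_on_of_inj_on_of_card_le (s := (Finset.univ : Finset Q))
    (t := Finset.range (Fintype.card Q)) (fun u _ => rank u)
    (fun u _ => by simpa using rank_lt_card u) (fun u v _ _ h => rank_strictMono.injective h)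
    (by simp [Finset.card_univ]) k (by simpa using hk)
  obtain ⟨u, -, h⟩ := this
  exact ⟨u, h.symm⟩

theorem rank_mem_uIcc {x u v : Q} : rank x ∈ Set.uIcc (rank u) (rank v) ↔ x ∈ Set.uIcc u v := by
  simp only [Set.mem_uIcc, rank_strictMono.le_iff_le]

end rank

namespace Automaton

variable {Q Q' σ : Type*}

theorem IsTrim.exists_edge {A : Automaton Q σ} (h : A.IsTrim) {u : Q} (hu : u ≠ A.start) :
    ∃ v a, (v, u, a) ∈ A.edges := by
  rcases Relation.ReflTransGen.cases_tail (h u).1 with h1 | ⟨v, -, a, h2⟩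
  · exact absurd h1 hu
  · exact ⟨v, a, h2⟩

/-- Each state other than the initial one is reached through an edge, so targets cover all states
but one. This is what turns bounds in states and edges into bounds in edges alone. -/
theorem IsTrim.card_le [Fintype Q] [DecidableEq Q] {A : Automaton Q σ} (h : A.IsTrim) :
    Fintype.card Q ≤ A.edges.card + 1 := by
  have h1 : (Finset.univ.erase A.start) ⊆ A.edges.image fun e => e.2.1 := by
    intro u hu
    obtain ⟨v, a, hv⟩ := h.exists_edge (Finset.ne_of_mem_erase hu)
    exact Finset.mem_image.2 ⟨_, hv, rfl⟩
  have h2 := (Finset.card_le_card h1).trans Finset.card_image_le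
  rw [Finset.card_erase_of_mem (Finset.mem_univ _), Finset.card_univ] at h2
  omega

variable [Fintype Q] [LinearOrder Q] [Fintype Q'] [LinearOrder Q']

/-- The numbers in `J` represent the two automata, the states by their ranks; the order of the
labels in `J` is that of the codes `lbl` of the characters. -/
structure Encodes (A : Automaton Q σ) (A' : Automaton Q' σ) (J : EdgeData) (code : σ → ℕ)
    (lbl : ℕ → ℕ) : Prop where
  n : J.n = Fintype.card Q
  N : J.N = Fintype.card Q + Fintype.card Q'
  m_le : J.m ≤ J.M
  left : ∀ e < J.m, ∃ u v a, (u, v, a) ∈ A.edges ∧ lbl e = code a ∧ J.src e = rank u ∧ J.dst e = rank v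
  right : ∀ e, J.m ≤ e → e < J.M → ∃ u v a, (u, v, a) ∈ A'.edges ∧ lbl e = code a ∧
    J.src e = J.n + rank u ∧ J.dst e = J.n + rank v
  exists_left : ∀ u v a, (u, v, a) ∈ A.edges →
    ∃ e < J.m, lbl e = code a ∧ J.src e = rank u ∧ J.dst e = rank v
  exists_right : ∀ u v a, (u, v, a) ∈ A'.edges →
    ∃ e, J.m ≤ e ∧ e < J.M ∧ lbl e = code a ∧
      J.src e = J.n + rank u ∧ J.dst e = J.n + rank v
  lab : ∀ e < J.M, ∀ f < J.M, J.lab e ≤ J.lab f ↔ lbl e ≤ lbl f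
  fin_left : ∀ u : Q, J.fin (rank u) = if u ∈ A.final then 1 else 0
  fin_right : ∀ u : Q', J.fin (J.n + rank u) = if u ∈ A'.final then 1 else 0

variable {A : Automaton Q σ} {A' : Automaton Q' σ} {J : EdgeData} {code : σ → ℕ}
  {lbl : ℕ → ℕ}

theorem Encodes.lab_eq (h : A.Encodes A' J code lbl) {e f : ℕ} (he : e < J.M) (hf : f < J.M) :
    J.lab e = J.lab f ↔ lbl e = lbl f := by
  rw [le_antisymm_iff, le_antisymm_iff, h.lab e he f hf, h.lab f hf e he]

variable [LinearOrder σ]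

theorem IsWheeler.rank_start (h : A.IsWheeler) : rank A.start = 0 := by
  rw [rank, Finset.card_eq_zero, Finset.filter_eq_empty_iff]
  intro u _
  exact not_lt.2 (h.start_le u)

theorem Encodes.isJoint (h : A.Encodes A' J code lbl) (hc : StrictMono code) (hA : A.IsWheeler) (hA' : A'.IsWheeler) :
    J.IsJoint := by
  have hm := h.m_le
  have hn := h.n
  have hN := h.N
  have hpos : 0 < Fintype.card Q := Fintype.card_pos_iff.2 ⟨A.start⟩
  have hpos' : 0 < Fintype.card Q' := Fintype.card_pos_iff.2 ⟨A'.start⟩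
  have hlr : ∀ e < J.M, (e < J.m ∧ J.src e < J.n ∧ J.dst e < J.n) ∨
      (¬ e < J.m ∧ J.n ≤ J.src e ∧ J.n ≤ J.dst e ∧ J.src e < J.N ∧ J.dst e < J.N) := by
    intro e he
    rcases Nat.lt_or_ge e J.m with h1 | h1
    · obtain ⟨u, v, -, -, -, hu, hv⟩ := h.left e h1
      have := rank_lt_card u
      have := rank_lt_card v
      omega
    · obtain ⟨u, v, -, -, -, hu, hv⟩ := h.right e h1 he
      have := rank_lt_card u
      have := rank_lt_card v
      omega
  refine ⟨by omega, by omega, hm, fun e he => ?_, fun e he => ?_, fun e he => ?_, fun e he => ?_,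
    ?_, ?_, ?_⟩
  · have := hlr e he; omega
  · have := hlr e he; omega
  · have := hlr e he; omega
  · have := hlr e he; omega
  · intro e he f hf hh hd
    rw [h.lab e he f hf]
    rcases Nat.lt_or_ge e J.m with h1 | h1
    · obtain ⟨u, v, a, hE, ha, hu, hv⟩ := h.left e h1
      obtain ⟨u', v', a', hE', ha', hu', hv'⟩ := h.left f (hh.1 h1)
      rw [hv, hv', rank_strictMono.lt_iff_lt] at hd
      rw [ha, ha', hc.le_iff_le]
      exact hA.label_le _ _ _ _ _ _ hE hE' hd
    · obtain ⟨u, v, a, hE, ha, hu, hv⟩ := h.right e h1 he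
      obtain ⟨u', v', a', hE', ha', hu', hv'⟩ := h.right f (by omega) hf
      rw [hv, hv', Nat.add_lt_add_iff_left, rank_strictMono.lt_iff_lt] at hd
      rw [ha, ha', hc.le_iff_le]
      exact hA'.label_le _ _ _ _ _ _ hE hE' hd
  · intro e he f hf hh hl hd
    rw [h.lab_eq he hf] at hl
    rcases Nat.lt_or_ge e J.m with h1 | h1
    · obtain ⟨u, v, a, hE, ha, hu, hv⟩ := h.left e h1
      obtain ⟨u', v', a', hE', ha', hu', hv'⟩ := h.left f (hh.1 h1)
      rw [hv, hv', rank_strictMono.lt_iff_lt] at hd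
      rw [ha, ha'] at hl
      rw [← hc.injective hl] at hE'
      rw [hu, hu', rank_strictMono.le_iff_le]
      exact hA.source_le _ _ _ _ _ hE hE' hd
    · obtain ⟨u, v, a, hE, ha, hu, hv⟩ := h.right e h1 he
      obtain ⟨u', v', a', hE', ha', hu', hv'⟩ := h.right f (by omega) hf
      rw [hv, hv', Nat.add_lt_add_iff_left, rank_strictMono.lt_iff_lt] at hd
      rw [ha, ha'] at hl
      rw [← hc.injective hl] at hE'
      rw [hu, hu', Nat.add_le_add_iff_left, rank_strictMono.le_iff_le]
      exact hA'.source_le _ _ _ _ _ hE hE' hd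
  · intro P h0 h1 hstep v hv
    rcases Nat.lt_or_ge v J.n with h2 | h2
    · obtain ⟨u, rfl⟩ := exists_rank_eq (Q := Q) (hn ▸ h2)
      have : ∀ u, Relation.ReflTransGen A.Step A.start u → P (rank u) := by
        intro u hu
        induction hu with
        | refl => rwa [hA.rank_start]
        | tail _ hs ih =>
          obtain ⟨a, ha⟩ := hs
          obtain ⟨e, he, -, hu, hv⟩ := h.exists_left _ _ _ ha
          rw [← hv]
          exact hstep e (by omega) (by rwa [hu])
      exact this u (hA.trim u).1
    · obtain ⟨u, hu⟩ := exists_rank_eq (Q := Q') (k := v - J.n) (by omega)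
      obtain rfl : v = J.n + rank u := by omega
      have : ∀ u, Relation.ReflTransGen A'.Step A'.start u → P (J.n + rank u) := by
        intro u hu
        induction hu with
        | refl => rwa [hA'.rank_start]
        | tail _ hs ih =>
          obtain ⟨a, ha⟩ := hs
          obtain ⟨e, he, he', -, hu, hv⟩ := h.exists_right _ _ _ ha
          rw [← hv]
          exact hstep e (by omega) (by rwa [hu])
      exact this u (hA'.trim u).1

/-- `IsWB` asks for convexity only on intervals spanned by two related points. This is enough
because a convex set contains the interval between any two of its points; conversely, intervals are
convex sets. Unordered intervals appear since `R` need not preserve the order of individual states.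
-/
theorem Encodes.exists_iff (h : A.Encodes A' J code lbl) (hc : StrictMono code) (hA : A.IsWheeler) (hA' : A'.IsWheeler) :
    (∃ R, J.IsWB R) ↔ ∃ R : Q → Q' → Prop, A.IsWheelerBisimulation A' R := by
  have hm := h.m_le
  have hn := h.n
  have hN := h.N
  constructor
  · rintro ⟨R, hR⟩
    refine ⟨fun u u' => R (rank u) (J.n + rank u'), ⟨?_, ?_, ?_, ?_⟩, ?_, ?_⟩
    · intro u v u' a huu' hE
      obtain ⟨e, he, ha, hu, hv⟩ := h.exists_left _ _ _ hE
      rw [← hu] at huu'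
      obtain ⟨f, f1, f2, f3, f4, f5⟩ := hR.forth e he _ huu'
      obtain ⟨x, y, b, hE', hb, hx, hy⟩ := h.right f f1 f2
      rw [h.lab_eq f2 (by omega), ha, hb] at f4
      rw [hx, Nat.add_left_cancel_iff] at f3
      rw [rank_strictMono.injective f3, hc.injective f4] at hE'
      exact ⟨y, by rwa [hv, hy] at f5, hE'⟩
    · intro u u' v' a huu' hE
      obtain ⟨f, f1, f2, ha, hu, hv⟩ := h.exists_right _ _ _ hE
      rw [← hu] at huu'
      obtain ⟨e, he, f3, f4, f5⟩ := hR.back f f1 f2 _ huu'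
      obtain ⟨x, y, b, hE', hb, hx, hy⟩ := h.left e he
      rw [h.lab_eq f2 (by omega), ha, hb] at f4
      rw [hx] at f3
      rw [rank_strictMono.injective f3, ← hc.injective f4] at hE'
      exact ⟨y, by rwa [hv, hy] at f5, hE'⟩
    · simpa only [hA.rank_start, hA'.rank_start, add_zero] using hR.start
    · intro u u' huu'
      have := hR.fin _ _ huu'
      rw [h.fin_left, h.fin_right] at this
      split_ifs at this with h1 h2 <;> simp_all
    · intro D hD
      refine ⟨?_⟩
      rintro x' ⟨x, hx, hxx⟩ y' ⟨y, hy, hyy⟩ z' ⟨hz1, hz2⟩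
      obtain ⟨k, hk, hkz⟩ := hR.image _ _ _ _ (J.n + rank z') hxx hyy
        (Nat.add_le_add_left (rank_strictMono.monotone hz1) _)
        (Nat.add_le_add_left (rank_strictMono.monotone hz2) _)
      obtain ⟨z, rfl⟩ := exists_rank_eq (Q := Q) (hn ▸ (hR.dom _ _ hkz).1)
      exact ⟨z, hD.uIcc_subset hx hy (rank_mem_uIcc.1 hk), hkz⟩
    · intro D hD
      refine ⟨?_⟩
      rintro x ⟨x', hx, hxx⟩ y ⟨y', hy, hyy⟩ z ⟨hz1, hz2⟩
      obtain ⟨k, hk, hkz⟩ := hR.preimage _ _ _ _ (rank z) hxx hyy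
        (rank_strictMono.monotone hz1) (rank_strictMono.monotone hz2)
      have hd := hR.dom _ _ hkz
      obtain ⟨z', hz'⟩ := exists_rank_eq (Q := Q') (k := k - J.n) (by omega)
      obtain rfl : k = J.n + rank z' := by omega
      refine ⟨z', hD.uIcc_subset hx hy (rank_mem_uIcc.1 ?_), hkz⟩
      simp only [Set.mem_uIcc] at hk ⊢
      omega
  · rintro ⟨R, hR⟩
    refine ⟨fun x y => ∃ u u', R u u' ∧ rank u = x ∧ J.n + rank u' = y, ?_, ?_, ?_, ?_, ?_, ?_, ?_⟩
    · rintro _ _ ⟨u, u', -, rfl, rfl⟩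
      have := rank_lt_card u
      have := rank_lt_card u'
      omega
    · exact ⟨_, _, hR.bisim.start, hA.rank_start, by rw [hA'.rank_start, add_zero]⟩
    · rintro _ _ ⟨u, u', huu', rfl, rfl⟩
      rw [h.fin_left, h.fin_right]
      simp only [hR.bisim.final u u' huu']
    · rintro e he _ ⟨u, u', huu', hu, rfl⟩
      obtain ⟨x, y, a, hE, ha, hx, hy⟩ := h.left e he
      rw [hx] at hu
      rw [← rank_strictMono.injective hu] at hE
      obtain ⟨v', hv', hE'⟩ := hR.bisim.forth _ _ _ _ huu' hE
      obtain ⟨f, f1, f2, f3, f4, f5⟩ := h.exists_right _ _ _ hE'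
      exact ⟨f, f1, f2, f4, (h.lab_eq f2 (by omega)).2 (f3.trans ha.symm), y, v', hv', hy.symm, f5.symm⟩
    · rintro f f1 f2 _ ⟨u, u', huu', rfl, hu⟩
      obtain ⟨x, y, a, hE, ha, hx, hy⟩ := h.right f f1 f2
      rw [hx, Nat.add_left_cancel_iff] at hu
      rw [← rank_strictMono.injective hu] at hE
      obtain ⟨v, hv, hE'⟩ := hR.bisim.back _ _ _ _ huu' hE
      obtain ⟨e, f1, f3, f4, f5⟩ := h.exists_left _ _ _ hE'
      exact ⟨e, f1, f4, (h.lab_eq f2 (by omega)).2 (ha.trans f3.symm), v, y, hv, f5.symm, hy.symm⟩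
    · rintro _ _ _ _ z ⟨u, u', huu', rfl, rfl⟩ ⟨v, v', hvv', rfl, rfl⟩ h1 h2
      have := rank_lt_card v'
      obtain ⟨z', hz'⟩ := exists_rank_eq (Q := Q') (k := z - J.n) (by omega)
      obtain rfl : z = J.n + rank z' := by omega
      rw [Nat.add_le_add_iff_left, rank_strictMono.le_iff_le] at h1 h2
      obtain ⟨x, hx, hxz⟩ := (hR.image_convex (Set.uIcc u v) Set.ordConnected_uIcc).out
        ⟨u, Set.left_mem_uIcc, huu'⟩ ⟨v, Set.right_mem_uIcc, hvv'⟩ ⟨h1, h2⟩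
      exact ⟨rank x, rank_mem_uIcc.2 hx, x, z', hxz, rfl, rfl⟩
    · rintro _ _ _ _ z ⟨u, u', huu', rfl, rfl⟩ ⟨v, v', hvv', rfl, rfl⟩ h1 h2
      have := rank_lt_card v
      obtain ⟨z, rfl⟩ := exists_rank_eq (Q := Q) (k := z) (by omega)
      rw [rank_strictMono.le_iff_le] at h1 h2
      obtain ⟨x, hx, hxz⟩ := (hR.preimage_convex (Set.uIcc u' v') Set.ordConnected_uIcc).out
        ⟨u', Set.left_mem_uIcc, huu'⟩ ⟨v', Set.right_mem_uIcc, hvv'⟩ ⟨h1, h2⟩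
      refine ⟨J.n + rank x, ?_, z, x, hxz, rfl, rfl⟩
      have := rank_mem_uIcc.2 hx
      simp only [Set.mem_uIcc] at this ⊢
      omega

end Automaton

/-! ### Joining the two inputs in memory -/

namespace Cmd

variable {w : ℕ}

/-- Join the arrays of the two automata, the states of the second one following those of the first,
and prepare the input of the sorting program and the identity list. -/
def join : Cmd :=
  block [binop .add 4 1 3, binop .add 5 0 2, const 42 1, binop .add 6 4 42, binop .add 7 5 42,
    binop .land 100 4 4,
    forTo 3 (block [load 20 4 40, binop .add 20 20 0, binop .add 21 40 1, store 0 21 20,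
      load 20 5 40, binop .add 20 20 0, store 1 21 20, load 20 6 40, store 2 21 20]),
    forTo 2 (block [load 20 7 40, binop .add 21 40 0, store 3 21 20]),
    forTo 4 (block [load 20 2 40, store 100 40 20, store 9 40 40])]

/-- The registers after `join`. -/
structure Sizes (n m n' m' : ℕ) (s : Mem) : Prop where
  reg_n : s.reg 0 = n
  reg_m : s.reg 1 = m
  reg_n' : s.reg 2 = n'
  reg_m' : s.reg 3 = m'
  reg_M : s.reg 4 = m + m'
  reg_N : s.reg 5 = n + n'
  reg_M1 : s.reg 6 = m + m' + 1
  reg_N1 : s.reg 7 = n + n' + 1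
  len : s.reg 100 = m + m'

theorem Sizes.frame {n m n' m' : ℕ} {c : Cmd} {s s' : Mem} (h : Sizes n m n' m' s)
    (hf : c.Frame s s') (hr : ∀ x ∈ c.wregs, x ∉ [0, 1, 2, 3, 4, 5, 6, 7, 100]) :
    Sizes n m n' m' s' := by
  have hr' : ∀ x ∈ [0, 1, 2, 3, 4, 5, 6, 7, 100], s'.reg x = s.reg x :=
    fun x hx => hf.1 x fun h => hr x h hx
  exact ⟨(hr' 0 (by simp)).trans h.reg_n, (hr' 1 (by simp)).trans h.reg_m, (hr' 2 (by simp)).trans h.reg_n',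
    (hr' 3 (by simp)).trans h.reg_m', (hr' 4 (by simp)).trans h.reg_M, (hr' 5 (by simp)).trans h.reg_N,
    (hr' 6 (by simp)).trans h.reg_M1, (hr' 7 (by simp)).trans h.reg_N1, (hr' 100 (by simp)).trans h.len⟩

/-- `g` consists of the first `k` entries of `f`, followed by the first `l` values of `f'`. -/
def Joined (k l : ℕ) (f f' g : ℕ → ℕ) : Prop :=
  (∀ i < k, g i = f i) ∧ ∀ i < l, g (k + i) = f' i

theorem Joined.update {k l : ℕ} {f f' g : ℕ → ℕ} (h : Joined k l f f' g) :
    Joined k (l + 1) f f' (Function.update g (l + k) (f' l)) := by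
  refine ⟨fun i hi => ?_, fun i hi => ?_⟩
  · rw [Function.update_of_ne (by omega)]; exact h.1 i hi
  · rcases Nat.lt_or_ge i l with h1 | h1
    · rw [Function.update_of_ne (by omega)]; exact h.2 i h1
    · obtain rfl : i = l := by omega
      rw [Nat.add_comm, Function.update_self]

/-- The bounds on the entries of arrays `4` and `5` only ensure that adding `n` does not overflow.
The last clause keeps array `100` unchanged beyond the labels, where the sorting program expects
zeros. -/
theorem join_runs {s : Mem} {n m n' m' : ℕ} (h0 : s.reg 0 = n) (h1 : s.reg 1 = m)
    (h2 : s.reg 2 = n') (h3 : s.reg 3 = m') (hsrc : ∀ i < m', s.arr 4 i ≤ n')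
    (hdst : ∀ i < m', s.arr 5 i ≤ n') (hw : n + n' + m + m' + 3 ≤ 2 ^ w) :
    Runs w join s (30 * (n + n' + m + m' + 1)) (fun s' => Sizes n m n' m' s' ∧
      Joined m m' (s.arr 0) (fun i => s.arr 4 i + n) (s'.arr 0) ∧
      Joined m m' (s.arr 1) (fun i => s.arr 5 i + n) (s'.arr 1) ∧
      Joined m m' (s.arr 2) (s.arr 6) (s'.arr 2) ∧
      Joined n n' (s.arr 3) (s.arr 7) (s'.arr 3) ∧
      (∀ i < m + m', s'.arr 9 i = i) ∧
      (∀ i < m + m', s'.arr 100 i = s'.arr 2 i) ∧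
      ∀ i, m + m' ≤ i → s'.arr 100 i = s.arr 100 i) := by
  refine Runs.mono (T := 7 + (m' * 13 + 4 + (n' * 7 + 4 + ((m + m') * 7 + 4 + 1)))) ?_ (by omega)
    (fun _ h => h)
  have hpre : Runs w (block [binop .add 4 1 3, binop .add 5 0 2, const 42 1, binop .add 6 4 42,
      binop .add 7 5 42, binop .land 100 4 4]) s 7 (fun s' => Sizes n m n' m' s') := by
    refine Runs.of_wp ?_
    simp only [block, wp, BinOp.eval, Mem.setReg_reg, if_true, if_false, Nat.reduceEqDiff, h0, h1,
      h2, h3, Nat.and_self]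
    refine ⟨by omega, by omega, by omega, by omega, by omega, by omega, ?_, ?_, ?_, ?_, ?_, ?_, ?_,
      ?_, ?_⟩ <;> simp [Mem.setReg_reg, h0, h1, h2, h3]
  refine Runs.block_append (l₂ := [_, _, _]) hpre.frame ?_
  rintro s1 ⟨hS1, f1⟩
  have a1 : ∀ a, s1.arr a = s.arr a := fun a => f1.2 _ (by simp [block, warrs])
  clear hpre f1
  refine Runs.block_cons (Runs.frame ((Runs.forTo (w := w) (n := 3) (N := m')
    (fun k s' => Joined m k (s.arr 0) (fun i => s.arr 4 i + n) (s'.arr 0) ∧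
      Joined m k (s.arr 1) (fun i => s.arr 5 i + n) (s'.arr 1) ∧
      Joined m k (s.arr 2) (s.arr 6) (s'.arr 2))
    (by omega) hS1.reg_m' (by omega) (by simp [block, wregs])
    (by simp [Mem.setReg_arr, a1, Joined])
    (by
      rintro k s' hk ⟨j1, j2, j3⟩ hf h40 h42
      have hS' : Sizes n m n' m' s' := hS1.frame hf (by simp [block, forTo, wregs])
      have b4 : s'.arr 4 = s.arr 4 := (hf.2 _ (by simp [block, forTo, warrs])).trans (a1 _)
      have b5 : s'.arr 5 = s.arr 5 := (hf.2 _ (by simp [block, forTo, warrs])).trans (a1 _)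
      have b6 : s'.arr 6 = s.arr 6 := (hf.2 _ (by simp [block, forTo, warrs])).trans (a1 _)
      have c1 := hsrc k hk
      have c2 := hdst k hk
      simp only [block, wp, BinOp.eval, Mem.setReg_reg, Mem.setReg_arr, Mem.setArr_arr,
        Mem.setArr_reg, if_true, if_false, Nat.reduceEqDiff, h40, hS'.reg_n, hS'.reg_m, b4, b5, b6]
      exact ⟨by omega, by omega, by omega, fun _ => ⟨j1.update, j2.update, j3.update⟩⟩)).mono
    (by simp [block, cost]) fun _ h => h.1)) ?_
  rintro s2 ⟨⟨j1, j2, j3⟩, f2⟩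
  have hS2 : Sizes n m n' m' s2 := hS1.frame f2 (by simp [block, forTo, wregs])
  have a2 : ∀ a, 3 ≤ a → s2.arr a = s.arr a := fun a ha =>
    (f2.2 _ (by simp [block, forTo, warrs]; omega)).trans (a1 _)
  clear f2
  refine Runs.block_cons (Runs.frame ((Runs.forTo (w := w) (n := 2) (N := n')
    (fun k s' => Joined n k (s.arr 3) (s.arr 7) (s'.arr 3))
    (by omega) hS2.reg_n' (by omega) (by simp [block, wregs])
    (by simp [Mem.setReg_arr, a2, Joined])
    (by
      rintro k s' hk j4 hf h40 h42
      have hS' : Sizes n m n' m' s' := hS2.frame hf (by simp [block, forTo, wregs])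
      have b7 : s'.arr 7 = s.arr 7 :=
        (hf.2 _ (by simp [block, forTo, warrs])).trans (a2 _ (by norm_num))
      simp only [block, wp, BinOp.eval, Mem.setReg_reg, Mem.setReg_arr, Mem.setArr_arr,
        if_true, if_false, Nat.reduceEqDiff, h40, hS'.reg_n, b7]
      exact ⟨by omega, fun _ => j4.update⟩)).mono (by simp [block, cost]) fun _ h => h.1)) ?_
  rintro s3 ⟨j4, f3⟩
  have hS3 : Sizes n m n' m' s3 := hS2.frame f3 (by simp [block, forTo, wregs])
  have a3 : ∀ a, a ≠ 3 → s3.arr a = s2.arr a := fun a ha =>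
    f3.2 _ (by simp [block, forTo, warrs]; omega)
  rw [← a3 0 (by norm_num)] at j1
  rw [← a3 1 (by norm_num)] at j2
  rw [← a3 2 (by norm_num)] at j3
  clear f3
  have hloop := Runs.forTo (w := w) (n := 4) (N := m + m') (s := s3)
    (c := block [load 20 2 40, store 100 40 20, store 9 40 40])
    (fun k s' => (∀ i < k, s'.arr 9 i = i) ∧ (∀ i < k, s'.arr 100 i = s3.arr 2 i) ∧
      ∀ i, k ≤ i → s'.arr 100 i = s.arr 100 i)
    (by omega) hS3.reg_M (by omega) (by simp [block, wregs])
    (by simp [Mem.setReg_arr, a3, a2])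
    (by
      rintro k s' hk ⟨k1, k2, k3⟩ hf h40 h42
      have b2 : s'.arr 2 = s3.arr 2 := hf.2 _ (by simp [block, forTo, warrs])
      simp only [block, wp, Mem.setReg_reg, Mem.setReg_arr, Mem.setArr_arr,
        Mem.setArr_reg, if_true, if_false, Nat.reduceEqDiff, h40, b2]
      refine fun _ => ⟨fun i hi => ?_, fun i hi => ?_, fun i hi => ?_⟩
      · rw [Function.update_apply]
        split_ifs with h
        · exact h.symm
        · exact k1 i (by omega)
      · rw [Function.update_apply]
        split_ifs with h
        · rw [h]
        · exact k2 i (by omega)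
      · rw [Function.update_of_ne (by omega)]
        exact k3 i (by omega))
  refine Runs.block_singleton ((hloop.frame).mono (by simp [block, cost]) ?_)
  rintro s4 ⟨⟨⟨k1, k2, k3⟩, -⟩, f4⟩
  have a4 : ∀ a, a < 9 → s4.arr a = s3.arr a := fun a ha =>
    f4.2 _ (by simp [block, forTo, warrs]; omega)
  have hS4 : Sizes n m n' m' s4 := hS3.frame f4 (by simp [block, forTo, wregs])
  rw [a4 0 (by norm_num), a4 1 (by norm_num), a4 2 (by norm_num), a4 3 (by norm_num)]
  exact ⟨hS4, j1, j2, j3, j4, k1, k2, k3⟩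

end Cmd
end WheelerBisim


/-! ### Use of the sorting program and assembly of the decider -/

namespace WheelerBisim
namespace Cmd

variable {w : ℕ}

theorem Runs.shift {k T : ℕ} {c : Cmd} {s r : Mem} {P : Mem → Prop} (h : Runs w c s T P)
    (hr : Shifted k s r) : Runs w (c.shift k) r T (fun r' => ∃ s', P s' ∧ Shifted k s' r') := by
  obtain ⟨s', t, h1, h2, h3⟩ := h
  obtain ⟨r', h4, h5⟩ := exec_shift h1 r hr
  exact ⟨r', t, h4, h2, s', h3, h5⟩

end Cmd

theorem IsSortingOf.isListing {f : ℕ → ℕ} {l : List ℕ} (h : IsSortingOf f l) :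
    IsListing l.length f := by
  obtain ⟨π, hπ, -⟩ := h
  refine ⟨fun i hi => ?_, fun i hi j hj hij => ?_⟩
  · exact (hπ ⟨i, hi⟩).trans_lt (π ⟨i, hi⟩).2
  · have h1 := hπ ⟨i, hi⟩
    have h2 := hπ ⟨j, hj⟩
    simp only at h1 h2
    rw [h1, h2] at hij
    exact congrArg Fin.val (π.injective (Fin.ext hij))

theorem IsSortingOf.getD_le {f : ℕ → ℕ} {l : List ℕ} (h : IsSortingOf f l) {i j : ℕ} (hij : i ≤ j)
    (hj : j < l.length) : l.getD (f i) 0 ≤ l.getD (f j) 0 := by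
  obtain ⟨π, hπ, hm⟩ := h
  have h1 := hπ ⟨i, hij.trans_lt hj⟩
  have h2 := hπ ⟨j, hj⟩
  simp only at h1 h2
  have := hm (show (⟨i, hij.trans_lt hj⟩ : Fin l.length) ≤ ⟨j, hj⟩ from hij)
  rw [h1, h2, List.getD_eq_getElem _ _ (Fin.is_lt _), List.getD_eq_getElem _ _ (Fin.is_lt _)]
  exact this

namespace Cmd

variable {w : ℕ}

/-- Decide whether there is a Wheeler bisimulation, sorting the labels with the program `S`. -/
def decider (S : Cmd) : Cmd := block [join, S.shift 100, rankLabels, decideRanked]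

/-- The hypothesis `hp` isolates everything about automata: any edge data that carries the joined
arrays, with labels in the same order, is a correct encoding for the question `p`. -/
theorem decider_runs {S : Cmd} {T : ℕ} {s : Mem} {n m n' m' : ℕ} {l : List ℕ} {p : Prop}
    (h0 : s.reg 0 = n) (h1 : s.reg 1 = m) (h2 : s.reg 2 = n') (h3 : s.reg 3 = m')
    (hr : ∀ x, 100 < x → s.reg x = 0) (ha : ∀ a, 9 ≤ a → ∀ i, s.arr a i = 0)
    (hsrc : ∀ i < m', s.arr 4 i ≤ n') (hdst : ∀ i < m', s.arr 5 i ≤ n')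
    (hlen : l.length = m + m') (hl : Joined m m' (s.arr 2) (s.arr 6) fun i => l.getD i 0)
    (hS : Runs w S (Mem.ofInput [l.length] [l]) T fun s' => IsSortingOf (s'.arr 1) l)
    (hn : n ≤ m + 1) (hn' : n' ≤ m' + 1) (hw : 20 * (m + m' + 1) ≤ 2 ^ w)
    (hp : ∀ J : EdgeData, J.n = n → J.m = m → J.N = n + n' → J.M = m + m' →
      Joined m m' (s.arr 0) (fun i => s.arr 4 i + n) J.src →
      Joined m m' (s.arr 1) (fun i => s.arr 5 i + n) J.dst →
      Joined n n' (s.arr 3) (s.arr 7) J.fin →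
      (∀ e < m + m', ∀ f < m + m', J.lab e ≤ J.lab f ↔ l.getD e 0 ≤ l.getD f 0) →
      J.IsJoint ∧ ((∃ R, J.IsWB R) ↔ p)) :
    Runs w (decider S) s (1500 * (m + m' + 1) + T) (fun s' => Tells s' 0 p) := by
  refine Runs.mono (T := 30 * (n + n' + m + m' + 1) + (T + (20 * (m + m' + 1) +
    (400 * ((m + m') + (n + n') + 1) + 1)))) ?_ (by omega) (fun _ h => h)
  refine Runs.block_cons (join_runs h0 h1 h2 h3 hsrc hdst (by omega)).frame ?_
  rintro s1 ⟨⟨hS1, j1, j2, j3, j4, k1, k2, k3⟩, f1⟩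
  have r1 : ∀ x, 100 < x → s1.reg x = 0 := fun x hx =>
    (f1.1 x (by simp [join, block, forTo, wregs]; omega)).trans (hr x hx)
  have a1 : ∀ a, 10 ≤ a → a ≠ 100 → ∀ i, s1.arr a i = 0 := fun a h h' i => by
    rw [f1.2 a (by simp [join, block, forTo, warrs]; omega)]; exact ha a (by omega) i
  have hl2 : ∀ i < m + m', s1.arr 2 i = l.getD i 0 := by
    intro i hi
    rcases Nat.lt_or_ge i m with h | h
    · exact (j3.1 i h).trans (hl.1 i h).symm
    · have e1 := j3.2 (i - m) (by omega)
      have e2 := hl.2 (i - m) (by omega)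
      rw [Nat.add_sub_cancel' h] at e1 e2
      exact e1.trans e2.symm
  -- From number `100` on, registers and arrays must look exactly like the initial memory of `S`,
  -- zeros included.
  have hsh : Shifted 100 (Mem.ofInput [l.length] [l]) s1 := by
    refine ⟨fun x => ?_, fun a => funext fun i => ?_⟩
    · cases x with
      | zero => exact hS1.len.trans hlen.symm
      | succ x => rw [r1 _ (by omega)]; simp [Mem.ofInput]
    · cases a with
      | zero =>
        show s1.arr 100 i = l.getD i 0
        rcases Nat.lt_or_ge i (m + m') with h | h
        · rw [k2 i h, hl2 i h]
        · rw [k3 i h, ha 100 (by norm_num), List.getD_eq_default _ _ (by omega)]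
      | succ a => rw [a1 _ (by omega) (by omega)]; simp [Mem.ofInput]
  refine Runs.block_cons (hS.shift hsh).frame ?_
  rintro s2 ⟨⟨q, hq, hq'⟩, f2⟩
  have hlow : ∀ x < 100, s2.reg x = s1.reg x := fun x hx =>
    f2.1 x fun h => by have := le_of_mem_wregs_shift h; omega
  have alow : ∀ a < 100, s2.arr a = s1.arr a := fun a h' =>
    f2.2 a fun h => by have := le_of_mem_warrs_shift h; omega
  have h101 : IsSortingOf (s2.arr 101) l := by rw [← hq'.2 1] at hq; exact hq
  have hlist := h101.isListing
  rw [hlen] at hlist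
  refine Runs.block_cons (rankLabels_runs (w := w) (M := m + m')
    ((hlow 4 (by norm_num)).trans hS1.reg_M) hlist (fun i j hij hj => ?_) (by omega)).frame ?_
  · rw [alow 2 (by norm_num), hl2 _ (hlist.1 i (by omega)), hl2 _ (hlist.1 j hj)]
    exact h101.getD_le hij (by omega)
  rintro s3 ⟨⟨d1, d2⟩, f3⟩
  have r3 : ∀ x < 10, s3.reg x = s1.reg x := fun x hx =>
    (f3.1 x (by simp [rankLabels, block, forTo, wregs]; omega)).trans (hlow x (by omega))
  have a3 : ∀ a < 100, a ≠ 8 → s3.arr a = s1.arr a := fun a hx hx' =>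
    (f3.2 a (by simp [rankLabels, block, forTo, warrs]; omega)).trans (alow a (by omega))
  let J : EdgeData := ⟨n, m, n + n', m + m', s3.arr 0, s3.arr 1, s3.arr 8, s3.arr 3⟩
  have hJ : J.IsJoint ∧ ((∃ R, J.IsWB R) ↔ p) := by
    refine hp J rfl rfl rfl rfl ?_ ?_ ?_ fun e he f hf => ?_
    · show Joined _ _ _ _ (s3.arr 0); rwa [a3 0 (by norm_num) (by norm_num)]
    · show Joined _ _ _ _ (s3.arr 1); rwa [a3 1 (by norm_num) (by norm_num)]
    · show Joined _ _ _ _ (s3.arr 3); rwa [a3 3 (by norm_num) (by norm_num)]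
    · rw [← hl2 e he, ← hl2 f hf, ← alow 2 (by norm_num)]
      exact d2 e he f hf
  have hold : Holds J s3 :=
    ⟨(r3 0 (by norm_num)).trans hS1.reg_n, (r3 1 (by norm_num)).trans hS1.reg_m,
      (r3 4 (by norm_num)).trans hS1.reg_M, (r3 5 (by norm_num)).trans hS1.reg_N,
      (r3 6 (by norm_num)).trans hS1.reg_M1, (r3 7 (by norm_num)).trans hS1.reg_N1,
      rfl, rfl, rfl, rfl⟩
  refine Runs.block_singleton ((decideRanked_runs hJ.1 hold d1 (fun i hi => ?_)
    (fun a h h' i => ?_) ?_).mono le_rfl fun s4 h4 => h4.congr hJ.2)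
  · rw [a3 9 (by norm_num) (by norm_num)]; exact k1 i hi
  · rw [a3 a (by omega) (by omega)]; exact a1 a h (by omega) i
  · show 2 * ((n + n') + (m + m') + 5) ≤ 2 ^ w
    omega

end Cmd

namespace Automaton

variable {Q Q' σ : Type*}

theorem IsEdgeList.length_eq {A : Automaton Q σ} {L : List (Q × Q × σ)} (h : A.IsEdgeList L) :
    L.length = A.edges.card := by
  classical
  rw [← List.toFinset_card_of_nodup h.1]
  congr 1
  ext e
  simp [h.2]

variable [Fintype Q] [LinearOrder Q] [Fintype Q'] [LinearOrder Q'] {A : Automaton Q σ}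
  {A' : Automaton Q' σ} {L : List (Q × Q × σ)} {L' : List (Q' × Q' × σ)}

theorem finalBits_getD_rank (u : Q) :
    A.finalBits.getD (rank u) 0 = if u ∈ A.final then 1 else 0 := by
  rw [finalBits, List.getD_eq_getElem _ _ (by simpa using rank_lt_card u)]
  simp [rank_strictMono.injective.eq_iff]

theorem encodes_of_joined {code : σ → ℕ} (hL : A.IsEdgeList L) (hL' : A'.IsEdgeList L')
    {J : EdgeData} {l : List ℕ} (hl : l = labels code L ++ labels code L')
    (hn : J.n = Fintype.card Q) (hm : J.m = L.length)
    (hN : J.N = Fintype.card Q + Fintype.card Q') (hM : J.M = L.length + L'.length)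
    (hsrc : Cmd.Joined L.length L'.length (fun i => (L.map fun e => rank e.1).getD i 0)
      (fun i => (L'.map fun e => rank e.1).getD i 0 + Fintype.card Q) J.src)
    (hdst : Cmd.Joined L.length L'.length (fun i => (L.map fun e => rank e.2.1).getD i 0)
      (fun i => (L'.map fun e => rank e.2.1).getD i 0 + Fintype.card Q) J.dst)
    (hfin : Cmd.Joined (Fintype.card Q) (Fintype.card Q') (fun i => A.finalBits.getD i 0)
      (fun i => A'.finalBits.getD i 0) J.fin)
    (hlab : ∀ e < J.M, ∀ f < J.M, J.lab e ≤ J.lab f ↔ l.getD e 0 ≤ l.getD f 0) :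
    A.Encodes A' J code fun e => l.getD e 0 := by
  have hleft : ∀ e (he : e < L.length), l.getD e 0 = code L[e].2.2 ∧ J.src e = rank L[e].1 ∧
      J.dst e = rank L[e].2.1 := by
    intro e he
    rw [hsrc.1 e he, hdst.1 e he, hl, List.getD_append _ _ _ _ (by simpa [labels] using he)]
    simp [labels, he]
  have hright : ∀ e (he : e < L'.length), l.getD (L.length + e) 0 = code L'[e].2.2 ∧
      J.src (L.length + e) = J.n + rank L'[e].1 ∧
      J.dst (L.length + e) = J.n + rank L'[e].2.1 := by
    intro e he
    rw [hsrc.2 e he, hdst.2 e he, hl, List.getD_append_right _ _ _ _ (by simp [labels])]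
    simp [labels, he, hn, Nat.add_comm]
  refine ⟨hn, hN, by omega, ?_, ?_, ?_, ?_, hlab, ?_, ?_⟩
  · intro e he
    rw [hm] at he
    exact ⟨_, _, _, (hL.2 _).1 (List.getElem_mem he), hleft e he⟩
  · intro e he he'
    have h := hright (e - L.length) (by omega)
    rw [Nat.add_sub_cancel' (by omega)] at h
    exact ⟨_, _, _, (hL'.2 _).1 (List.getElem_mem (by omega)), h⟩
  · intro u v a h
    obtain ⟨e, he, hE⟩ := List.getElem_of_mem ((hL.2 _).2 h)
    have := hleft e he
    rw [hE] at this
    exact ⟨e, by omega, this⟩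
  · intro u v a h
    obtain ⟨e, he, hE⟩ := List.getElem_of_mem ((hL'.2 _).2 h)
    have := hright e he
    rw [hE] at this
    exact ⟨L.length + e, by omega, by omega, this⟩
  · intro u
    rw [hfin.1 _ (rank_lt_card u)]
    exact finalBits_getD_rank u
  · intro u
    rw [hn, hfin.2 _ (rank_lt_card u)]
    exact finalBits_getD_rank u

end Automaton
end WheelerBisim

theorem mainTheorem8 (𝓛 : ℕ → Set (List ℕ)) (h𝓛 : WheelerBisim.SortableInLinearTime 𝓛) :
    ∃ (P : WheelerBisim.Cmd) (K C : ℕ),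
      ∀ (Q Q' σ : Type*) [Fintype Q] [LinearOrder Q] [Fintype Q'] [LinearOrder Q']
        [Finite σ] [LinearOrder σ]
        (A : WheelerBisim.Automaton Q σ) (A' : WheelerBisim.Automaton Q' σ)
        (code : σ → ℕ) (L : List (Q × Q × σ)) (L' : List (Q' × Q' × σ)) (w : ℕ),
        A.IsWheeler → A'.IsWheeler → StrictMono code →
        A.IsEdgeList L → A'.IsEdgeList L' →
        K * (A.edges.card + A'.edges.card + 1) ≤ 2 ^ w →
        (∀ a ∈ WheelerBisim.Automaton.labels code L ++ WheelerBisim.Automaton.labels code L',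
          a < 2 ^ w) →
        WheelerBisim.Automaton.labels code L ++ WheelerBisim.Automaton.labels code L' ∈ 𝓛 w →
        ∃ (s : WheelerBisim.Mem) (t : ℕ),
          WheelerBisim.Exec w P (A.inputPair A' code L L') s t ∧
          t ≤ C * (A.edges.card + A'.edges.card + 1) ∧
          ((∃ R : Q → Q' → Prop, A.IsWheelerBisimulation A' R) → s.reg 0 = 1) ∧
          ((¬ ∃ R : Q → Q' → Prop, A.IsWheelerBisimulation A' R) → s.reg 0 = 0) := by
  obtain ⟨S, K, C, hS⟩ := h𝓛
  -- `K` and `C` serve the single run of `S`; `20` keeps all sums and counters of the remaining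
  -- program within a word, and `1500` bounds its steps.
  refine ⟨WheelerBisim.Cmd.decider S, K + 20, 1500 + C, ?_⟩
  intro Q Q' σ _ _ _ _ _ _ A A' code L L' w hA hA' hc hL hL' hw hlt hmem
  rw [Nat.add_mul] at hw
  have hm := hL.length_eq
  have hm' := hL'.length_eq
  have hlen : (WheelerBisim.Automaton.labels code L ++
      WheelerBisim.Automaton.labels code L').length = A.edges.card + A'.edges.card := by
    simp [WheelerBisim.Automaton.labels, hm, hm']
  have hbound : ∀ (g : Q' × Q' × σ → Q') (i : ℕ),
      (L'.map fun e => WheelerBisim.rank (g e)).getD i 0 ≤ Fintype.card Q' := by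
    intro g i
    rcases Nat.lt_or_ge i L'.length with h | h
    · rw [List.getD_eq_getElem _ _ (by simpa using h), List.getElem_map]
      exact (WheelerBisim.rank_lt_card _).le
    · rw [List.getD_eq_default _ _ (by simpa using h)]
      exact Nat.zero_le _
  obtain ⟨s, t, h1, h2, h3⟩ := WheelerBisim.Cmd.decider_runs (w := w) (S := S)
    (T := C * (A.edges.card + A'.edges.card + 1)) (s := A.inputPair A' code L L')
    (n := Fintype.card Q) (m := A.edges.card) (n' := Fintype.card Q') (m' := A'.edges.card)
    (p := ∃ R : Q → Q' → Prop, A.IsWheelerBisimulation A' R)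
    rfl rfl rfl rfl
    (fun x hx => List.getD_eq_default _ _ (by simp; omega))
    (fun a ha i => by
      show (List.getD _ a []).getD i 0 = 0
      rw [List.getD_eq_default (n := a) _ _ (by simp [WheelerBisim.Automaton.arrays]; omega)]
      rfl)
    (fun i _ => hbound (fun e => e.1) i) (fun i _ => hbound (fun e => e.2.1) i) hlen
    ⟨fun i hi => List.getD_append _ _ _ _ (by simpa [WheelerBisim.Automaton.labels, hm] using hi),
      fun i _ => by
        have : (WheelerBisim.Automaton.labels code L).length = A.edges.card := by
          simp [WheelerBisim.Automaton.labels, hm]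
        refine (List.getD_append_right _ _ _ _ (by omega)).trans ?_
        rw [this, Nat.add_sub_cancel_left]
        rfl⟩
    (by
      obtain ⟨s, t, h1, h2, h3⟩ := hS w _ hmem hlt (by rw [hlen]; omega)
      exact ⟨s, t, h1, by rwa [hlen] at h2, h3⟩)
    hA.trim.card_le hA'.trim.card_le (by omega)
    (fun J e1 e2 e3 e4 e5 e6 e7 e8 => by
      have hE := WheelerBisim.Automaton.encodes_of_joined hL hL' (J := J) (code := code) rfl e1
        (e2.trans hm.symm) e3 (by rw [e4, hm, hm']) (by rw [hm, hm']; exact e5)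
        (by rw [hm, hm']; exact e6) e7 (by rw [e4]; exact e8)
      exact ⟨hE.isJoint hc hA hA', hE.exists_iff hc hA hA'⟩)
  exact ⟨s, t, h1, by rw [Nat.add_mul]; omega, h3⟩
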